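/- Let $n\ge 1$ and let $a,b,c\in C^\infty(\mathbb R^n)$ satisfy, for all $x\in\mathbb R^n$, $$a_0(1+|x|)^{-\alpha}\le a(x)\le a_1(1+|x|)^{-\alpha},\quad b_0(1+|x|)^{\beta}\le b(x)\le b_1(1+|x|)^{\beta},\quad c_0(1+|x|)^{-\gamma}\le c(x)\le c_1(1+|x|)^{-\gamma},$$ where $a_i,b_i,c_i>0$ and the real exponents $\alpha,\beta,\gamma$ satisfy $\beta+\gamma<2$ and $2\alpha+\beta-\gamma<2$. Let $q\in C^1([0,\infty))$ satisfy $0<q'(|x|)\le\sqrt{c(x)/b(x)}$ for all $x\in\mathbb R^n$ and $q(r)\ge q_0 r^{1-(\beta+\gamma)/2}$ for all $r\ge0$, for some $q_0>0$. Let $R\ge 0$, $\theta>0$, let $k\ge0$ be an integer, let $$\max\Big\{0,\frac{2(\alpha-\gamma)}{2-\beta-\gamma}\Big\}<\omega<1,$$ and put $\nu=\theta+\omega$ and $\sigma=2k+\max\big\{0,\frac{2(\gamma-\alpha)}{2-\beta-\gamma}-\omega\big\}$. For a function $w=w(x,t)$ write $$E(t;w)=\frac12\int_{\mathbb R^n}\big(c\,w_t^2+b\,|\nabla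 w|^2\big)\,dx .$$ Then there are constants $T_*>0$ and $C>0$, depending only on the data listed so far, such that the following holds for all $T\ge T_0\ge T_*$. Let $h$ be smooth on $\mathbb R^n\times(0,\infty)$ with $h\in L^\infty([0,\infty);L^2(\mathbb R^n))$ and $h(x,t)=0$ whenever $t>0$ and $q(|x|)>t+q(R)$. Let $u_0\in H^1(\mathbb R^n)$ and $u_1\in L^2(\mathbb R^n)$ vanish for $|x|>R$, and let $u\in C([0,\infty);H^1(\mathbb R^n))\cap C^1([0,\infty);L^2(\mathbb R^n))$ be the weak solution of $$c(x)u_{tt}-\operatorname{div}(b(x)\nabla u)+a(x)u_t=h(x,t)\quad(x\in\mathbb R^n,\ t>0),\qquad u|_{t=0}=u_0,\quad u_t|_{t=0}=u_1.$$ Assume that the energies below are defined, that is, $\partial_t^iu\in C((0,\infty);H^1(\mathbb R^n))\cap C^1((0,\infty);L^2(\mathbb R^n))$ for $0\le i\le k$. Then $$\int_{T_0}^T(1+t)^{\theta+2k}E(t;\partial_t^ku)\,dt\le C\Big[(1+T_0)^{\sigma}(1+T_0)^{\nu}\sum_{i=0}^kE(T_0;\partial_t^iu)+\int_{T_0}^T(1+t)^{\theta}E(t;u)\,dt+\int_{T_0}^T\!\!\int_{\mathbb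 R^n}(1+t)^{\theta+1}a^{-1}\sum_{i=0}^k(1+t)^{2i}(\partial_t^ih)^2\,dx\,dt\Big].$$ In particular, for each fixed $T_0\ge T_*$ the same estimate holds without the factor $(1+T_0)^{\sigma}$, with a constant that depends also on $T_0$ but not on $T$, $u$ or $h$. -/

import Mathlib

open MeasureTheory Set
open scoped ENNReal ContDiff

noncomputable section

namespace DampedWave

/-- The Euclidean space `ℝⁿ`. -/
abbrev Space (n : ℕ) : Type := EuclideanSpace ℝ (Fin n)

/-- `L²(ℝⁿ)`. -/
abbrev L2 (n : ℕ) : Type := Lp ℝ 2 (volume : Measure (Space n))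

/-- `L²(ℝⁿ; ℝⁿ)`, square integrable vector fields. -/
abbrev L2Vec (n : ℕ) : Type := Lp (Space n) 2 (volume : Measure (Space n))

/-- Test functions: the class `C_c^∞(ℝⁿ)`. -/
def IsTest {n : ℕ} (φ : Space n → ℝ) : Prop :=
  ContDiff ℝ ∞ φ ∧ HasCompactSupport φ

/-- `g` is the distributional gradient of `f`. -/
def HasWeakGrad {n : ℕ} (f : L2 n) (g : L2Vec n) : Prop :=
  ∀ φ : Space n → ℝ, IsTest φ → ∫ x, f x • gradient φ x = - ∫ x, φ x • g x

/-- Membership in the Sobolev space `H¹(ℝⁿ)`. -/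
def MemH1 {n : ℕ} (f : L2 n) : Prop := ∃ g : L2Vec n, HasWeakGrad f g

open Classical in
/-- The weak gradient of an `H¹` function (and `0` for functions outside `H¹`). -/
def weakGrad {n : ℕ} (f : L2 n) : L2Vec n :=
  if hf : MemH1 f then hf.choose else 0

/-- `w ∈ C(I; H¹(ℝⁿ))`. -/
def ContinuousInH1 {n : ℕ} (w : ℝ → L2 n) (I : Set ℝ) : Prop :=
  (∀ t ∈ I, MemH1 (w t)) ∧ ContinuousOn w I ∧ ContinuousOn (fun t => weakGrad (w t)) I

/-- The two-sided power bound `m (1+|x|)^σ ≤ f(x) ≤ M (1+|x|)^σ`, with `m, M > 0`. -/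
def PowerBounds {n : ℕ} (f : Space n → ℝ) (m M σ : ℝ) : Prop :=
  0 < m ∧ 0 < M ∧ ∀ x, m * (1 + ‖x‖) ^ σ ≤ f x ∧ f x ≤ M * (1 + ‖x‖) ^ σ

/-- The function `q` which measures the growth of supports: `q ∈ C¹([0,∞))` with
`0 < q'(|x|) ≤ √(c(x)/b(x))` and `q(r) ≥ q₀ r^{1-(β+γ)/2}` for some `q₀ > 0`. -/
structure IsSupportGauge {n : ℕ} (b c : Space n → ℝ) (β γ : ℝ) (q : ℝ → ℝ) : Prop where
  contDiffOn : ContDiffOn ℝ 1 q (Ici 0)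
  deriv_pos : ∀ x : Space n, 0 < derivWithin q (Ici 0) ‖x‖
  deriv_le : ∀ x : Space n, derivWithin q (Ici 0) ‖x‖ ≤ √(c x / b x)
  growth : ∃ q₀ : ℝ, 0 < q₀ ∧ ∀ r : ℝ, 0 ≤ r → q₀ * r ^ (1 - (β + γ) / 2) ≤ q r

/-- Admissible sources: `h` is smooth on `ℝⁿ × (0,∞)`, belongs to `L^∞([0,∞); L²(ℝⁿ))`, and
`h(x,t) = 0` whenever `q(|x|) > t + q(R)`. -/
structure IsSource {n : ℕ} (q : ℝ → ℝ) (R : ℝ) (h : Space n → ℝ → ℝ) : Prop where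
  smooth : ContDiffOn ℝ ∞ (fun p : Space n × ℝ => h p.1 p.2) (univ ×ˢ Ioi 0)
  bounded : ∃ M : ℝ, ∀ᵐ t ∂(volume.restrict (Ioi (0 : ℝ))),
    eLpNorm (fun x => h x t) 2 volume ≤ ENNReal.ofReal M
  support : ∀ x t, 0 < t → t + q R < q ‖x‖ → h x t = 0

/-- `u ∈ C([0,∞); H¹) ∩ C¹([0,∞); L²)` is the (weak, finite energy) solution of
`c u_tt - div(b ∇u) + a u_t = h` for `t > 0`, with `u = u₀`, `u_t = u₁` at `t = 0`. -/
structure IsSolution {n : ℕ} (a b c : Space n → ℝ) (h : Space n → ℝ → ℝ) (u₀ u₁ : L2 n)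
    (u : ℝ → L2 n) : Prop where
  continuous_H1 : ContinuousInH1 u (Ici 0)
  contDiffOn : ContDiffOn ℝ 1 u (Ici 0)
  initial : u 0 = u₀
  initial_deriv : derivWithin u (Ici 0) 0 = u₁
  equation : ∀ φ : Space n → ℝ, IsTest φ → ∀ t : ℝ, 0 < t →
    HasDerivAt (fun s => ∫ x, c x * deriv u s x * φ x)
      ((∫ x, h x t * φ x) - (∫ x, a x * deriv u t x * φ x)
        - ∫ x, b x * inner ℝ (weakGrad (u t) x) (gradient φ x)) t

/-- `∂_t^i u ∈ C((0,∞); H¹) ∩ C¹((0,∞); L²)` for every `0 ≤ i ≤ k`: the class in which the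
energies of `u, ∂_t u, …, ∂_t^k u` are defined. -/
def TimeRegular {n : ℕ} (k : ℕ) (u : ℝ → L2 n) : Prop :=
  ContDiffOn ℝ ((k + 1 : ℕ) : ℕ∞) u (Ioi 0) ∧
    ∀ i ≤ k, ContinuousInH1 (iteratedDeriv i u) (Ioi 0)

/-- The energy `E(t;w) = ½ ∫ (c w_t² + b |∇w|²) dx`, with values in `[0,∞]`. -/
def energy {n : ℕ} (b c : Space n → ℝ) (w : ℝ → L2 n) (t : ℝ) : ℝ≥0∞ :=
  (1 / 2) * ∫⁻ x, ENNReal.ofReal (c x * (deriv w t x) ^ 2 + b x * ‖weakGrad (w t) x‖ ^ 2)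

end DampedWave

end

/-!
The solution is estimated one time derivative at a time. Write `w = ∂_t^i u`, `z = 1 + t`, and let
`e`, `E` be the energies of `w` and `w_t`. With `p = θ + 2i` the functional
`Φ = A z^{p+1} e + z^{p+2+ω} E + z^{p+2} ∫ (c w_tt w_t + ½ a w_t²)` satisfies
`Φ' ≤ C z^p e - z^{p+2} E + (source terms)`: the last summand of `Φ` produces
`z^{p+2} ∫ (c w_tt² - b |∇w_t|²)`, and its good part `-2 z^{p+2} E` is what is kept. The term
`2 z^{p+2} ∫ c w_tt²` is absorbed by the dissipation `-z^{p+2+ω} ∫ a w_tt²` of the second summand,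
and all terms with `∫ a w_t²` are absorbed by the dissipation `-A z^{p+1} ∫ a w_t²` of the first
one. Integration (`integral_energy_deriv_le`) bounds `∫ z^{p+2} E` by `∫ z^p e`, the sources and
`Φ(T₀)`; iteration over `i < k` gives the theorem.

The absorption needs `c ≤ ε z^ω a` on the support of the solution at time `t`. By finite speed of
propagation, `q(|x|) ≤ t + q(R)` there, hence `1 + |x| ≤ L z^{2/(2-β-γ)}` by the growth of `q`, and
`c / a ≤ K (1 + |x|)^{α-γ}` is at most `K' z^{max(0, 2(α-γ)/(2-β-γ))}`, which is small compared
with `z^ω` for large `t`. In the same way `a / c` is bounded by a power of `z`, so that `Φ(T₀)` is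
bounded by the energies at time `T₀` with the weight of the theorem.

Three points are not formal, as `u` is only a weak solution.

* The equation is given for smooth test functions, and is needed for the test functions `w` and
  `w_t`. Mollification extends it to compactly supported elements of `H¹`
  (`HasWeakGrad.extend_test`, `IsSolution.equation_testPairs`).
* Finite speed of propagation (`IsSolution.ae_eq_zero`) follows from monotonicity of the energy of
  `u` weighted by a `C¹` cutoff to a backward cone. The slope of the cone is `q' ≤ √(c/b)`, so that
  the flux through its lateral boundary has a sign.
* For `i + 1 = k` the function `w_tt` need not have a weak gradient, so the equation for `w_t`
  cannot be tested with it. The identities for `w_t` are obtained for the difference quotients of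
  `w` instead, which converge locally uniformly in time (`hasDerivAt_energy_mixed_deriv`).

As everything happens in a fixed ball up to time `T + 1`, the coefficients can be truncated to that
ball, where they act as bounded operators on `L²`.
-/

open MeasureTheory Set
open scoped ENNReal ContDiff

noncomputable section

namespace DampedWave

/-! ### Multiplication operators on `L²` -/

section

variable {n : ℕ} {E : Type*} [NormedAddCommGroup E] {p : ℝ≥0∞}

open Classical in
/-- The class of `f` in `Lᵖ(ℝⁿ; E)`, and `0` if `f` is not in `Lᵖ`. -/
def lpOf (p : ℝ≥0∞) (f : Space n → E) : Lp E p (volume : Measure (Space n)) :=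
  if h : MemLp f p volume then h.toLp f else 0

lemma coeFn_lpOf {f : Space n → E} (h : MemLp f p volume) : lpOf p f =ᵐ[volume] f := by
  rw [lpOf, dif_pos h]; exact h.coeFn_toLp

/-- A function that is bounded by `M` and vanishes outside a ball. -/
lemma memLp_of_bound {f : Space n → E} (p : ℝ≥0∞) (hf : AEStronglyMeasurable f volume) {M ρ : ℝ}
    (hM : ∀ x ∈ Metric.closedBall (0 : Space n) ρ, ‖f x‖ ≤ M)
    (h0 : ∀ x, x ∉ Metric.closedBall (0 : Space n) ρ → f x = 0) : MemLp f p volume := by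
  have h1 : (Metric.closedBall (0 : Space n) ρ).indicator f = f := by
    ext x
    by_cases hx : x ∈ Metric.closedBall (0 : Space n) ρ
    · simp [indicator_of_mem hx]
    · rw [indicator_of_notMem hx, h0 x hx]
  rw [← h1, memLp_indicator_iff_restrict measurableSet_closedBall]
  have : IsFiniteMeasure ((volume : Measure (Space n)).restrict (Metric.closedBall 0 ρ)) :=
    ⟨by rw [Measure.restrict_apply_univ]; exact measure_closedBall_lt_top⟩
  exact MemLp.of_bound hf.restrict M
    ((ae_restrict_iff' measurableSet_closedBall).2 (.of_forall hM))

variable [InnerProductSpace ℝ E]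

/-- Multiplication of square integrable functions by essentially bounded ones, as a bilinear map. -/
def mulL (n : ℕ) (E : Type*) [NormedAddCommGroup E] [InnerProductSpace ℝ E] :
    Lp ℝ ⊤ (volume : Measure (Space n)) →L[ℝ]
      Lp E 2 (volume : Measure (Space n)) →L[ℝ] Lp E 2 (volume : Measure (Space n)) :=
  (ContinuousLinearMap.lsmul ℝ ℝ).holderL volume ⊤ 2 2

/-- Multiplication of square integrable functions by a bounded function `m`; the zero operator
if `m` is not essentially bounded. -/
def mul (m : Space n → ℝ) :
    Lp E 2 (volume : Measure (Space n)) →L[ℝ] Lp E 2 (volume : Measure (Space n)) :=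
  mulL n E (lpOf ⊤ m)

lemma coeFn_mul {m : Space n → ℝ} (hm : MemLp m ∞ volume)
    (f : Lp E 2 (volume : Measure (Space n))) : mul m f =ᵐ[volume] fun x => m x • f x := by
  rw [mul, mulL, ContinuousLinearMap.holderL_apply_apply]
  filter_upwards [ContinuousLinearMap.coeFn_holder (r := 2)
    (ContinuousLinearMap.lsmul ℝ ℝ : ℝ →L[ℝ] E →L[ℝ] E) (lpOf ∞ m) f, coeFn_lpOf hm] with x h1 h2
  rw [h1, h2]; rfl

lemma inner_mul {m : Space n → ℝ} (hm : MemLp m ∞ volume)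
    (f g : Lp E 2 (volume : Measure (Space n))) :
    inner ℝ (mul m f) g = ∫ x, m x * inner ℝ (f x) (g x) := by
  rw [L2.inner_def]
  apply integral_congr_ae
  filter_upwards [coeFn_mul hm f] with x h1
  rw [h1, real_inner_smul_left]

lemma integrable_mul_inner {m : Space n → ℝ} (hm : MemLp m ∞ volume)
    (f g : Lp E 2 (volume : Measure (Space n))) :
    Integrable (fun x => m x * inner ℝ (f x) (g x)) volume := by
  refine (L2.integrable_inner (𝕜 := ℝ) (mul m f) g).congr ?_
  filter_upwards [coeFn_mul hm f] with x h1
  rw [h1, real_inner_smul_left]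

lemma inner_mul_comm (m : Space n → ℝ) (f g : Lp E 2 (volume : Measure (Space n))) :
    inner ℝ (mul m f) g = inner ℝ f (mul m g) := by
  by_cases hm : MemLp m ∞ volume
  · rw [inner_mul hm, real_inner_comm, inner_mul hm]
    simp_rw [real_inner_comm]
  · simp [mul, lpOf, dif_neg hm]

/-- On functions that vanish outside a fixed ball, the `Lᵖ` norm is controlled by the supremum. -/
lemma norm_lpOf_le (n : ℕ) (p : ℝ≥0∞) (ρ : ℝ) : ∃ K : ℝ, 0 < K ∧ ∀ (f : Space n → ℝ) (M : ℝ),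
    0 ≤ M → (∀ x ∈ Metric.closedBall (0 : Space n) ρ, ‖f x‖ ≤ M) →
    (∀ x, x ∉ Metric.closedBall (0 : Space n) ρ → f x = 0) → ‖lpOf p f‖ ≤ K * M := by
  set μ := (volume : Measure (Space n)).restrict (Metric.closedBall 0 ρ) with hμ
  have : IsFiniteMeasure μ :=
    ⟨by rw [Measure.restrict_apply_univ]; exact measure_closedBall_lt_top⟩
  refine ⟨(μ univ ^ p.toReal⁻¹).toReal + 1, by positivity, fun f M h0M hM h0 => ?_⟩
  rw [lpOf]
  split_ifs with hf
  · have h1 : (Metric.closedBall (0 : Space n) ρ).indicator f = f := by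
      ext x
      by_cases hx : x ∈ Metric.closedBall (0 : Space n) ρ
      · simp [indicator_of_mem hx]
      · rw [indicator_of_notMem hx, h0 x hx]
    rw [Lp.norm_toLp]
    have h2 : eLpNorm f p volume ≤ μ univ ^ p.toReal⁻¹ * ENNReal.ofReal M := by
      rw [← h1, eLpNorm_indicator_eq_eLpNorm_restrict measurableSet_closedBall]
      exact eLpNorm_le_of_ae_bound ((ae_restrict_iff' measurableSet_closedBall).2 (.of_forall hM))
    have h3 : μ univ ^ p.toReal⁻¹ ≠ ⊤ :=
      ENNReal.rpow_ne_top_of_nonneg (by positivity) (measure_ne_top _ _)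
    calc _ ≤ (μ univ ^ p.toReal⁻¹ * ENNReal.ofReal M).toReal :=
          ENNReal.toReal_mono (ENNReal.mul_ne_top h3 ENNReal.ofReal_ne_top) h2
      _ = (μ univ ^ p.toReal⁻¹).toReal * M := by
          rw [ENNReal.toReal_mul, ENNReal.toReal_ofReal h0M]
      _ ≤ _ := by nlinarith
  · simp; positivity

lemma lpOf_sub_sub_smul {f g h : Space n → E} (hf : MemLp f p volume) (hg : MemLp g p volume)
    (hh : MemLp h p volume) (r : ℝ) :
    lpOf p f - lpOf p g - r • lpOf p h = lpOf p (fun x => f x - g x - r • h x) := by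
  have h1 : MemLp (fun x => f x - g x - r • h x) p volume := (hf.sub hg).sub (hh.const_smul r)
  apply Lp.ext
  filter_upwards [coeFn_lpOf h1, Lp.coeFn_sub (lpOf p f - lpOf p g) (r • lpOf p h),
    Lp.coeFn_sub (lpOf p f) (lpOf p g), Lp.coeFn_smul r (lpOf p h), coeFn_lpOf hf, coeFn_lpOf hg,
    coeFn_lpOf hh] with x a1 a2 a3 a4 a5 a6 a7
  rw [a1, a2, Pi.sub_apply, a3, Pi.sub_apply, a4, Pi.smul_apply, a5, a6, a7]

/-- Differentiability in `t` as an `Lᵖ` valued map follows from differentiability that is uniform in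
`x`, for functions that vanish outside a fixed ball. -/
lemma hasDerivAt_lpOf [Fact (1 ≤ p)] {F : ℝ → Space n → ℝ} {F' : Space n → ℝ} {t₀ ρ : ℝ}
    (hF : ∀ᶠ t in nhds t₀, MemLp (F t) p volume) (hF' : MemLp F' p volume)
    (h0 : ∀ᶠ t in nhds t₀, ∀ x, x ∉ Metric.closedBall (0 : Space n) ρ → F t x = 0)
    (h0' : ∀ x, x ∉ Metric.closedBall (0 : Space n) ρ → F' x = 0)
    (hd : ∀ ε > 0, ∀ᶠ t in nhds t₀, ∀ x ∈ Metric.closedBall (0 : Space n) ρ,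
      |F t x - F t₀ x - (t - t₀) * F' x| ≤ ε * |t - t₀|) :
    HasDerivAt (fun t => lpOf p (F t)) (lpOf p F') t₀ := by
  obtain ⟨K, hK, hb⟩ := norm_lpOf_le n p ρ
  rw [hasDerivAt_iff_isLittleO, Asymptotics.isLittleO_iff]
  intro ε hε
  filter_upwards [hF, h0, hd (ε / K) (by positivity)] with t h1 h2 h3
  rw [lpOf_sub_sub_smul h1 hF.self_of_nhds hF']
  refine (hb _ (ε / K * |t - t₀|) (by positivity) h3 ?_).trans (le_of_eq ?_)
  · intro x hx
    simp [h2 x hx, h0.self_of_nhds x hx, h0' x hx]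
  · rw [Real.norm_eq_abs]; field_simp

lemma hasDerivAt_clm₂_comp {X Y Z : Type*} [NormedAddCommGroup X] [NormedSpace ℝ X]
    [NormedAddCommGroup Y] [NormedSpace ℝ Y] [NormedAddCommGroup Z] [NormedSpace ℝ Z]
    (L : X →L[ℝ] Y →L[ℝ] Z) {m : ℝ → X} {m' : X} {t : ℝ} (h : HasDerivAt m m' t) :
    HasDerivAt (fun s => L (m s)) (L m') t :=
  L.hasFDerivAt.comp_hasDerivAt t h

lemma hasDerivAt_mul {m : ℝ → Space n → ℝ} {m' : Space n → ℝ} {t : ℝ}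
    (h : HasDerivAt (fun s => lpOf ⊤ (m s)) (lpOf ⊤ m') t) :
    HasDerivAt (fun s => (mul (m s) :
      Lp E 2 (volume : Measure (Space n)) →L[ℝ] Lp E 2 (volume : Measure (Space n))))
      (mul m') t :=
  hasDerivAt_clm₂_comp (mulL n E) h

-- Unfolding these definitions makes unification on `Lp` spaces very slow.
attribute [irreducible] lpOf mulL mul

end

/-! ### Test functions and weak gradients -/

section

variable {n : ℕ} {E : Type*} [NormedAddCommGroup E] [InnerProductSpace ℝ E]

lemma continuous_gradient {φ : Space n → ℝ} (h : ContDiff ℝ 1 φ) : Continuous (gradient φ) :=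
  (InnerProductSpace.toDual ℝ (Space n)).symm.continuous.comp (h.continuous_fderiv one_ne_zero)

lemma tsupport_gradient_subset (φ : Space n → ℝ) : tsupport (gradient φ) ⊆ tsupport φ := by
  refine closure_minimal (fun x hx => ?_) (isClosed_tsupport φ)
  apply support_fderiv_subset ℝ (f := φ)
  intro h0
  exact hx (by simp [gradient, h0])

lemma gradient_eq_zero_of_notMem_tsupport {φ : Space n → ℝ} {x : Space n} (hx : x ∉ tsupport φ) :
    gradient φ x = 0 :=
  image_eq_zero_of_notMem_tsupport fun h => hx (tsupport_gradient_subset φ h)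

lemma hasCompactSupport_gradient {φ : Space n → ℝ} (h : HasCompactSupport φ) :
    HasCompactSupport (gradient φ) :=
  h.of_isClosed_subset (isClosed_tsupport _) (tsupport_gradient_subset φ)

lemma IsTest.contDiff_one {φ : Space n → ℝ} (h : IsTest φ) : ContDiff ℝ 1 φ :=
  h.1.of_le (by exact_mod_cast le_top)

lemma locallyIntegrable_Lp {E : Type*} [NormedAddCommGroup E]
    (f : Lp E 2 (volume : Measure (Space n))) :
    LocallyIntegrable f volume :=
  (Lp.memLp f).locallyIntegrable (by norm_num)

lemma integrable_inner_of_continuous {ψ : Space n → E} (h : Continuous ψ)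
    (hs : HasCompactSupport ψ) (f : Lp E 2 (volume : Measure (Space n))) :
    Integrable (fun x => inner ℝ (ψ x) (f x)) volume := by
  have h1 : MemLp ψ 2 volume := h.memLp_of_hasCompactSupport hs
  refine (L2.integrable_inner (𝕜 := ℝ) (lpOf 2 ψ) f).congr ?_
  filter_upwards [coeFn_lpOf h1] with x hx
  rw [hx]

lemma inner_lpOf {ψ : Space n → E} (h1 : MemLp ψ 2 volume)
    (f : Lp E 2 (volume : Measure (Space n))) :
    inner ℝ (lpOf 2 ψ) f = ∫ x, inner ℝ (ψ x) (f x) := by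
  rw [L2.inner_def]
  apply integral_congr_ae
  filter_upwards [coeFn_lpOf h1] with x hx
  rw [hx]

/-- The weak gradient tested in a fixed direction `e`. -/
lemma hasWeakGrad_iff {f : L2 n} {g : L2Vec n} : HasWeakGrad f g ↔
    ∀ φ : Space n → ℝ, IsTest φ → ∀ e : Space n,
      inner ℝ (lpOf 2 fun x => fderiv ℝ φ x e) f + inner ℝ (lpOf 2 fun x => φ x • e) g = 0 := by
  refine forall_congr' fun φ => forall_congr' fun hφ => ?_
  have c1 := hφ.contDiff_one
  have i1 : Integrable (fun x => f x • gradient φ x) volume :=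
    (locallyIntegrable_Lp f).integrable_smul_right_of_hasCompactSupport (continuous_gradient c1)
      (hasCompactSupport_gradient hφ.2)
  have i2 : Integrable (fun x => φ x • g x) volume :=
    (locallyIntegrable_Lp g).integrable_smul_left_of_hasCompactSupport c1.continuous hφ.2
  have m1 : ∀ e : Space n, MemLp (fun x => fderiv ℝ φ x e) 2 volume := fun e =>
    ((c1.continuous_fderiv one_ne_zero).clm_apply continuous_const).memLp_of_hasCompactSupport
      ((hφ.2.fderiv_apply (𝕜 := ℝ) e))
  have m2 : ∀ e : Space n, MemLp (fun x => φ x • e) 2 volume := fun e =>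
    (c1.continuous.smul continuous_const).memLp_of_hasCompactSupport hφ.2.smul_right
  have key : ∀ e : Space n, inner ℝ (lpOf 2 fun x => fderiv ℝ φ x e) f +
      inner ℝ (lpOf 2 fun x => φ x • e) g
      = inner ℝ e ((∫ x, f x • gradient φ x) + ∫ x, φ x • g x) := by
    intro e
    rw [inner_lpOf (m1 e), inner_lpOf (m2 e), inner_add_right, ← integral_inner i1,
      ← integral_inner i2]
    congr 1
    · refine integral_congr_ae (.of_forall fun x => ?_)
      simp [real_inner_smul_right, inner_gradient_right]
    · refine integral_congr_ae (.of_forall fun x => ?_)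
      simp [real_inner_smul_right, real_inner_smul_left]
  simp_rw [key]
  rw [eq_neg_iff_add_eq_zero]
  exact ⟨fun h e => by rw [h, inner_zero_right], fun h => inner_self_eq_zero.1 (h _)⟩

/-- The weak gradient vanishes on every open set on which the function vanishes. -/
lemma HasWeakGrad.ae_eq_zero {f : L2 n} {g : L2Vec n} (h : HasWeakGrad f g) {U : Set (Space n)}
    (hU : IsOpen U) (hf : ∀ᵐ x, x ∈ U → f x = 0) : ∀ᵐ x, x ∈ U → g x = 0 := by
  refine hU.ae_eq_zero_of_integral_contDiff_smul_eq_zero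
    ((locallyIntegrable_Lp g).locallyIntegrableOn U) fun φ h1 h2 h3 => ?_
  have h4 := h φ ⟨h1, h2⟩
  rw [integral_eq_zero_of_ae] at h4
  · rw [← neg_eq_zero, ← h4]
  · filter_upwards [hf] with x hx
    by_cases hxU : x ∈ U
    · simp [hx hxU]
    · simp [gradient_eq_zero_of_notMem_tsupport fun h => hxU (h3 h)]

lemma HasWeakGrad.sub {f f' : L2 n} {g g' : L2Vec n} (h : HasWeakGrad f g)
    (h' : HasWeakGrad f' g') : HasWeakGrad (f - f') (g - g') := by
  rw [hasWeakGrad_iff] at *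
  intro φ hφ e
  rw [inner_sub_right, inner_sub_right]
  linarith [h φ hφ e, h' φ hφ e]

lemma HasWeakGrad.smul {f : L2 n} {g : L2Vec n} (h : HasWeakGrad f g) (r : ℝ) :
    HasWeakGrad (r • f) (r • g) := by
  rw [hasWeakGrad_iff] at *
  intro φ hφ e
  rw [inner_smul_right, inner_smul_right]
  linear_combination r * h φ hφ e

lemma HasWeakGrad.add {f f' : L2 n} {g g' : L2Vec n} (h : HasWeakGrad f g)
    (h' : HasWeakGrad f' g') : HasWeakGrad (f + f') (g + g') := by
  rw [hasWeakGrad_iff] at *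
  intro φ hφ e
  rw [inner_add_right, inner_add_right]
  linarith [h φ hφ e, h' φ hφ e]

lemma hasWeakGrad_zero : HasWeakGrad (0 : L2 n) 0 := by
  rw [hasWeakGrad_iff]; simp

lemma HasWeakGrad.unique {f : L2 n} {g g' : L2Vec n} (h : HasWeakGrad f g)
    (h' : HasWeakGrad f g') : g = g' := by
  have h1 : HasWeakGrad (0 : L2 n) (g - g') := by simpa using h.sub h'
  have h2 := h1.ae_eq_zero isOpen_univ
    (by filter_upwards [Lp.coeFn_zero ℝ 2 (volume : Measure (Space n))] with x hx _; exact hx)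
  rw [← sub_eq_zero]
  apply Lp.ext
  filter_upwards [h2, Lp.coeFn_zero (Space n) 2 (volume : Measure (Space n))] with x hx hx'
  rw [hx (mem_univ x), hx']; rfl

lemma MemH1.hasWeakGrad {f : L2 n} (h : MemH1 f) : HasWeakGrad f (weakGrad f) := by
  rw [weakGrad, dif_pos h]; exact h.choose_spec

/-- The weak gradient commutes with Bochner integrals in time. -/
lemma hasWeakGrad_intervalIntegral {w : ℝ → L2 n} {G : ℝ → L2Vec n} {s t : ℝ}
    (h : ∀ r ∈ uIcc s t, HasWeakGrad (w r) (G r)) (hw : ContinuousOn w (uIcc s t))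
    (hG : ContinuousOn G (uIcc s t)) :
    HasWeakGrad (∫ r in s..t, w r) (∫ r in s..t, G r) := by
  rw [hasWeakGrad_iff]
  intro φ hφ e
  have i1 := hw.intervalIntegrable (μ := volume)
  have i2 := hG.intervalIntegrable (μ := volume)
  rw [← innerSL_apply_apply ℝ, ← innerSL_apply_apply ℝ (E := L2Vec n),
    ← ContinuousLinearMap.intervalIntegral_comp_comm _ i1,
    ← ContinuousLinearMap.intervalIntegral_comp_comm _ i2, ← intervalIntegral.integral_add]
  · refine (intervalIntegral.integral_congr fun r hr => ?_).trans intervalIntegral.integral_zero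
    exact hasWeakGrad_iff.1 (h r hr) φ hφ e
  · exact ((innerSL ℝ _).continuous.comp_continuousOn hw).intervalIntegrable
  · exact ((innerSL ℝ _).continuous.comp_continuousOn hG).intervalIntegrable

/-- If the derivative of `w` in `L²` is a continuous curve in `H¹`, then the gradient of `w` is
differentiable in time: by integration in time, it is a primitive of a continuous curve. -/
lemma hasDerivAt_weakGrad {w w' : ℝ → L2 n} {G G' : ℝ → L2Vec n} {I : Set ℝ} (hI : IsOpen I)
    (hI' : OrdConnected I) (hw : ∀ t ∈ I, HasDerivAt w (w' t) t) (hw' : ContinuousOn w' I)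
    (hG : ∀ t ∈ I, HasWeakGrad (w t) (G t)) (hG' : ∀ t ∈ I, HasWeakGrad (w' t) (G' t))
    (hGc : ContinuousOn G' I) {t : ℝ} (ht : t ∈ I) : HasDerivAt G (G' t) t := by
  have h1 : ∀ s ∈ I, G s = G t + ∫ r in t..s, G' r := by
    intro s hs
    have hsub : uIcc t s ⊆ I := hI'.uIcc_subset ht hs
    have h2 : (∫ r in t..s, w' r) = w s - w t :=
      intervalIntegral.integral_eq_sub_of_hasDerivAt (fun r hr => hw r (hsub hr))
        (hw'.mono hsub).intervalIntegrable
    have h3 := hasWeakGrad_intervalIntegral (fun r hr => hG' r (hsub hr)) (hw'.mono hsub)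
      (hGc.mono hsub)
    rw [h2] at h3
    rw [h3.unique ((hG s hs).sub (hG t ht))]; abel
  have h4 : HasDerivAt (fun s => G t + ∫ r in t..s, G' r) (G' t) t := by
    refine HasDerivAt.const_add _ ?_
    refine intervalIntegral.integral_hasDerivAt_right (by simp) ?_
      (hGc.continuousAt (hI.mem_nhds ht))
    exact hGc.stronglyMeasurableAtFilter hI t ht
  exact h4.congr_of_eventuallyEq (Filter.eventually_of_mem (hI.mem_nhds ht) h1)

end

/-! ### Testing with compactly supported elements of `H¹` -/

section

variable {n : ℕ} {E : Type*} [NormedAddCommGroup E]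

/-- The translate `x ↦ f (x - y)`. -/
def translate (y : Space n) (f : Lp E 2 (volume : Measure (Space n))) :
    Lp E 2 (volume : Measure (Space n)) :=
  DomAddAct.mk (-y) +ᵥ f

lemma coeFn_translate (y : Space n) (f : Lp E 2 (volume : Measure (Space n))) :
    translate y f =ᵐ[volume] fun x => f (x - y) := by
  filter_upwards [DomAddAct.vadd_Lp_ae_eq (DomAddAct.mk (-y)) f] with x hx
  rw [translate, hx]
  simp [neg_add_eq_sub]

lemma norm_translate (y : Space n) (f : Lp E 2 (volume : Measure (Space n))) :
    ‖translate y f‖ = ‖f‖ := DomAddAct.norm_vadd_Lp _ _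

lemma translate_zero (f : Lp E 2 (volume : Measure (Space n))) : translate 0 f = f := by
  apply Lp.ext
  filter_upwards [coeFn_translate 0 f] with x hx
  simpa using hx

lemma continuous_translate (f : Lp E 2 (volume : Measure (Space n))) :
    Continuous fun y => translate y f := by
  have : Fact ((2 : ℝ≥0∞) ≠ ⊤) := ⟨by norm_num⟩
  exact (DomAddAct.continuous_mk.comp continuous_neg).vadd continuous_const

variable [InnerProductSpace ℝ E]

/-- Averaging the pairings of `P` with the translates of `f` is pairing `P` with a convolution. -/
lemma integral_mul_inner_translate [CompleteSpace E] {η : Space n → ℝ} (hη : Continuous η)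
    (hc : HasCompactSupport η) (P f : Lp E 2 (volume : Measure (Space n))) :
    ∫ y, η y * inner ℝ P (translate y f) = ∫ x, inner ℝ (P x) (∫ y, η y • f (x - y)) := by
  have hcv : ∀ x, Integrable (fun y => η y • f (x - y)) volume := fun x => by
    have h1 : MemLp (fun y => f (x - y)) 2 volume :=
      (Lp.memLp f).comp_measurePreserving (Measure.measurePreserving_sub_left volume x)
    exact (h1.locallyIntegrable (by norm_num)).integrable_smul_left_of_hasCompactSupport hη hc
  have h1 : ∀ y, inner ℝ P (translate y f) = ∫ x, inner ℝ (P x) (f (x - y)) := fun y => by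
    rw [L2.inner_def]
    apply integral_congr_ae
    filter_upwards [coeFn_translate y f] with x hx
    rw [hx]
  have h2 : ∀ y, Integrable (fun x => inner ℝ (P x) (f (x - y))) volume := fun y => by
    refine (L2.integrable_inner (𝕜 := ℝ) P (translate y f)).congr ?_
    filter_upwards [coeFn_translate y f] with x hx
    rw [hx]
  have hint : Integrable (Function.uncurry fun y x : Space n => η y * inner ℝ (P x) (f (x - y)))
      (volume.prod volume) := by
    have hm : AEStronglyMeasurable
        (Function.uncurry fun y x : Space n => η y * inner ℝ (P x) (f (x - y)))
        (volume.prod volume) := by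
      have a1 : StronglyMeasurable fun z : Space n × Space n => η z.1 :=
        (hη.comp continuous_fst).stronglyMeasurable
      have a2 : StronglyMeasurable fun z : Space n × Space n => P z.2 :=
        (Lp.stronglyMeasurable P).comp_measurable measurable_snd
      have a3 : StronglyMeasurable fun z : Space n × Space n => f (z.2 - z.1) :=
        (Lp.stronglyMeasurable f).comp_measurable (measurable_snd.sub measurable_fst)
      exact (a1.mul (a2.inner a3)).aestronglyMeasurable
    rw [integrable_prod_iff hm]
    refine ⟨.of_forall fun y => (h2 y).const_mul (η y), ?_⟩
    refine Integrable.mono' (g := fun y => ‖η y‖ * (‖P‖ * ‖f‖)) ?_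
      hm.norm.integral_prod_right' (.of_forall fun y => ?_)
    · exact ((hη.integrable_of_hasCompactSupport hc).norm).mul_const _
    · simp only [Function.uncurry, norm_mul]
      rw [integral_const_mul, norm_mul, norm_norm]
      refine mul_le_mul_of_nonneg_left ?_ (norm_nonneg _)
      have b1 : Integrable (fun x => ‖P x‖ * ‖f (x - y)‖) volume := by
        refine (L2.integrable_inner (𝕜 := ℝ) (Lp.memLp P).norm.toLp
          ((Lp.memLp (translate y f)).norm.toLp)).congr ?_
        filter_upwards [coeFn_translate y f, (Lp.memLp P).norm.coeFn_toLp,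
          (Lp.memLp (translate y f)).norm.coeFn_toLp] with x hx h3 h4
        rw [h3, h4, hx]; simp [mul_comm]
      have b2 : ∫ x, ‖P x‖ * ‖f (x - y)‖ ≤ ‖P‖ * ‖f‖ := by
        have b3 := real_inner_le_norm (Lp.memLp P).norm.toLp
          ((Lp.memLp (translate y f)).norm.toLp)
        rw [Lp.norm_toLp, Lp.norm_toLp, eLpNorm_norm, eLpNorm_norm, ← Lp.norm_def, ← Lp.norm_def,
          norm_translate, L2.inner_def] at b3
        refine le_trans (le_of_eq (integral_congr_ae ?_)) b3
        filter_upwards [coeFn_translate y f, (Lp.memLp P).norm.coeFn_toLp,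
          (Lp.memLp (translate y f)).norm.coeFn_toLp] with x hx h3 h4
        rw [h3, h4, hx]; simp [mul_comm]
      rw [Real.norm_of_nonneg (integral_nonneg fun x => norm_nonneg _)]
      refine le_trans (integral_mono_of_nonneg (.of_forall fun x => norm_nonneg _) b1
        (.of_forall fun x => ?_)) b2
      exact norm_inner_le_norm _ _
  simp_rw [h1, ← integral_const_mul]
  rw [integral_integral_swap hint]
  refine integral_congr_ae (.of_forall fun x => ?_)
  simp only
  rw [← integral_inner (hcv x)]
  simp_rw [real_inner_smul_right]

/-- The gradient of a mollification is the mollification of the weak gradient. -/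
lemma HasWeakGrad.gradient_convolution {f : L2 n} {F : L2Vec n} (h : HasWeakGrad f F)
    {η : Space n → ℝ} (hη : IsTest η) (x : Space n) :
    gradient (fun x => ∫ y, η y • f (x - y)) x = ∫ y, η y • F (x - y) := by
  have hd := hη.2.hasFDerivAt_convolution_left (ContinuousLinearMap.lsmul ℝ ℝ) hη.contDiff_one
    (locallyIntegrable_Lp f) x
  have hφ : IsTest fun y => η (x - y) :=
    ⟨hη.1.comp (contDiff_const.sub contDiff_id),
      hη.2.comp_homeomorph (Homeomorph.subLeft x)⟩
  have hg : ∀ y, gradient (fun y => η (x - y)) y = - gradient η (x - y) := by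
    intro y
    have h1 : HasFDerivAt (fun y => η (x - y)) (-(fderiv ℝ η (x - y))) y := by
      have h2 := (hη.contDiff_one.differentiable one_ne_zero (x - y)).hasFDerivAt.comp y
        ((hasFDerivAt_const x y).sub (hasFDerivAt_id y))
      simpa using! h2
    rw [gradient, h1.fderiv, map_neg]; rfl
  have h1 := h _ hφ
  simp_rw [hg, smul_neg, integral_neg, neg_inj] at h1
  have h2 : ∫ y, η y • F (x - y) = ∫ y, η (x - y) • F y := by
    rw [← integral_sub_left_eq_self (fun y => η y • F (x - y)) volume x]
    simp
  rw [h2, ← h1]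
  have hfd : fderiv ℝ (fun x => ∫ y, η y • f (x - y)) x = _ := hd.fderiv
  have i1 : Integrable (fun y => f y • gradient η (x - y)) volume := by
    refine (locallyIntegrable_Lp f).integrable_smul_right_of_hasCompactSupport
      ((continuous_gradient hη.contDiff_one).comp (continuous_const.sub continuous_id))
      ((hasCompactSupport_gradient hη.2).comp_homeomorph (Homeomorph.subLeft x))
  apply ext_inner_left ℝ
  intro e
  rw [inner_gradient_right, hfd, ← integral_inner i1, convolution_eq_swap]
  rw [ContinuousLinearMap.integral_apply]
  · refine integral_congr_ae (.of_forall fun y => ?_)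
    simp [real_inner_smul_right, inner_gradient_right, mul_comm, ContinuousLinearMap.precompL_apply]
  · have c1 := (hη.2.fderiv ℝ).convolutionExists_left
      ((ContinuousLinearMap.lsmul ℝ ℝ : ℝ →L[ℝ] ℝ →L[ℝ] ℝ).precompL (Space n))
      (hη.contDiff_one.continuous_fderiv one_ne_zero) (locallyIntegrable_Lp f) x
    have := c1.integrable_swap
    exact this

/-- An identity that is linear in `(φ, ∇φ)` and holds for test functions extends to all
compactly supported elements of `H¹`. The pairing with the translates of `(f, F)` is a continuous
function of the translation; its averages against mollifiers are pairings with test functions, so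
it vanishes near `0`. -/
lemma HasWeakGrad.extend_test {f : L2 n} {F : L2Vec n} (h : HasWeakGrad f F) {ρ : ℝ}
    (hf : ∀ᵐ x, ρ < ‖x‖ → f x = 0) {P : L2 n} {Q : L2Vec n}
    (hPQ : ∀ φ : Space n → ℝ, IsTest φ → (∀ x, ρ + 1 < ‖x‖ → φ x = 0) →
      inner ℝ P (lpOf 2 φ) + inner ℝ Q (lpOf 2 (gradient φ)) = 0) :
    inner ℝ P f + inner ℝ Q F = 0 := by
  set Λ : Space n → ℝ := fun y => inner ℝ P (translate y f) + inner ℝ Q (translate y F) with hΛ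
  have hcont : Continuous Λ :=
    (continuous_const.inner (continuous_translate f)).add
      (continuous_const.inner (continuous_translate F))
  -- averages of `Λ` against `η` are pairings with the test function `φ = η ∗ f` and its gradient
  have hae : ∀ᵐ y, y ∈ Metric.ball (0 : Space n) 1 → Λ y = 0 := by
    refine Metric.isOpen_ball.ae_eq_zero_of_integral_contDiff_smul_eq_zero
      (hcont.locallyIntegrable.locallyIntegrableOn _) fun η h1 h2 h3 => ?_
    have hη : IsTest η := ⟨h1, h2⟩
    have hηc := hη.contDiff_one.continuous
    set φ : Space n → ℝ := fun x => ∫ y, η y • f (x - y) with hφ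
    have hφ0 : ∀ x, ρ + 1 < ‖x‖ → φ x = 0 := by
      intro x hx
      refine integral_eq_zero_of_ae ?_
      have h4 : ∀ᵐ y, ρ < ‖x - y‖ → f (x - y) = 0 :=
        (Measure.measurePreserving_sub_left volume x).quasiMeasurePreserving.ae hf
      filter_upwards [h4] with y hy
      by_cases hyb : y ∈ tsupport η
      · have h5 := h3 hyb
        rw [mem_ball_zero_iff] at h5
        have h6 : ‖x‖ ≤ ‖x - y‖ + ‖y‖ := by simpa using norm_add_le (x - y) y
        simp [hy (by linarith)]
      · simp [image_eq_zero_of_notMem_tsupport hyb]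
    have hφt : IsTest φ := by
      refine ⟨h2.contDiff_convolution_left (n := ⊤) (ContinuousLinearMap.lsmul ℝ ℝ) h1
        (locallyIntegrable_Lp f), ?_⟩
      refine HasCompactSupport.intro (isCompact_closedBall (0 : Space n) (ρ + 1)) fun x hx => ?_
      exact hφ0 x (by simpa using hx)
    have hφ1 := hφt.contDiff_one
    have h7 := hPQ φ hφt hφ0
    have e1 : ∫ y, η y * inner ℝ P (translate y f) = inner ℝ P (lpOf 2 φ) := by
      rw [integral_mul_inner_translate hηc h2, real_inner_comm,
        inner_lpOf (hφ1.continuous.memLp_of_hasCompactSupport hφt.2)]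
      simp_rw [real_inner_comm]; rfl
    have e2 : ∫ y, η y * inner ℝ Q (translate y F) = inner ℝ Q (lpOf 2 (gradient φ)) := by
      rw [integral_mul_inner_translate hηc h2, real_inner_comm,
        inner_lpOf ((continuous_gradient hφ1).memLp_of_hasCompactSupport
          (hasCompactSupport_gradient hφt.2))]
      simp_rw [hφ, h.gradient_convolution hη, real_inner_comm]
    simp_rw [hΛ, smul_eq_mul, mul_add]
    rw [integral_add, e1, e2, h7]
    · exact (hηc.mul (continuous_const.inner (continuous_translate f))).integrable_of_hasCompactSupport
        h2.mul_right
    · exact (hηc.mul (continuous_const.inner (continuous_translate F))).integrable_of_hasCompactSupport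
        h2.mul_right
  -- a continuous function that vanishes almost everywhere near `0` vanishes at `0`
  have h0 : Λ 0 = 0 := by
    by_contra hne
    have hopen : IsOpen ({y | Λ y ≠ 0} ∩ Metric.ball (0 : Space n) 1) :=
      (isOpen_ne_fun hcont continuous_const).inter Metric.isOpen_ball
    have hpos := hopen.measure_pos volume ⟨0, hne, by simp⟩
    refine hpos.ne' (measure_mono_null (fun y hy => ?_) hae)
    exact fun hh => hy.1 (hh hy.2)
  simpa [hΛ, translate_zero] using h0

end

/-! ### Products of `H¹` functions with compactly supported `C¹` functions -/

section

variable {n : ℕ}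

lemma exists_bound_of_hasCompactSupport {ψ : Space n → ℝ} (h : HasCompactSupport ψ) :
    ∃ ρ : ℝ, ∀ x, ρ < ‖x‖ → ψ x = 0 := by
  obtain ⟨ρ, hρ⟩ := h.isCompact.isBounded.subset_closedBall 0
  refine ⟨ρ, fun x hx => image_eq_zero_of_notMem_tsupport fun hx' => ?_⟩
  have := mem_closedBall_zero_iff.1 (hρ hx')
  linarith

lemma memLp_of_contDiff {ψ : Space n → ℝ} (h : ContDiff ℝ 1 ψ) (hs : HasCompactSupport ψ)
    (p : ℝ≥0∞) : MemLp ψ p volume := h.continuous.memLp_of_hasCompactSupport hs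

lemma memLp_gradient {ψ : Space n → ℝ} (h : ContDiff ℝ 1 ψ) (hs : HasCompactSupport ψ)
    (p : ℝ≥0∞) : MemLp (gradient ψ) p volume :=
  (continuous_gradient h).memLp_of_hasCompactSupport (hasCompactSupport_gradient hs)

lemma hasWeakGrad_of_contDiff {ψ : Space n → ℝ} (h : ContDiff ℝ 1 ψ) (hs : HasCompactSupport ψ) :
    HasWeakGrad (lpOf 2 ψ) (lpOf 2 (gradient ψ)) := by
  rw [hasWeakGrad_iff]
  intro φ hφ e
  have c1 := hφ.contDiff_one
  have m1 : MemLp (fun x => fderiv ℝ φ x e) 2 volume :=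
    ((c1.continuous_fderiv one_ne_zero).clm_apply continuous_const).memLp_of_hasCompactSupport
      ((hφ.2.fderiv_apply (𝕜 := ℝ) e))
  have m2 : MemLp (fun x => φ x • e) 2 volume :=
    (c1.continuous.smul continuous_const).memLp_of_hasCompactSupport hφ.2.smul_right
  rw [inner_lpOf m1, inner_lpOf m2]
  have e1 : ∫ x, inner ℝ (fderiv ℝ φ x e) (lpOf 2 ψ x) = ∫ x, ψ x * fderiv ℝ φ x e := by
    apply integral_congr_ae
    filter_upwards [coeFn_lpOf (memLp_of_contDiff h hs 2)] with x hx
    rw [hx]; rfl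
  have e2 : ∫ x, inner ℝ (φ x • e) (lpOf 2 (gradient ψ) x) = ∫ x, fderiv ℝ ψ x e * φ x := by
    apply integral_congr_ae
    filter_upwards [coeFn_lpOf (memLp_gradient h hs 2)] with x hx
    rw [hx, real_inner_smul_left, inner_gradient_right]; simp [mul_comm]
  rw [e1, e2, integral_mul_fderiv_eq_neg_fderiv_mul_of_integrable]
  · ring
  · exact (((h.continuous_fderiv one_ne_zero).clm_apply continuous_const).mul
      c1.continuous).integrable_of_hasCompactSupport hφ.2.mul_left
  · exact (h.continuous.mul ((c1.continuous_fderiv one_ne_zero).clm_apply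
      continuous_const)).integrable_of_hasCompactSupport hs.mul_right
  · exact (h.continuous.mul c1.continuous).integrable_of_hasCompactSupport hs.mul_right
  · exact fun x _ => h.differentiable one_ne_zero x
  · exact fun x _ => c1.differentiable one_ne_zero x

lemma memLp_smul_of_bounded {v : L2 n} {g : Space n → Space n} (hg : MemLp g ⊤ volume) :
    MemLp (fun x => v x • g x) 2 volume :=
  MemLp.smul (p := 2) (q := ⊤) (r := 2) hg (Lp.memLp v)

/-- Product rule. The weak formulation for `ψ v` tested with `φ` is the one for `v` tested with
`ψ φ`, which is only `C¹` and therefore requires `HasWeakGrad.extend_test`. -/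
lemma HasWeakGrad.mul {v : L2 n} {V : L2Vec n} (hv : HasWeakGrad v V) {ψ : Space n → ℝ}
    (h : ContDiff ℝ 1 ψ) (hs : HasCompactSupport ψ) :
    HasWeakGrad (mul ψ v) (DampedWave.mul ψ V + lpOf 2 fun x => v x • gradient ψ x) := by
  rw [hasWeakGrad_iff]
  intro φ hφ e
  have c1 := hφ.contDiff_one
  have k1 : ContDiff ℝ 1 fun x => ψ x * φ x := h.mul c1
  have k2 : HasCompactSupport fun x => ψ x * φ x := hs.mul_right
  obtain ⟨ρ, hρ⟩ := exists_bound_of_hasCompactSupport k2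
  have mP : MemLp (fun x => inner ℝ (V x) e) 2 volume := (Lp.memLp V).inner_const e
  have mQ : MemLp (fun x => v x • e) 2 volume := by
    refine memLp_smul_of_bounded (g := fun _ => e) ?_
    exact memLp_top_const e
  have mD : ∀ χ : Space n → ℝ, ContDiff ℝ 1 χ → HasCompactSupport χ →
      MemLp (fun x => fderiv ℝ χ x e) 2 volume := fun χ hχ hχs =>
    ((hχ.continuous_fderiv one_ne_zero).clm_apply continuous_const).memLp_of_hasCompactSupport
      ((hχs.fderiv_apply (𝕜 := ℝ) e))
  have m2 : ∀ χ : Space n → ℝ, ContDiff ℝ 1 χ → HasCompactSupport χ →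
      MemLp (fun x => χ x • e) 2 volume := fun χ hχ hχs =>
    (hχ.continuous.smul continuous_const).memLp_of_hasCompactSupport hχs.smul_right
  have hswap1 : ∀ χ : Space n → ℝ, ContDiff ℝ 1 χ → HasCompactSupport χ →
      inner ℝ (lpOf 2 fun x => inner ℝ (V x) e) (lpOf 2 χ)
        = inner ℝ (lpOf 2 fun x => χ x • e) V := by
    intro χ hχ hχs
    rw [inner_lpOf mP, inner_lpOf (m2 χ hχ hχs)]
    apply integral_congr_ae
    filter_upwards [coeFn_lpOf (memLp_of_contDiff hχ hχs 2)] with x hx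
    rw [hx, real_inner_smul_left, real_inner_comm (V x) e]
    simp
  have hswap2 : ∀ χ : Space n → ℝ, ContDiff ℝ 1 χ → HasCompactSupport χ →
      inner ℝ (lpOf 2 fun x => v x • e) (lpOf 2 (gradient χ))
        = inner ℝ (lpOf 2 fun x => fderiv ℝ χ x e) v := by
    intro χ hχ hχs
    rw [inner_lpOf mQ, inner_lpOf (mD χ hχ hχs)]
    apply integral_congr_ae
    filter_upwards [coeFn_lpOf (memLp_gradient hχ hχs 2)] with x hx
    rw [hx, real_inner_smul_left, inner_gradient_right]
    simp
  have main := (hasWeakGrad_of_contDiff k1 k2).extend_test (ρ := ρ)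
    (P := lpOf 2 fun x => inner ℝ (V x) e) (Q := lpOf 2 fun x => v x • e) (by
      filter_upwards [coeFn_lpOf (memLp_of_contDiff k1 k2 2)] with x hx hxρ
      rw [hx, hρ x hxρ]) (by
      intro χ hχ _
      rw [hswap1 χ hχ.contDiff_one hχ.2, hswap2 χ hχ.contDiff_one hχ.2, add_comm]
      exact hasWeakGrad_iff.1 hv χ hχ e)
  rw [hswap1 _ k1 k2, hswap2 _ k1 k2] at main
  have hb : MemLp ψ ⊤ volume := memLp_of_contDiff h hs ⊤
  have mG := memLp_smul_of_bounded (v := v) (memLp_gradient h hs ⊤)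
  have s1 : inner ℝ (lpOf 2 fun x => fderiv ℝ (fun x => ψ x * φ x) x e) v
      = inner ℝ (lpOf 2 fun x => fderiv ℝ φ x e) (DampedWave.mul ψ v)
        + inner ℝ (lpOf 2 fun x => φ x • e) (lpOf 2 fun x => v x • gradient ψ x) := by
    rw [inner_lpOf (mD _ k1 k2), inner_lpOf (mD _ c1 hφ.2), inner_lpOf (m2 _ c1 hφ.2),
      ← integral_add]
    · apply integral_congr_ae
      filter_upwards [coeFn_mul hb v, coeFn_lpOf mG] with x h1 h2
      rw [h1, h2, fderiv_fun_mul (h.differentiable one_ne_zero x) (c1.differentiable one_ne_zero x)]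
      simp only [add_apply, smul_apply, smul_eq_mul,
        real_inner_smul_right, inner_gradient_right]
      simp
      ring
    · exact integrable_inner_of_continuous ((c1.continuous_fderiv one_ne_zero).clm_apply
        continuous_const) (hφ.2.fderiv_apply (𝕜 := ℝ) e) _
    · exact integrable_inner_of_continuous (c1.continuous.smul continuous_const)
        hφ.2.smul_right _
  have s2 : inner ℝ (lpOf 2 fun x => (ψ x * φ x) • e) V
      = inner ℝ (lpOf 2 fun x => φ x • e) (DampedWave.mul ψ V) := by
    rw [inner_lpOf (m2 _ k1 k2), inner_lpOf (m2 _ c1 hφ.2)]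
    apply integral_congr_ae
    filter_upwards [coeFn_mul hb V] with x h1
    rw [h1]
    simp only [real_inner_smul_left, real_inner_smul_right]
    ring
  rw [inner_add_right]
  linarith

end

/-! ### Energy identities in Hilbert space -/

section

open Filter Topology in
/-- Difference quotients of a `C¹` curve converge jointly in the increment and the base point. -/
lemma tendsto_diffQuot {X : Type*} [NormedAddCommGroup X] [NormedSpace ℝ X] {f f' : ℝ → X}
    {I : Set ℝ} (hI : IsOpen I) (hf : ∀ t ∈ I, HasDerivAt f (f' t) t) (hc : ContinuousOn f' I)
    {t : ℝ} (ht : t ∈ I) :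
    Tendsto (fun z : ℝ × ℝ => z.1⁻¹ • (f (z.2 + z.1) - f z.2)) (𝓝[≠] 0 ×ˢ 𝓝 t) (𝓝 (f' t)) := by
  have hs : HasStrictDerivAt f (f' t) t :=
    hasStrictDerivAt_of_hasDerivAt_of_continuousAt (Filter.eventually_of_mem (hI.mem_nhds ht) hf)
      (hc.continuousAt (hI.mem_nhds ht))
  have h1 : Tendsto (fun z : ℝ × ℝ => (z.2 + z.1, z.2)) (𝓝[≠] 0 ×ˢ 𝓝 t) (𝓝 (t, t)) := by
    have h2 : Tendsto (fun z : ℝ × ℝ => (z.2 + z.1, z.2)) (𝓝 (0, t)) (𝓝 (t + 0, t)) := by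
      refine Continuous.tendsto ?_ _
      fun_prop
    rw [nhds_prod_eq, add_zero] at h2
    exact h2.mono_left (prod_mono_left _ nhdsWithin_le_nhds)
  have h3 := (hasStrictFDerivAt_iff_isLittleO.1 hs.hasStrictFDerivAt).comp_tendsto h1
  have h4 : Tendsto (fun z : ℝ × ℝ => z.1⁻¹ • (f (z.2 + z.1) - f z.2 - z.1 • f' t))
      (𝓝[≠] 0 ×ˢ 𝓝 t) (𝓝 0) := by
    rw [Asymptotics.isLittleO_iff] at h3
    rw [Metric.tendsto_nhds]
    intro ε hε
    have hne : ∀ᶠ z : ℝ × ℝ in 𝓝[≠] 0 ×ˢ 𝓝 t, z.1 ≠ 0 :=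
      tendsto_fst.eventually (eventually_mem_nhdsWithin (a := (0 : ℝ)) (s := {0}ᶜ))
    filter_upwards [h3 (half_pos hε), hne] with z hz hz0
    simp only [Function.comp, add_sub_cancel_left, ContinuousLinearMap.toSpanSingleton_apply] at hz
    rw [dist_zero_right, norm_smul, norm_inv]
    have hpos : 0 < ‖z.1‖ := norm_pos_iff.2 hz0
    calc ‖z.1‖⁻¹ * ‖f (z.2 + z.1) - f z.2 - z.1 • f' t‖
        ≤ ‖z.1‖⁻¹ * (ε / 2 * ‖z.1‖) := by gcongr
      _ = ε / 2 := by field_simp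
      _ < ε := half_lt_self hε
  have hne : ∀ᶠ z : ℝ × ℝ in 𝓝[≠] 0 ×ˢ 𝓝 t, z.1 ≠ 0 :=
    tendsto_fst.eventually (eventually_mem_nhdsWithin (a := (0 : ℝ)) (s := {0}ᶜ))
  have h5 := h4.add_const (f' t)
  rw [zero_add] at h5
  refine h5.congr' ?_
  filter_upwards [hne] with z hz
  rw [smul_sub _ _ (z.1 • f' t), smul_smul, inv_mul_cancel₀ hz, one_smul, sub_add_cancel]

open Filter Topology in
/-- Differentiation of a limit of functions whose derivatives converge jointly in the parameter and
the base point. -/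
lemma hasDerivAt_of_tendsto_prod {e e' : ℝ → ℝ → ℝ} {E D : ℝ → ℝ} {t : ℝ}
    (hd : ∀ᶠ z : ℝ × ℝ in 𝓝[≠] 0 ×ˢ 𝓝 t, HasDerivAt (e z.1) (e' z.1 z.2) z.2)
    (hD : ContinuousAt D t)
    (hlim' : Tendsto (fun z : ℝ × ℝ => e' z.1 z.2) (𝓝[≠] 0 ×ˢ 𝓝 t) (𝓝 (D t)))
    (hlim : ∀ᶠ s in 𝓝 t,
      Tendsto (fun z : ℝ × ℝ => e z.1 z.2) (𝓝[≠] 0 ×ˢ 𝓝 s) (𝓝 (E s))) :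
    HasDerivAt E (D t) t := by
  refine hasDerivAt_of_tendstoUniformlyOnFilter (l := 𝓝[≠] (0 : ℝ)) ?_ hd ?_
  · rw [tendstoUniformlyOnFilter_iff_tendsto]
    refine Tendsto.mono_right ?_ (nhds_le_uniformity (D t))
    rw [nhds_prod_eq]
    exact (hD.tendsto.comp tendsto_snd).prodMk hlim'
  · filter_upwards [hlim] with s hs
    exact hs.comp (tendsto_id.prodMk (tendsto_const_nhds (x := s)))

section Hilbert

variable {H K : Type*} [NormedAddCommGroup H] [InnerProductSpace ℝ H] [NormedAddCommGroup K]
  [InnerProductSpace ℝ K] {A C : H →L[ℝ] H} {B : K →L[ℝ] K}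

lemma hasDerivAt_half_inner (hA : ∀ f g, inner ℝ (A f) g = inner ℝ f (A g)) {f : ℝ → H} {f' : H}
    {t : ℝ} (hf : HasDerivAt f f' t) :
    HasDerivAt (fun s => 1 / 2 * inner ℝ (A (f s)) (f s)) (inner ℝ (A (f t)) f') t := by
  have h := ((A.hasFDerivAt.comp_hasDerivAt t hf).inner ℝ hf).const_mul (1 / 2)
  refine h.congr_deriv ?_
  have : inner ℝ (A f') (f t) = inner ℝ (A (f t)) f' := by rw [hA, real_inner_comm]
  simp only [Function.comp, this]; ring

/-- Energy identity, obtained by testing the equation with the velocity. -/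
lemma hasDerivAt_energy (hC : ∀ f g, inner ℝ (C f) g = inner ℝ f (C g))
    (hB : ∀ f g, inner ℝ (B f) g = inner ℝ f (B g)) {w₁ : ℝ → H} {G : ℝ → K} {w₂ g : H} {G₁ : K}
    {t : ℝ} (hw₁ : HasDerivAt w₁ w₂ t) (hG : HasDerivAt G G₁ t)
    (heq : inner ℝ (C w₂) (w₁ t) + inner ℝ (A (w₁ t)) (w₁ t) + inner ℝ (B (G t)) G₁
      = inner ℝ g (w₁ t)) :
    HasDerivAt (fun s => 1 / 2 * inner ℝ (C (w₁ s)) (w₁ s) + 1 / 2 * inner ℝ (B (G s)) (G s))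
      (-inner ℝ (A (w₁ t)) (w₁ t) + inner ℝ g (w₁ t)) t := by
  refine ((hasDerivAt_half_inner hC hw₁).add (hasDerivAt_half_inner hB hG)).congr_deriv ?_
  have : inner ℝ (C (w₁ t)) w₂ = inner ℝ (C w₂) (w₁ t) := by rw [hC, real_inner_comm]
  linarith

/-- Equipartition identity, obtained by testing the equation with the solution itself. -/
lemma hasDerivAt_mixed (hA : ∀ f g, inner ℝ (A f) g = inner ℝ f (A g))
    {w w₁ : ℝ → H} {G : K} {w₂ g : H} {t : ℝ} (hw : HasDerivAt w (w₁ t) t)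
    (hw₁ : HasDerivAt w₁ w₂ t)
    (heq : inner ℝ (C w₂) (w t) + inner ℝ (A (w₁ t)) (w t) + inner ℝ (B G) G = inner ℝ g (w t)) :
    HasDerivAt (fun s => inner ℝ (C (w₁ s)) (w s) + 1 / 2 * inner ℝ (A (w s)) (w s))
      (inner ℝ (C (w₁ t)) (w₁ t) - inner ℝ (B G) G + inner ℝ g (w t)) t := by
  have h1 := (C.hasFDerivAt.comp_hasDerivAt t hw₁).inner ℝ hw
  refine (h1.add (hasDerivAt_half_inner hA hw)).congr_deriv ?_
  have : inner ℝ (A (w t)) (w₁ t) = inner ℝ (A (w₁ t)) (w t) := by rw [hA, real_inner_comm]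
  simp only [Function.comp]
  linarith

variable {V V₁ V₂ g g₁ : ℝ → H} {G G₁ : ℝ → K} {I : Set ℝ}

open Filter Topology in
/-- Energy and equipartition identities for the time derivative `w = V'` of a strong solution `V`.
As `w'` need not have a weak gradient, the identities are first applied to difference quotients of
`V`. Here `S` collects the pairs of a test element and its gradient. -/
lemma hasDerivAt_energy_mixed_deriv (hA : ∀ f g, inner ℝ (A f) g = inner ℝ f (A g))
    (hC : ∀ f g, inner ℝ (C f) g = inner ℝ f (C g)) (hB : ∀ f g, inner ℝ (B f) g = inner ℝ f (B g))
    (hI : IsOpen I) (hV : ∀ t ∈ I, HasDerivAt V (V₁ t) t) (hV₁ : ∀ t ∈ I, HasDerivAt V₁ (V₂ t) t)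
    (hV₂ : ContinuousOn V₂ I) (hG : ∀ t ∈ I, HasDerivAt G (G₁ t) t) (hG₁ : ContinuousOn G₁ I)
    (hg : ∀ t ∈ I, HasDerivAt g (g₁ t) t) (hg₁ : ContinuousOn g₁ I) (S : Submodule ℝ (H × K))
    (hS : ∀ t ∈ I, (V t, G t) ∈ S) (hS₁ : ∀ t ∈ I, (V₁ t, G₁ t) ∈ S)
    (heq : ∀ t ∈ I, ∀ z ∈ S, inner ℝ (C (V₂ t)) z.1 + inner ℝ (A (V₁ t)) z.1
      + inner ℝ (B (G t)) z.2 = inner ℝ (g t) z.1) {t : ℝ} (ht : t ∈ I) :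
    HasDerivAt (fun s => 1 / 2 * inner ℝ (C (V₂ s)) (V₂ s) + 1 / 2 * inner ℝ (B (G₁ s)) (G₁ s))
      (-inner ℝ (A (V₂ t)) (V₂ t) + inner ℝ (g₁ t) (V₂ t)) t ∧
    HasDerivAt (fun s => inner ℝ (C (V₂ s)) (V₁ s) + 1 / 2 * inner ℝ (A (V₁ s)) (V₁ s))
      (inner ℝ (C (V₂ t)) (V₂ t) - inner ℝ (B (G₁ t)) (G₁ t) + inner ℝ (g₁ t) (V₁ t)) t := by
  have hV₁c : ContinuousOn V₁ I := fun s hs => (hV₁ s hs).continuousAt.continuousWithinAt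
  have hcA : ∀ {X : Type} {l : Filter X} {a b : X → H} {a₀ b₀ : H}, Tendsto a l (𝓝 a₀) →
      Tendsto b l (𝓝 b₀) → ∀ L : H →L[ℝ] H,
      Tendsto (fun x => inner ℝ (L (a x)) (b x)) l (𝓝 (inner ℝ (L a₀) b₀)) :=
    fun ha hb L => ((L.continuous.tendsto _).comp ha).inner hb
  have hcB : ∀ {X : Type} {l : Filter X} {a b : X → K} {a₀ b₀ : K}, Tendsto a l (𝓝 a₀) →
      Tendsto b l (𝓝 b₀) → Tendsto (fun x => inner ℝ (B (a x)) (b x)) l (𝓝 (inner ℝ (B a₀) b₀)) :=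
    fun ha hb => ((B.continuous.tendsto _).comp ha).inner hb
  have dV := fun {s} (hs : s ∈ I) => tendsto_diffQuot hI hV hV₁c hs
  have dV₁ := fun {s} (hs : s ∈ I) => tendsto_diffQuot hI hV₁ hV₂ hs
  have dG := fun {s} (hs : s ∈ I) => tendsto_diffQuot hI hG hG₁ hs
  have dg := fun {s} (hs : s ∈ I) => tendsto_diffQuot hI hg hg₁ hs
  have cV₁ := hV₁c.continuousAt (hI.mem_nhds ht)
  have cV₂ := hV₂.continuousAt (hI.mem_nhds ht)
  have cG₁ := hG₁.continuousAt (hI.mem_nhds ht)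
  have cg₁ := hg₁.continuousAt (hI.mem_nhds ht)
  have hmem : ∀ᶠ z : ℝ × ℝ in 𝓝[≠] 0 ×ˢ 𝓝 t, z.2 ∈ I ∧ z.2 + z.1 ∈ I := by
    have h1 : Tendsto (fun z : ℝ × ℝ => z.2 + z.1) (𝓝[≠] 0 ×ˢ 𝓝 t) (𝓝 t) := by
      have h2 : Tendsto (fun z : ℝ × ℝ => z.2 + z.1) (𝓝 (0, t)) (𝓝 (t + 0)) :=
        Continuous.tendsto (by fun_prop) _
      rw [nhds_prod_eq, add_zero] at h2
      exact h2.mono_left (prod_mono_left _ nhdsWithin_le_nhds)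
    exact (tendsto_snd.eventually (hI.mem_nhds ht)).and (h1.eventually (hI.mem_nhds ht))
  have hdq : ∀ {X : Type _} [NormedAddCommGroup X] [NormedSpace ℝ X] {f f' : ℝ → X} {ε s : ℝ},
      (∀ t ∈ I, HasDerivAt f (f' t) t) → s ∈ I → s + ε ∈ I →
      HasDerivAt (fun r => ε⁻¹ • (f (r + ε) - f r)) (ε⁻¹ • (f' (s + ε) - f' s)) s :=
    fun hf hs hs' => (((hf _ hs').comp_add_const _ _).sub (hf _ hs)).const_smul _
  have hdqK : ∀ {f f' : ℝ → K} {ε s : ℝ},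
      (∀ t ∈ I, HasDerivAt f (f' t) t) → s ∈ I → s + ε ∈ I →
      HasDerivAt (fun r => ε⁻¹ • (f (r + ε) - f r)) (ε⁻¹ • (f' (s + ε) - f' s)) s :=
    fun hf hs hs' => (((hf _ hs').comp_add_const _ _).sub (hf _ hs)).const_smul _
  have hdeq : ∀ {ε s : ℝ}, s ∈ I → s + ε ∈ I → ∀ z ∈ S,
      inner ℝ (C (ε⁻¹ • (V₂ (s + ε) - V₂ s))) z.1 + inner ℝ (A (ε⁻¹ • (V₁ (s + ε) - V₁ s))) z.1
      + inner ℝ (B (ε⁻¹ • (G (s + ε) - G s))) z.2 = inner ℝ (ε⁻¹ • (g (s + ε) - g s)) z.1 := by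
    intro ε s hs hs' z hz
    simp only [map_smul, map_sub, real_inner_smul_left, inner_sub_left]
    linear_combination ε⁻¹ * (heq _ hs' z hz) - ε⁻¹ * (heq _ hs z hz)
  constructor
  · refine hasDerivAt_of_tendsto_prod
      (e := fun ε s => 1 / 2 * inner ℝ (C (ε⁻¹ • (V₁ (s + ε) - V₁ s))) (ε⁻¹ • (V₁ (s + ε) - V₁ s))
        + 1 / 2 * inner ℝ (B (ε⁻¹ • (G (s + ε) - G s))) (ε⁻¹ • (G (s + ε) - G s)))
      (e' := fun ε s =>
        -inner ℝ (A (ε⁻¹ • (V₁ (s + ε) - V₁ s))) (ε⁻¹ • (V₁ (s + ε) - V₁ s))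
        + inner ℝ (ε⁻¹ • (g (s + ε) - g s)) (ε⁻¹ • (V₁ (s + ε) - V₁ s)))
      (D := fun t => -inner ℝ (A (V₂ t)) (V₂ t) + inner ℝ (g₁ t) (V₂ t)) ?_ ?_ ?_ ?_
    · filter_upwards [hmem] with z hz
      exact hasDerivAt_energy hC hB (hdq hV₁ hz.1 hz.2) (hdqK hG hz.1 hz.2)
        (hdeq hz.1 hz.2 (_, _) (S.smul_mem _ (S.sub_mem (hS₁ _ hz.2) (hS₁ _ hz.1))))
    · exact ((hcA cV₂ cV₂ A).neg.add (cg₁.inner cV₂))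
    · exact (hcA (dV₁ ht) (dV₁ ht) A).neg.add ((dg ht).inner (dV₁ ht))
    · filter_upwards [hI.mem_nhds ht] with s hs
      exact ((hcA (dV₁ hs) (dV₁ hs) C).const_mul _).add ((hcB (dG hs) (dG hs)).const_mul _)
  · refine hasDerivAt_of_tendsto_prod
      (e := fun ε s => inner ℝ (C (ε⁻¹ • (V₁ (s + ε) - V₁ s))) (ε⁻¹ • (V (s + ε) - V s))
        + 1 / 2 * inner ℝ (A (ε⁻¹ • (V (s + ε) - V s))) (ε⁻¹ • (V (s + ε) - V s)))
      (e' := fun ε s =>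
        inner ℝ (C (ε⁻¹ • (V₁ (s + ε) - V₁ s))) (ε⁻¹ • (V₁ (s + ε) - V₁ s))
        - inner ℝ (B (ε⁻¹ • (G (s + ε) - G s))) (ε⁻¹ • (G (s + ε) - G s))
        + inner ℝ (ε⁻¹ • (g (s + ε) - g s)) (ε⁻¹ • (V (s + ε) - V s)))
      (D := fun t => inner ℝ (C (V₂ t)) (V₂ t) - inner ℝ (B (G₁ t)) (G₁ t)
        + inner ℝ (g₁ t) (V₁ t)) ?_ ?_ ?_ ?_
    · filter_upwards [hmem] with z hz
      exact hasDerivAt_mixed hA (hdq hV hz.1 hz.2) (hdq hV₁ hz.1 hz.2)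
        (hdeq hz.1 hz.2 (_, _) (S.smul_mem _ (S.sub_mem (hS _ hz.2) (hS _ hz.1))))
    · exact (((hcA cV₂ cV₂ C).sub (hcB cG₁ cG₁)).add (cg₁.inner cV₁))
    · exact ((hcA (dV₁ ht) (dV₁ ht) C).sub (hcB (dG ht) (dG ht))).add ((dg ht).inner (dV ht))
    · filter_upwards [hI.mem_nhds ht] with s hs
      exact (hcA (dV₁ hs) (dV hs) C).add ((hcA (dV hs) (dV hs) A).const_mul _)

end Hilbert

end

/-! ### The support gauge and the source term -/

section

variable {n : ℕ}

/-- If the time derivative is jointly continuous and the supports stay in a fixed ball, then a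
function is differentiable in time as an `L²` valued curve. -/
lemma hasDerivAt_lpOf_of_continuousOn {F F' : Space n → ℝ → ℝ} {T ρ : ℝ}
    (hF : ∀ x, ∀ t, 0 < t → HasDerivAt (F x) (F' x t) t)
    (hc : ContinuousOn (fun z : Space n × ℝ => F z.1 z.2) (univ ×ˢ Ioi 0))
    (hc' : ContinuousOn (fun z : Space n × ℝ => F' z.1 z.2) (univ ×ˢ Ioi 0))
    (h0 : ∀ x t, 0 < t → t < T → ρ < ‖x‖ → F x t = 0)
    (h0' : ∀ x t, 0 < t → t < T → ρ < ‖x‖ → F' x t = 0) {t : ℝ} (ht : 0 < t) (htT : t < T) :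
    HasDerivAt (fun s => lpOf 2 fun x => F x s) (lpOf 2 fun x => F' x t) t := by
  have slice : ∀ {f : Space n → ℝ → ℝ},
      ContinuousOn (fun z : Space n × ℝ => f z.1 z.2) (univ ×ˢ Ioi 0) →
      ∀ s, 0 < s → Continuous fun x => f x s := by
    intro f hf s hs
    rw [← continuousOn_univ]
    exact hf.comp (f := fun x : Space n => (x, s)) (by fun_prop) fun x _ => ⟨mem_univ _, hs⟩
  have hmem : ∀ {f : Space n → ℝ → ℝ},
      ContinuousOn (fun z : Space n × ℝ => f z.1 z.2) (univ ×ˢ Ioi 0) →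
      (∀ x t, 0 < t → t < T → ρ < ‖x‖ → f x t = 0) → ∀ s, 0 < s → s < T →
      MemLp (fun x => f x s) 2 volume := by
    intro f hf hf0 s hs hsT
    refine (slice hf s hs).memLp_of_hasCompactSupport
      (HasCompactSupport.intro (isCompact_closedBall (0 : Space n) ρ) fun x hx => ?_)
    exact hf0 x s hs hsT (by simpa using hx)
  have hnear : ∀ᶠ s in nhds t, 0 < s ∧ s < T :=
    (eventually_gt_nhds ht).and (eventually_lt_nhds htT)
  refine hasDerivAt_lpOf (ρ := ρ) ?_ (hmem hc' h0' t ht htT) ?_ ?_ ?_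
  · filter_upwards [hnear] with s hs using hmem hc h0 s hs.1 hs.2
  · filter_upwards [hnear] with s hs x hx using h0 x s hs.1 hs.2 (by simpa using hx)
  · exact fun x hx => h0' x t ht htT (by simpa using hx)
  · intro ε hε
    have hK : IsCompact (Metric.closedBall (0 : Space n) ρ ×ˢ Icc (t / 2) (2 * t)) :=
      (isCompact_closedBall _ _).prod isCompact_Icc
    have hsub : Metric.closedBall (0 : Space n) ρ ×ˢ Icc (t / 2) (2 * t) ⊆ univ ×ˢ Ioi 0 := by
      rintro ⟨x, s⟩ ⟨_, hs⟩
      exact ⟨mem_univ _, lt_of_lt_of_le (by positivity) hs.1⟩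
    obtain ⟨δ, hδ, hδ'⟩ := Metric.uniformContinuousOn_iff_le.1
      (hK.uniformContinuousOn_of_continuous (hc'.mono hsub)) ε hε
    have hn : ∀ᶠ s in nhds t, s ∈ Metric.closedBall t (min δ (t / 2)) :=
      Metric.closedBall_mem_nhds t (by positivity)
    filter_upwards [hn] with s hs x hx
    have hball : Metric.closedBall t (min δ (t / 2)) ⊆ Icc (t / 2) (2 * t) := by
      intro r hr
      rw [Metric.mem_closedBall, Real.dist_eq] at hr
      have := abs_le.1 (hr.trans (min_le_right _ _))
      constructor <;> linarith [this.1, this.2]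
    have key := (convex_closedBall t (min δ (t / 2))).norm_image_sub_le_of_norm_hasDerivWithin_le
      (f := fun r => F x r - r * F' x t) (f' := fun r => F' x r - F' x t) (C := ε) (x := t) (y := s)
      (fun r hr => ?_) (fun r hr => ?_) (Metric.mem_closedBall_self (by positivity)) hs
    · rw [Real.norm_eq_abs, Real.norm_eq_abs] at key
      refine le_trans (le_of_eq ?_) key
      congr 1; ring
    · have hr0 : 0 < r := lt_of_lt_of_le (by positivity) (hball hr).1
      have h1 := (hF x r hr0).sub ((hasDerivAt_id r).mul_const (F' x t))
      simp only [one_mul] at h1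
      exact h1.hasDerivWithinAt
    · have h1 := hδ' (x, r) ⟨hx, hball hr⟩ (x, t) ⟨hx, by constructor <;> linarith⟩ (by
        rw [Prod.dist_eq, dist_self]
        exact max_le hδ.le ((Metric.mem_closedBall.1 hr).trans (min_le_left _ _)))
      exact h1

lemma contDiffOn_iteratedDeriv_snd {h : Space n → ℝ → ℝ}
    (hh : ContDiffOn ℝ ∞ (fun z : Space n × ℝ => h z.1 z.2) (univ ×ˢ Ioi 0)) (i : ℕ) :
    ContDiffOn ℝ ∞ (fun z : Space n × ℝ => iteratedDeriv i (h z.1) z.2) (univ ×ˢ Ioi 0) ∧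
    ∀ x t, 0 < t → HasDerivAt (iteratedDeriv i (h x)) (iteratedDeriv (i + 1) (h x) t) t := by
  have hopen : IsOpen ((univ : Set (Space n)) ×ˢ Ioi (0 : ℝ)) := isOpen_univ.prod isOpen_Ioi
  have step : ∀ f : Space n → ℝ → ℝ,
      ContDiffOn ℝ ∞ (fun z : Space n × ℝ => f z.1 z.2) (univ ×ˢ Ioi 0) →
      ∀ x t, 0 < t → HasDerivAt (f x)
        (fderiv ℝ (fun z : Space n × ℝ => f z.1 z.2) (x, t) (0, 1)) t := by
    intro f hf x t ht
    have h1 := ((hf.differentiableOn (by simp)) (x, t) ⟨mem_univ _, ht⟩).differentiableAt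
      (hopen.mem_nhds ⟨mem_univ _, ht⟩)
    have h2 : HasDerivAt (fun s : ℝ => (x, s)) ((0 : Space n), (1 : ℝ)) t :=
      (hasDerivAt_const t x).prodMk (hasDerivAt_id t)
    exact h1.hasFDerivAt.comp_hasDerivAt t h2
  have main : ContDiffOn ℝ ∞ (fun z : Space n × ℝ => iteratedDeriv i (h z.1) z.2)
      (univ ×ˢ Ioi 0) := by
    induction i with
    | zero => simpa using hh
    | succ i ih =>
      have h1 : ContDiffOn ℝ ∞ (fun z : Space n × ℝ =>
          fderiv ℝ (fun z : Space n × ℝ => iteratedDeriv i (h z.1) z.2) z (0, 1))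
          (univ ×ˢ Ioi 0) :=
        (ih.fderiv_of_isOpen hopen (by simp)).clm_apply contDiffOn_const
      refine h1.congr fun z hz => ?_
      rw [iteratedDeriv_succ]
      exact (step (fun x => iteratedDeriv i (h x)) ih z.1 z.2 hz.2).deriv
  refine ⟨main, fun x t ht => ?_⟩
  rw [iteratedDeriv_succ]
  exact (step (fun x => iteratedDeriv i (h x)) main x t ht).differentiableAt.hasDerivAt

lemma IsSource.iteratedDeriv_eq_zero {q : ℝ → ℝ} {R : ℝ} {h : Space n → ℝ → ℝ}
    (hs : IsSource q R h) (i : ℕ) {x : Space n} {t : ℝ} (ht : 0 < t) (hx : t + q R < q ‖x‖) :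
    iteratedDeriv i (h x) t = 0 := by
  have h1 : h x =ᶠ[nhds t] fun _ => 0 := by
    filter_upwards [eventually_gt_nhds ht, eventually_lt_nhds (show t < q ‖x‖ - q R by linarith)]
      with s hs1 hs2
    exact hs.support x s hs1 (by linarith)
  rw [h1.iteratedDeriv_eq i]
  simp

section Gauge

variable {b c : Space n → ℝ} {β γ : ℝ} {q : ℝ → ℝ}

/-- Polynomial growth of the gauge confines the set `q(|x|) ≤ t + q(R) + 1` to
`1 + |x| ≤ L (1 + t)^{2/(2-β-γ)}`. -/
lemma IsSupportGauge.exists_bound (hq : IsSupportGauge b c β γ q) (hβγ : β + γ < 2) {R : ℝ}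
    (hR : 0 ≤ R) : ∃ L : ℝ, 0 < L ∧ ∀ (t r : ℝ), 0 ≤ t → 0 ≤ r → q r ≤ t + 1 + q R →
      1 + r ≤ L * (1 + t) ^ (2 / (2 - β - γ)) := by
  obtain ⟨q₀, hq₀, hg⟩ := hq.growth
  set m := 1 - (β + γ) / 2 with hm
  have hm0 : 0 < m := by rw [hm]; linarith
  have hmi : 2 / (2 - β - γ) = 1 / m := by rw [hm]; field_simp; ring
  have hqR : 0 ≤ q R := le_trans (by positivity) (hg R hR)
  refine ⟨1 + ((1 + q R) / q₀) ^ (1 / m), by positivity, fun t r ht hr h => ?_⟩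
  have h1 : r ^ m ≤ (1 + q R) / q₀ * (1 + t) := by
    rw [div_mul_eq_mul_div, le_div_iff₀ hq₀]
    nlinarith [hg r hr]
  have h2 : r ≤ ((1 + q R) / q₀) ^ (1 / m) * (1 + t) ^ (1 / m) := by
    rw [← Real.mul_rpow (by positivity) (by positivity)]
    calc r = (r ^ m) ^ (1 / m) := by
          rw [← Real.rpow_mul hr, mul_one_div_cancel hm0.ne', Real.rpow_one]
      _ ≤ _ := Real.rpow_le_rpow (by positivity) h1 (by positivity)
  have h3 : (1 : ℝ) ≤ (1 + t) ^ (1 / m) := Real.one_le_rpow (by linarith) (by positivity)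
  rw [hmi]
  linarith

lemma IsSupportGauge.exists_radius (hq : IsSupportGauge b c β γ q) (hβγ : β + γ < 2) (s : ℝ) :
    ∃ ρ : ℝ, 0 ≤ ρ ∧ ∀ x : Space n, ρ < ‖x‖ → s < q ‖x‖ := by
  obtain ⟨q₀, hq₀, hg⟩ := hq.growth
  set m := 1 - (β + γ) / 2 with hm
  have hm0 : 0 < m := by rw [hm]; linarith
  refine ⟨(|s| / q₀) ^ (1 / m), by positivity, fun x hx => ?_⟩
  have h1 : |s| / q₀ < ‖x‖ ^ m := by
    calc |s| / q₀ = ((|s| / q₀) ^ (1 / m)) ^ m := by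
          rw [← Real.rpow_mul (by positivity), one_div_mul_cancel hm0.ne', Real.rpow_one]
      _ < _ := Real.rpow_lt_rpow (by positivity) hx hm0
  rw [div_lt_iff₀ hq₀] at h1
  linarith [hg ‖x‖ (norm_nonneg _), le_abs_self s]

end Gauge

end

/-! ### The equations for the time derivatives -/

section

variable {n : ℕ} {E : Type*} [NormedAddCommGroup E] [InnerProductSpace ℝ E]

/-- The time derivative `∂_t^i h(·, t)` of the source as an element of `L²`. -/
def src (h : Space n → ℝ → ℝ) (i : ℕ) (t : ℝ) : L2 n := lpOf 2 fun x => iteratedDeriv i (h x) t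

section Source

variable {b c : Space n → ℝ} {β γ R : ℝ} {q : ℝ → ℝ} {h : Space n → ℝ → ℝ}

lemma IsSource.exists_radius (hs : IsSource q R h) (hq : IsSupportGauge b c β γ q)
    (hβγ : β + γ < 2) (T : ℝ) : ∃ ρ : ℝ, ∀ i x t, 0 < t → t < T → ρ < ‖x‖ →
      iteratedDeriv i (h x) t = 0 := by
  obtain ⟨ρ, -, hρ⟩ := hq.exists_radius hβγ (T + q R)
  exact ⟨ρ, fun i x t ht htT hx => hs.iteratedDeriv_eq_zero i ht (by linarith [hρ x hx])⟩

lemma IsSource.continuous_iteratedDeriv (hs : IsSource q R h) (i : ℕ) {t : ℝ} (ht : 0 < t) :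
    Continuous fun x => iteratedDeriv i (h x) t := by
  rw [← continuousOn_univ]
  exact (contDiffOn_iteratedDeriv_snd hs.smooth i).1.continuousOn.comp
    (f := fun x : Space n => (x, t)) (by fun_prop) fun x _ => ⟨mem_univ _, ht⟩

lemma IsSource.memLp (hs : IsSource q R h) (hq : IsSupportGauge b c β γ q)
    (hβγ : β + γ < 2) (i : ℕ) {t : ℝ} (ht : 0 < t) :
    MemLp (fun x => iteratedDeriv i (h x) t) 2 volume := by
  obtain ⟨ρ, hρ⟩ := hs.exists_radius hq hβγ (t + 1)
  refine (hs.continuous_iteratedDeriv i ht).memLp_of_hasCompactSupport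
    (HasCompactSupport.intro (isCompact_closedBall (0 : Space n) ρ) fun x hx => ?_)
  exact hρ i x t ht (by linarith) (by simpa using hx)

lemma IsSource.hasDerivAt_src (hs : IsSource q R h) (hq : IsSupportGauge b c β γ q)
    (hβγ : β + γ < 2) (i : ℕ) {t : ℝ} (ht : 0 < t) :
    HasDerivAt (src h i) (src h (i + 1) t) t := by
  obtain ⟨ρ, hρ⟩ := hs.exists_radius hq hβγ (t + 1)
  exact hasDerivAt_lpOf_of_continuousOn (contDiffOn_iteratedDeriv_snd hs.smooth i).2
    (contDiffOn_iteratedDeriv_snd hs.smooth i).1.continuousOn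
    (contDiffOn_iteratedDeriv_snd hs.smooth (i + 1)).1.continuousOn
    (hρ i) (hρ (i + 1)) ht (lt_add_one t)

end Source

section Regularity

variable {k : ℕ} {u : ℝ → L2 n}

lemma TimeRegular.hasDerivAt (hu : TimeRegular k u) {i : ℕ} (hi : i ≤ k) {t : ℝ} (ht : 0 < t) :
    HasDerivAt (iteratedDeriv i u) (iteratedDeriv (i + 1) u t) t := by
  have h1 := hu.1.differentiableOn_iteratedDerivWithin (m := i)
    (by exact_mod_cast Nat.lt_succ_of_le hi) (uniqueDiffOn_Ioi 0)
  have h2 : DifferentiableOn ℝ (iteratedDeriv i u) (Ioi 0) :=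
    h1.congr fun s hs => (iteratedDerivWithin_of_isOpen isOpen_Ioi hs).symm
  rw [iteratedDeriv_succ]
  exact (h2.differentiableAt (Ioi_mem_nhds ht)).hasDerivAt

lemma TimeRegular.continuousOn (hu : TimeRegular k u) {i : ℕ} (hi : i ≤ k + 1) :
    ContinuousOn (iteratedDeriv i u) (Ioi 0) :=
  (hu.1.continuousOn_iteratedDerivWithin (m := i) (by exact_mod_cast hi)
    (uniqueDiffOn_Ioi 0)).congr fun _ hs => (iteratedDerivWithin_of_isOpen isOpen_Ioi hs).symm

lemma TimeRegular.hasWeakGrad (hu : TimeRegular k u) {i : ℕ} (hi : i ≤ k) {t : ℝ} (ht : 0 < t) :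
    HasWeakGrad (iteratedDeriv i u t) (weakGrad (iteratedDeriv i u t)) :=
  ((hu.2 i hi).1 t ht).hasWeakGrad

lemma TimeRegular.hasDerivAt_weakGrad (hu : TimeRegular k u) {i : ℕ} (hi : i < k) {t : ℝ}
    (ht : 0 < t) :
    HasDerivAt (fun s => weakGrad (iteratedDeriv i u s)) (weakGrad (iteratedDeriv (i + 1) u t)) t :=
  DampedWave.hasDerivAt_weakGrad isOpen_Ioi ordConnected_Ioi
    (fun _ hs => hu.hasDerivAt hi.le hs) (hu.continuousOn (by omega))
    (fun _ hs => hu.hasWeakGrad hi.le hs) (G' := fun s => weakGrad (iteratedDeriv (i + 1) u s))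
    (fun _ hs => hu.hasWeakGrad hi hs) (hu.2 (i + 1) hi).2.2 ht

end Regularity

/-- Truncation of a coefficient to a ball. The weights `b`, `a⁻¹` may be unbounded, but their
truncations act on `L²`. -/
def cut (ρ : ℝ) (m : Space n → ℝ) : Space n → ℝ := (Metric.closedBall (0 : Space n) ρ).indicator m

lemma cut_of_le {ρ : ℝ} {m : Space n → ℝ} {x : Space n} (hx : ‖x‖ ≤ ρ) : cut ρ m x = m x :=
  indicator_of_mem (by simpa using hx) _

lemma cut_of_lt {ρ : ℝ} {m : Space n → ℝ} {x : Space n} (hx : ρ < ‖x‖) : cut ρ m x = 0 :=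
  indicator_of_notMem (by simpa using hx) _

lemma memLp_cut {m : Space n → ℝ} (hm : Continuous m) (ρ : ℝ) : MemLp (cut ρ m) ⊤ volume := by
  obtain ⟨M, hM⟩ := (isCompact_closedBall (0 : Space n) ρ).exists_bound_of_continuousOn
    hm.continuousOn
  refine memLp_of_bound ⊤ (hm.aestronglyMeasurable.indicator measurableSet_closedBall)
    (M := M) (ρ := ρ) (fun x hx => ?_) (fun x hx => indicator_of_notMem hx _)
  rw [cut, indicator_of_mem hx]; exact hM x hx

/-- Pairing with a test function that is supported in the ball of truncation. -/
lemma inner_mul_cut_lpOf {m : Space n → ℝ} (hm : Continuous m) {ρ : ℝ} {ψ : Space n → E}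
    (hψ : Continuous ψ) (hs : HasCompactSupport ψ) (h0 : ∀ x, ρ < ‖x‖ → ψ x = 0)
    (f : Lp E 2 (volume : Measure (Space n))) :
    inner ℝ (mul (cut ρ m) f) (lpOf 2 ψ) = inner ℝ (lpOf 2 fun x => m x • ψ x) f := by
  rw [inner_mul (memLp_cut hm ρ),
    inner_lpOf (ψ := fun x => m x • ψ x) ((hm.smul hψ).memLp_of_hasCompactSupport hs.smul_left)]
  apply integral_congr_ae
  filter_upwards [coeFn_lpOf (hψ.memLp_of_hasCompactSupport hs (p := 2) (μ := volume))] with x hx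
  rw [hx]
  by_cases h : ‖x‖ ≤ ρ
  · rw [cut_of_le h, real_inner_smul_left, real_inner_comm]
  · rw [h0 x (not_le.1 h)]; simp

section Equation

variable {a b c : Space n → ℝ} {β γ R : ℝ} {q : ℝ → ℝ} {h : Space n → ℝ → ℝ} {k : ℕ}
  {u₀ u₁ : L2 n} {u : ℝ → L2 n}

/-- Differentiating the weak formulation in time. -/
lemma IsSolution.equation_test (hsol : IsSolution a b c h u₀ u₁ u) (ha : Continuous a)
    (hb : Continuous b) (hc : Continuous c) (hs : IsSource q R h) (hq : IsSupportGauge b c β γ q)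
    (hβγ : β + γ < 2) (hu : TimeRegular k u) {φ : Space n → ℝ} (hφ : IsTest φ) (i : ℕ)
    (hi : i < k) {t : ℝ} (ht : 0 < t) :
    inner ℝ (lpOf 2 fun x => c x • φ x) (iteratedDeriv (i + 2) u t)
      + inner ℝ (lpOf 2 fun x => a x • φ x) (iteratedDeriv (i + 1) u t)
      + inner ℝ (lpOf 2 fun x => b x • gradient φ x) (weakGrad (iteratedDeriv i u t))
      = inner ℝ (src h i t) (lpOf 2 φ) := by
  have c1 := hφ.contDiff_one
  have hm : ∀ {m : Space n → ℝ}, Continuous m → MemLp (fun x => m x • φ x) 2 volume :=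
    fun hm => (hm.smul c1.continuous).memLp_of_hasCompactSupport hφ.2.smul_left
  have hmg : MemLp (fun x => b x • gradient φ x) 2 volume :=
    (hb.smul (continuous_gradient c1)).memLp_of_hasCompactSupport
      (hasCompactSupport_gradient hφ.2).smul_left
  induction i generalizing t with
  | zero =>
    have h1 := hsol.equation φ hφ t ht
    have e1 : (fun s => ∫ x, c x * deriv u s x * φ x)
        = fun s => inner ℝ (lpOf 2 fun x => c x • φ x) (iteratedDeriv 1 u s) := by
      funext s
      rw [inner_lpOf (hm hc), iteratedDeriv_one]
      refine integral_congr_ae (.of_forall fun x => ?_)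
      simp; ring
    have h2 : HasDerivAt (fun s => inner ℝ (lpOf 2 fun x => c x • φ x) (iteratedDeriv 1 u s))
        (inner ℝ (lpOf 2 fun x => c x • φ x) (iteratedDeriv 2 u t)) t :=
      (innerSL ℝ (lpOf 2 fun x => c x • φ x)).hasFDerivAt.comp_hasDerivAt t
        (hu.hasDerivAt (i := 1) hi ht)
    rw [e1] at h1
    have h3 := h2.unique h1
    have e2 : ∫ x, h x t * φ x = inner ℝ (src h 0 t) (lpOf 2 φ) := by
      rw [real_inner_comm, inner_lpOf (memLp_of_contDiff c1 hφ.2 2), src]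
      apply integral_congr_ae
      filter_upwards [coeFn_lpOf (hs.memLp hq hβγ 0 ht)] with x hx
      rw [hx]; simp
    have e3 : ∫ x, a x * deriv u t x * φ x
        = inner ℝ (lpOf 2 fun x => a x • φ x) (iteratedDeriv 1 u t) := by
      rw [inner_lpOf (hm ha), iteratedDeriv_one]
      refine integral_congr_ae (.of_forall fun x => ?_)
      simp; ring
    have e4 : ∫ x, b x * inner ℝ (weakGrad (u t) x) (gradient φ x)
        = inner ℝ (lpOf 2 fun x => b x • gradient φ x) (weakGrad (u t)) := by
      rw [inner_lpOf hmg]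
      refine integral_congr_ae (.of_forall fun x => ?_)
      simp only [real_inner_smul_left]
      rw [real_inner_comm]
    rw [e2, e3, e4] at h3
    simp only [zero_add, iteratedDeriv_zero]
    linarith
  | succ i ih =>
    have hd : ∀ {X : Type} [NormedAddCommGroup X] [InnerProductSpace ℝ X] (f : X) {g : ℝ → X}
        {g' : X}, HasDerivAt g g' t → HasDerivAt (fun s => inner ℝ f (g s)) (inner ℝ f g') t :=
      fun {X} _ _ f {g g'} hg => (innerSL ℝ f).hasFDerivAt.comp_hasDerivAt t hg
    have h1 := ((hd (lpOf 2 fun x => c x • φ x) (hu.hasDerivAt (i := i + 2) (by omega) ht)).add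
      (hd (lpOf 2 fun x => a x • φ x) (hu.hasDerivAt (i := i + 1) (by omega) ht))).add
      (hd (lpOf 2 fun x => b x • gradient φ x) (hu.hasDerivAt_weakGrad (i := i) (by omega) ht))
    have h2 := hd (lpOf 2 φ) (hs.hasDerivAt_src hq hβγ i ht)
    simp_rw [real_inner_comm _ (lpOf 2 φ)] at h2
    refine h1.unique (h2.congr_of_eventuallyEq ?_)
    filter_upwards [eventually_gt_nhds ht] with s hs'
    exact ih (by omega) hs'

/-- Pairs `(f, ∇f)` with `f ∈ H¹` vanishing outside the ball of radius `σ`. -/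
def testPairs (n : ℕ) (σ : ℝ) : Submodule ℝ (L2 n × L2Vec n) where
  carrier := {z | HasWeakGrad z.1 z.2 ∧ ∀ᵐ x, σ < ‖x‖ → z.1 x = 0}
  add_mem' := by
    rintro z z' ⟨h1, h2⟩ ⟨h3, h4⟩
    refine ⟨h1.add h3, ?_⟩
    filter_upwards [h2, h4, Lp.coeFn_add z.1 z'.1] with x a1 a2 a3 hx
    rw [Prod.fst_add, a3, Pi.add_apply, a1 hx, a2 hx, add_zero]
  zero_mem' := by
    refine ⟨hasWeakGrad_zero, ?_⟩
    filter_upwards [Lp.coeFn_zero ℝ 2 (volume : Measure (Space n))] with x hx _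
    exact hx
  smul_mem' := by
    rintro r z ⟨h1, h2⟩
    refine ⟨h1.smul r, ?_⟩
    filter_upwards [h2, Lp.coeFn_smul r z.1] with x a1 a2 hx
    rw [Prod.smul_fst, a2, Pi.smul_apply, a1 hx, smul_zero]

/-- The equation for `∂_t^i u`, tested with compactly supported elements of `H¹`. -/
lemma IsSolution.equation_testPairs (hsol : IsSolution a b c h u₀ u₁ u) (ha : Continuous a)
    (hb : Continuous b) (hc : Continuous c) (hs : IsSource q R h) (hq : IsSupportGauge b c β γ q)
    (hβγ : β + γ < 2) (hu : TimeRegular k u) {i : ℕ} (hi : i < k) {t : ℝ} (ht : 0 < t) {σ : ℝ}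
    {z : L2 n × L2Vec n} (hz : z ∈ testPairs n σ) :
    inner ℝ (mul (cut (σ + 1) c) (iteratedDeriv (i + 2) u t)) z.1
      + inner ℝ (mul (cut (σ + 1) a) (iteratedDeriv (i + 1) u t)) z.1
      + inner ℝ (mul (cut (σ + 1) b) (weakGrad (iteratedDeriv i u t))) z.2
      = inner ℝ (src h i t) z.1 := by
  have key := hz.1.extend_test hz.2
    (P := mul (cut (σ + 1) c) (iteratedDeriv (i + 2) u t)
      + mul (cut (σ + 1) a) (iteratedDeriv (i + 1) u t) - src h i t)
    (Q := mul (cut (σ + 1) b) (weakGrad (iteratedDeriv i u t))) (fun φ hφ h0 => ?_)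
  · rw [inner_sub_left, inner_add_left] at key
    linarith
  · have c1 := hφ.contDiff_one
    have h0' : ∀ x, σ + 1 < ‖x‖ → gradient φ x = 0 := fun x hx => by
      apply gradient_eq_zero_of_notMem_tsupport
      have hsub : tsupport φ ⊆ Metric.closedBall 0 (σ + 1) := by
        refine closure_minimal (fun y hy => ?_) Metric.isClosed_closedBall
        by_contra hy'
        exact hy (h0 y (by simpa using hy'))
      intro hx'
      have := mem_closedBall_zero_iff.1 (hsub hx')
      linarith
    rw [inner_sub_left, inner_add_left, inner_mul_cut_lpOf hc c1.continuous hφ.2 h0,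
      inner_mul_cut_lpOf ha c1.continuous hφ.2 h0,
      inner_mul_cut_lpOf hb (continuous_gradient c1) (hasCompactSupport_gradient hφ.2) h0']
    linarith [hsol.equation_test ha hb hc hs hq hβγ hu hφ i hi ht]

end Equation

end

/-! ### Backward cones -/

section

variable {n : ℕ}

lemma abs_posPart_sq_sub_le (s ε : ℝ) :
    |(max (s + ε) 0) ^ 2 - (max s 0) ^ 2 - 2 * ε * max s 0| ≤ ε ^ 2 := by
  rcases le_total (s + ε) 0 with h1 | h1 <;> rcases le_total s 0 with h2 | h2 <;>
    simp only [max_eq_left, max_eq_right, h1, h2] <;> rw [abs_le] <;> constructor <;> nlinarith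

lemma hasDerivAt_posPart_sq (s : ℝ) : HasDerivAt (fun r : ℝ => (max r 0) ^ 2) (2 * max s 0) s := by
  rw [hasDerivAt_iff_isLittleO, Asymptotics.isLittleO_iff]
  intro ε hε
  filter_upwards [Metric.ball_mem_nhds s hε] with r hr
  have h := abs_posPart_sq_sub_le s (r - s)
  rw [add_sub_cancel] at h
  rw [Metric.mem_ball, Real.dist_eq] at hr
  rw [Real.norm_eq_abs, Real.norm_eq_abs, smul_eq_mul]
  have e : (r - s) * (2 * max s 0) = 2 * (r - s) * max s 0 := by ring
  rw [e]
  calc _ ≤ (r - s) ^ 2 := h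
    _ = |r - s| * |r - s| := by rw [← sq, sq_abs]
    _ ≤ _ := by gcongr

lemma contDiff_posPart_sq : ContDiff ℝ 1 fun r : ℝ => (max r 0) ^ 2 := by
  rw [contDiff_one_iff_deriv]
  refine ⟨fun s => (hasDerivAt_posPart_sq s).differentiableAt, ?_⟩
  have : deriv (fun r : ℝ => (max r 0) ^ 2) = fun s => 2 * max s 0 :=
    funext fun s => (hasDerivAt_posPart_sq s).deriv
  rw [this]; fun_prop

/-- A smoothed version of `min (q(|x|) - q(R)) (2N - q(R) - q(|x|))`. The sets where it exceeds `t`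
are sections of backward cones, and exhaust `q(|x|) > t + q(R)` as `N → ∞`. -/
def cone (q : ℝ → ℝ) (R N : ℝ) (x : Space n) : ℝ := N - q R - √((q ‖x‖ - N) ^ 2 + 1)

/-- The cutoff `(cone - t)₊²`. -/
def coneCutoff (q : ℝ → ℝ) (R N t : ℝ) (x : Space n) : ℝ := (max (cone q R N x - t) 0) ^ 2

lemma cone_lt (q : ℝ → ℝ) (R N : ℝ) (x : Space n) : cone q R N x < q ‖x‖ - q R := by
  have h : N - q ‖x‖ < √((q ‖x‖ - N) ^ 2 + 1) := Real.lt_sqrt_of_sq_lt (by nlinarith)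
  rw [cone]; linarith

/-- The cones exhaust the complement of the propagation region. -/
lemma exists_lt_cone (q : ℝ → ℝ) {R t : ℝ} {x : Space n} (h : t + q R < q ‖x‖) :
    ∃ N : ℕ, t < cone q R N x := by
  set δ := q ‖x‖ - q R - t with hδ
  have hδ0 : 0 < δ := by rw [hδ]; linarith
  obtain ⟨N, hN⟩ := exists_nat_gt (q ‖x‖ + 1 / δ)
  refine ⟨N, ?_⟩
  have h1 : 1 / δ < N - q ‖x‖ := by linarith
  have h2 : 0 < 1 / δ := by positivity
  have h3 : √((q ‖x‖ - N) ^ 2 + 1) < N - q ‖x‖ + δ := by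
    rw [Real.sqrt_lt' (by linarith)]
    have h4 : 1 < δ * (N - q ‖x‖) := by
      rw [div_lt_iff₀ hδ0] at h1; linarith
    nlinarith
  rw [cone]; linarith

section Gauge

variable {b c : Space n → ℝ} {β γ R N : ℝ} {q : ℝ → ℝ}

lemma IsSupportGauge.continuous_norm (hq : IsSupportGauge b c β γ q) :
    Continuous fun x : Space n => q ‖x‖ :=
  hq.contDiffOn.continuousOn.comp_continuous _root_.continuous_norm fun x => norm_nonneg x

lemma IsSupportGauge.continuous_cone (hq : IsSupportGauge b c β γ q) :
    Continuous (cone q R N : Space n → ℝ) := by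
  have := hq.continuous_norm
  exact continuous_const.sub (((this.sub continuous_const).pow 2).add continuous_const).sqrt

lemma IsSupportGauge.exists_cone_lt (hq : IsSupportGauge b c β γ q) (hβγ : β + γ < 2) (R N : ℝ) :
    ∃ ρ : ℝ, ∀ x : Space n, ρ < ‖x‖ → cone q R N x < -1 := by
  obtain ⟨ρ, -, h⟩ := hq.exists_radius hβγ (2 * N - q R + 1)
  refine ⟨ρ, fun x hx => ?_⟩
  have h1 : q ‖x‖ - N ≤ √((q ‖x‖ - N) ^ 2 + 1) := Real.le_sqrt_of_sq_le (by linarith)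
  rw [cone]
  linarith [h x hx]

lemma IsSupportGauge.le_of_norm_le (hn : 1 ≤ n) (hq : IsSupportGauge b c β γ q) (hR : 0 ≤ R)
    {x : Space n} (hx : ‖x‖ ≤ R) : q ‖x‖ ≤ q R := by
  have : Nonempty (Fin n) := ⟨⟨0, hn⟩⟩
  have hmono : StrictMonoOn q (Ici 0) := by
    refine strictMonoOn_of_deriv_pos (convex_Ici 0) hq.contDiffOn.continuousOn fun r hr => ?_
    rw [interior_Ici] at hr
    obtain ⟨y, hy⟩ := exists_norm_eq (Space n) (le_of_lt hr)
    have h := hq.deriv_pos y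
    rwa [hy, derivWithin_of_mem_nhds (Ici_mem_nhds hr)] at h
  exact hmono.monotoneOn (norm_nonneg x) hR hx

lemma coneCutoff_nonneg (t : ℝ) (x : Space n) : 0 ≤ coneCutoff q R N t x := sq_nonneg _

lemma coneCutoff_eq_zero {t : ℝ} {x : Space n} (h : cone q R N x ≤ t) :
    coneCutoff q R N t x = 0 := by
  rw [coneCutoff, max_eq_right (by linarith)]; norm_num

/-- The cutoffs are `C¹`, and their gradients are controlled by their time derivatives. -/
lemma IsSupportGauge.coneCutoff_regular (hq : IsSupportGauge b c β γ q) (hR : q 0 ≤ q R)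
    {t : ℝ} (ht : 0 ≤ t) :
    ContDiff ℝ 1 (coneCutoff q R N t : Space n → ℝ) ∧
    ∀ x : Space n, ‖gradient (coneCutoff q R N t) x‖ ≤
      2 * max (cone q R N x - t) 0 * √(c x / b x) := by
  have hcontc : Continuous (cone q R N : Space n → ℝ) := hq.continuous_cone
  have h0 : cone q R N (0 : Space n) < 0 := by
    have := cone_lt q R N (0 : Space n)
    rw [norm_zero] at this; linarith
  -- near the origin, where `|x|` is not differentiable, the cutoff vanishes identically
  have hnear : (coneCutoff q R N t : Space n → ℝ) =ᶠ[nhds 0] fun _ => 0 := by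
    filter_upwards [hcontc.continuousAt.eventually_lt continuousAt_const h0] with x hx
    exact coneCutoff_eq_zero (by linarith)
  have hpos : ∀ x : Space n, x ≠ 0 → ContDiffAt ℝ 1 q ‖x‖ := fun x hx =>
    hq.contDiffOn.contDiffAt (Ici_mem_nhds (norm_pos_iff.2 hx))
  have hsq : ∀ s : ℝ, HasDerivAt (fun r : ℝ => √((r - N) ^ 2 + 1))
      ((s - N) / √((s - N) ^ 2 + 1)) s := fun s => by
    have h1 : HasDerivAt (fun r : ℝ => (r - N) ^ 2 + 1) (2 * (s - N)) s := by
      have := (((hasDerivAt_id s).sub_const N).pow 2).add_const 1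
      simpa using! this
    have h2 := h1.sqrt (by positivity)
    refine h2.congr_deriv ?_
    field_simp
  constructor
  · rw [contDiff_iff_contDiffAt]
    intro x
    rcases eq_or_ne x 0 with rfl | hx
    · exact contDiffAt_const.congr_of_eventuallyEq hnear
    · have h1 : ContDiffAt ℝ 1 (fun y : Space n => q ‖y‖) x :=
        (hpos x hx).comp x (contDiffAt_norm ℝ hx)
      have h2 : ContDiffAt ℝ 1 (fun y : Space n => cone q R N y - t) x := by
        have h3 : ContDiffAt ℝ 1 (fun y : Space n => √((q ‖y‖ - N) ^ 2 + 1)) x :=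
          (((h1.sub contDiffAt_const).pow 2).add contDiffAt_const).sqrt (by positivity)
        exact (contDiffAt_const.sub h3).sub contDiffAt_const
      exact contDiff_posPart_sq.contDiffAt.comp x h2
  · intro x
    rcases eq_or_ne x 0 with rfl | hx
    · rw [hnear.gradient_eq]
      simp only [gradient_fun_const, norm_zero]
      positivity
    · have hqd : HasDerivAt q (derivWithin q (Ici 0) ‖x‖) ‖x‖ := by
        rw [derivWithin_of_mem_nhds (Ici_mem_nhds (norm_pos_iff.2 hx))]
        exact ((hpos x hx).differentiableAt one_ne_zero).hasDerivAt
      have hnd : HasFDerivAt (fun y : Space n => ‖y‖) (fderiv ℝ (fun y : Space n => ‖y‖) x) x :=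
        ((contDiffAt_norm ℝ hx (n := 1)).differentiableAt one_ne_zero).hasFDerivAt
      set s := q ‖x‖
      have h1 : HasDerivAt (fun r : ℝ => N - q R - √((q r - N) ^ 2 + 1) - t)
          (-((s - N) / √((s - N) ^ 2 + 1) * derivWithin q (Ici 0) ‖x‖)) ‖x‖ := by
        have := (((hsq s).comp ‖x‖ hqd).const_sub (N - q R)).sub_const t
        exact this
      have h2 : HasDerivAt (fun r : ℝ => (max (N - q R - √((q r - N) ^ 2 + 1) - t) 0) ^ 2)
          (2 * max (cone q R N x - t) 0 *
            -((s - N) / √((s - N) ^ 2 + 1) * derivWithin q (Ici 0) ‖x‖)) ‖x‖ :=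
        (hasDerivAt_posPart_sq _).comp ‖x‖ h1
      have h3 := h2.comp_hasFDerivAt x hnd
      have h4 : fderiv ℝ (coneCutoff q R N t) x = _ := h3.fderiv
      rw [gradient, LinearIsometryEquiv.norm_map, h4, norm_smul,
        norm_mul (2 * max (cone q R N x - t) 0), norm_neg, norm_mul ((s - N) / _)]
      have n1 : ‖fderiv ℝ (fun y : Space n => ‖y‖) x‖ ≤ 1 := by
        simpa using norm_fderiv_le_of_lipschitz ℝ (lipschitzWith_one_norm (E := Space n)) (x₀ := x)
      have n2 : ‖(s - N) / √((s - N) ^ 2 + 1)‖ ≤ 1 := by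
        rw [norm_div, Real.norm_of_nonneg (Real.sqrt_nonneg _), div_le_one (by positivity)]
        exact Real.abs_le_sqrt (by linarith)
      have n3 : ‖derivWithin q (Ici 0) ‖x‖‖ ≤ √(c x / b x) := by
        rw [Real.norm_of_nonneg (hq.deriv_pos x).le]; exact hq.deriv_le x
      rw [Real.norm_of_nonneg (by positivity : 0 ≤ 2 * max (cone q R N x - t) 0)]
      calc _ ≤ 2 * max (cone q R N x - t) 0 * (1 * √(c x / b x)) * 1 := by gcongr
        _ = _ := by ring

end Gauge

end

/-! ### Finite speed of propagation -/

section

variable {n : ℕ} {E : Type*} [NormedAddCommGroup E] [InnerProductSpace ℝ E]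

lemma inner_mul_self_nonneg {m : Space n → ℝ} (hm : MemLp m ⊤ volume) (h0 : ∀ x, 0 ≤ m x)
    (f : Lp E 2 (volume : Measure (Space n))) : 0 ≤ inner ℝ (mul m f) f := by
  rw [inner_mul hm]
  exact integral_nonneg fun x => mul_nonneg (h0 x) real_inner_self_nonneg

lemma inner_mul_cut_mul {m ψ : Space n → ℝ} (hm : Continuous m) (hψ : Continuous ψ) {ρ : ℝ}
    (h0 : ∀ x, ρ < ‖x‖ → ψ x = 0) (f g : Lp E 2 (volume : Measure (Space n))) :
    inner ℝ (mul (cut (ρ + 1) m) f) (mul ψ g) = inner ℝ (mul (fun x => ψ x * m x) f) g := by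
  have hs : HasCompactSupport ψ :=
    HasCompactSupport.intro (isCompact_closedBall (0 : Space n) ρ) fun x hx =>
      h0 x (by simpa using hx)
  rw [inner_mul (memLp_cut hm _),
    inner_mul (m := fun x => ψ x * m x) ((hψ.mul hm).memLp_of_hasCompactSupport hs.mul_right)]
  apply integral_congr_ae
  filter_upwards [coeFn_mul (hψ.memLp_of_hasCompactSupport hs) g] with x hx
  rw [hx, real_inner_smul_right]
  by_cases h : ‖x‖ ≤ ρ
  · rw [cut_of_le (by linarith)]; ring
  · rw [h0 x (not_le.1 h)]; ring

/-- Pointwise form of the sign of the flux: completing the square, with `|g| ≤ 2P √(c/b)`. -/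
lemma cone_dissipation {b c P v : ℝ} {G g : E} (hb : 0 < b) (hc : 0 < c) (hP : 0 ≤ P)
    (hg : ‖g‖ ≤ 2 * P * √(c / b)) :
    -(P * c) * v ^ 2 - P * b * ‖G‖ ^ 2 - b * (v * inner ℝ G g) ≤ 0 := by
  have h1 : -(v * inner ℝ G g) ≤ |v| * (‖G‖ * (2 * P * √(c / b))) := by
    calc -(v * inner ℝ G g) ≤ |v * inner ℝ G g| := neg_le_abs _
      _ = |v| * |inner ℝ G g| := abs_mul _ _
      _ ≤ |v| * (‖G‖ * ‖g‖) := by gcongr; exact abs_real_inner_le_norm _ _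
      _ ≤ _ := by gcongr
  set s := √(c / b) with hs
  have hs2 : b * s ^ 2 = c := by rw [hs, Real.sq_sqrt (by positivity)]; field_simp
  have h2 : b * (|v| * (‖G‖ * (2 * P * s))) ≤ P * c * v ^ 2 + P * b * ‖G‖ ^ 2 := by
    have h3 : 0 ≤ P * b * (s * |v| - ‖G‖) ^ 2 := by positivity
    have h4 : P * b * (s * |v| - ‖G‖) ^ 2
        = P * (b * s ^ 2) * |v| ^ 2 + P * b * ‖G‖ ^ 2 - b * (|v| * (‖G‖ * (2 * P * s))) := by ring
    rw [hs2, sq_abs] at h4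
    linarith
  nlinarith [mul_le_mul_of_nonneg_left h1 hb.le]

section Cutoff

variable {b c : Space n → ℝ} {β γ R N : ℝ} {q : ℝ → ℝ}

lemma IsSupportGauge.continuous_coneCutoff (hq : IsSupportGauge b c β γ q) (t : ℝ) :
    Continuous (coneCutoff q R N t : Space n → ℝ) :=
  ((hq.continuous_cone.sub continuous_const).max continuous_const).pow 2

lemma continuousOn_half_inner_clm {H : Type*} [NormedAddCommGroup H] [InnerProductSpace ℝ H]
    {M M' : ℝ → H →L[ℝ] H} {f : ℝ → H} {s : Set ℝ} (hM : ∀ t ∈ s, HasDerivAt M (M' t) t)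
    (hf : ContinuousOn f s) : ContinuousOn (fun t => 1 / 2 * inner ℝ (M t (f t)) (f t)) s :=
  have hM' : ContinuousOn M s := fun t ht => (hM t ht).continuousAt.continuousWithinAt
  continuousOn_const.mul ((hM'.clm_apply hf).inner hf)

lemma hasDerivAt_half_inner_clm {H : Type*} [NormedAddCommGroup H] [InnerProductSpace ℝ H]
    {M : ℝ → H →L[ℝ] H} {M' : H →L[ℝ] H} {f : ℝ → H} {f' : H} {t : ℝ}
    (hsymm : ∀ g g', inner ℝ (M t g) g' = inner ℝ g (M t g'))
    (hM : HasDerivAt M M' t) (hf : HasDerivAt f f' t) :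
    HasDerivAt (fun s => 1 / 2 * inner ℝ (M s (f s)) (f s))
      (1 / 2 * inner ℝ (M' (f t)) (f t) + inner ℝ (M t (f t)) f') t := by
  refine (((hM.clm_apply hf).inner ℝ hf).const_mul (1 / 2)).congr_deriv ?_
  have : inner ℝ (M t f') (f t) = inner ℝ (M t (f t)) f' := by rw [hsymm, real_inner_comm]
  rw [inner_add_left, this]; ring

lemma IsSupportGauge.hasDerivAt_lpOf_coneCutoff (hq : IsSupportGauge b c β γ q) {ρ : ℝ}
    (hρ : ∀ x : Space n, ρ < ‖x‖ → cone q R N x < -1) {m : Space n → ℝ} (hm : Continuous m) {t : ℝ}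
    (ht : -1 < t) :
    HasDerivAt (fun s => lpOf ⊤ fun x : Space n => coneCutoff q R N s x * m x)
      (lpOf ⊤ fun x : Space n => -(2 * max (cone q R N x - t) 0) * m x) t := by
  have hc1 : ∀ s, Continuous fun x : Space n => coneCutoff q R N s x * m x := fun s =>
    (hq.continuous_coneCutoff s).mul hm
  have hc2 : Continuous fun x : Space n => -(2 * max (cone q R N x - t) 0) * m x :=
    (continuous_const.mul ((hq.continuous_cone.sub continuous_const).max continuous_const)).neg.mul
      hm
  have z1 : ∀ s, -1 < s → ∀ x, x ∉ Metric.closedBall (0 : Space n) ρ →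
      coneCutoff q R N s x * m x = 0 := fun s hs x hx => by
    rw [coneCutoff_eq_zero (by linarith [hρ x (by simpa using hx)]), zero_mul]
  have z2 : ∀ x, x ∉ Metric.closedBall (0 : Space n) ρ →
      -(2 * max (cone q R N x - t) 0) * m x = 0 := fun x hx => by
    rw [max_eq_right (by linarith [hρ x (by simpa using hx)])]; simp
  obtain ⟨M, hM⟩ := (isCompact_closedBall (0 : Space n) ρ).exists_bound_of_continuousOn
    hm.continuousOn
  refine hasDerivAt_lpOf (ρ := ρ) ?_ ?_ ?_ z2 ?_
  · filter_upwards [eventually_gt_nhds ht] with s hs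
    exact (hc1 s).memLp_of_hasCompactSupport (HasCompactSupport.intro
      (isCompact_closedBall (0 : Space n) ρ) (z1 s hs))
  · exact hc2.memLp_of_hasCompactSupport (HasCompactSupport.intro
      (isCompact_closedBall (0 : Space n) ρ) z2)
  · filter_upwards [eventually_gt_nhds ht] with s hs using z1 s hs
  · intro ε hε
    have hM' : 0 < |M| + 1 := by positivity
    filter_upwards [Metric.ball_mem_nhds t (div_pos hε hM')] with s hs x hx
    rw [Metric.mem_ball, Real.dist_eq, lt_div_iff₀ hM'] at hs
    have h1 := abs_posPart_sq_sub_le (cone q R N x - t) (t - s)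
    have e1 : cone q R N x - t + (t - s) = cone q R N x - s := by ring
    rw [e1] at h1
    have h2 := hM x hx
    rw [Real.norm_eq_abs] at h2
    have e2 : coneCutoff q R N s x * m x - coneCutoff q R N t x * m x
        - (s - t) * (-(2 * max (cone q R N x - t) 0) * m x)
        = ((max (cone q R N x - s) 0) ^ 2 - (max (cone q R N x - t) 0) ^ 2
          - 2 * (t - s) * max (cone q R N x - t) 0) * m x := by
      rw [coneCutoff, coneCutoff]; ring
    rw [e2, abs_mul]
    calc _ ≤ (t - s) ^ 2 * (|M| + 1) := by
          gcongr
          linarith [le_abs_self M]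
      _ = |s - t| * (|M| + 1) * |s - t| := by
          rw [← sq_abs, abs_sub_comm]; ring
      _ ≤ ε * |s - t| := by gcongr

lemma IsSupportGauge.hasDerivAt_mul_coneCutoff (hq : IsSupportGauge b c β γ q) {ρ : ℝ}
    (hρ : ∀ x : Space n, ρ < ‖x‖ → cone q R N x < -1) {m : Space n → ℝ} (hm : Continuous m) {t : ℝ}
    (ht : -1 < t) :
    HasDerivAt (fun s => (mul fun x => coneCutoff q R N s x * m x :
      Lp E 2 (volume : Measure (Space n)) →L[ℝ] Lp E 2 (volume : Measure (Space n))))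
      (mul fun x => -(2 * max (cone q R N x - t) 0) * m x) t :=
  hasDerivAt_mul (hq.hasDerivAt_lpOf_coneCutoff hρ hm ht)

lemma IsSupportGauge.memLp_coneCutoff_mul (hq : IsSupportGauge b c β γ q) {ρ : ℝ}
    (hρ : ∀ x : Space n, ρ < ‖x‖ → cone q R N x < -1) {m : Space n → ℝ} (hm : Continuous m) {t : ℝ}
    (ht : -1 ≤ t) : MemLp (fun x => coneCutoff q R N t x * m x) ⊤ volume := by
  refine ((hq.continuous_coneCutoff t).mul hm).memLp_of_hasCompactSupport
    (HasCompactSupport.intro (isCompact_closedBall (0 : Space n) ρ) fun x hx => ?_)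
  rw [Pi.mul_apply, coneCutoff_eq_zero (by linarith [hρ x (by simpa using hx)]), zero_mul]

/-- The spatial flux through the lateral boundary of the cone is absorbed by the time derivative of
the cutoff. -/
lemma IsSupportGauge.cone_flux_le (hq : IsSupportGauge b c β γ q) (hR : q 0 ≤ q R) {ρ : ℝ}
    (hρ : ∀ x : Space n, ρ < ‖x‖ → cone q R N x < -1) (hb : Continuous b) (hc : Continuous c)
    (hb0 : ∀ x, 0 < b x) (hc0 : ∀ x, 0 < c x) {t : ℝ} (ht : 0 ≤ t) (v : L2 n) (G : L2Vec n) :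
    1 / 2 * inner ℝ (mul (fun x => -(2 * max (cone q R N x - t) 0) * c x) v) v
      + 1 / 2 * inner ℝ (mul (fun x => -(2 * max (cone q R N x - t) 0) * b x) G) G
      ≤ inner ℝ (mul (cut (ρ + 1) b) G)
        (lpOf 2 fun x => v x • gradient (coneCutoff q R N t) x) := by
  obtain ⟨r1, r2⟩ := hq.coneCutoff_regular hR (N := N) ht
  have hψs : HasCompactSupport (coneCutoff q R N t : Space n → ℝ) :=
    HasCompactSupport.intro (isCompact_closedBall (0 : Space n) ρ) fun x hx =>
      coneCutoff_eq_zero (by linarith [hρ x (by simpa using hx)])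
  have hm' : ∀ {m : Space n → ℝ}, Continuous m →
      MemLp (fun x => -(2 * max (cone q R N x - t) 0) * m x) ⊤ volume := fun {m} hm => by
    have hcont : Continuous fun x : Space n => -(2 * max (cone q R N x - t) 0) * m x :=
      (continuous_const.mul ((hq.continuous_cone.sub continuous_const).max
        continuous_const)).neg.mul hm
    refine hcont.memLp_of_hasCompactSupport (HasCompactSupport.intro
      (isCompact_closedBall (0 : Space n) ρ) fun x hx => ?_)
    rw [max_eq_right (by linarith [hρ x (by simpa using hx)])]; simp
  have i1 := (integrable_mul_inner (hm' hc) v v).const_mul (1 / 2)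
  have i2 := (integrable_mul_inner (hm' hb) G G).const_mul (1 / 2)
  have i3 := integrable_mul_inner (memLp_cut hb (ρ + 1)) G
    (lpOf 2 fun x => v x • gradient (coneCutoff q R N t) x)
  rw [← sub_nonpos, inner_mul (hm' hc), inner_mul (hm' hb), inner_mul (memLp_cut hb _),
    ← integral_const_mul, ← integral_const_mul, ← integral_add i1 i2]
  refine (integral_sub (i1.add i2) i3).symm.trans_le ?_
  refine integral_nonpos_of_ae ?_
  filter_upwards [coeFn_lpOf (memLp_smul_of_bounded (v := v) (memLp_gradient r1 hψs ⊤))] with x hx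
  simp only [Pi.add_apply]
  rw [hx, real_inner_smul_right, real_inner_self_eq_norm_sq, real_inner_self_eq_norm_sq,
    Real.norm_eq_abs, sq_abs]
  have hd := cone_dissipation (v := v x) (G := G x) (hb0 x) (hc0 x)
    (le_max_right (cone q R N x - t) 0) (r2 x)
  by_cases hxρ : ‖x‖ ≤ ρ + 1
  · rw [cut_of_le hxρ]
    simp only [Pi.zero_apply]
    linarith
  · have hz1 := hρ x (by linarith [not_le.1 hxρ])
    rw [cut_of_lt (not_le.1 hxρ), max_eq_right (by linarith)]
    simp

end Cutoff

section Propagation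

variable {a b c : Space n → ℝ} {β γ R : ℝ} {q : ℝ → ℝ} {h : Space n → ℝ → ℝ} {k : ℕ}
  {u₀ u₁ : L2 n} {u : ℝ → L2 n}

/-- The energy weighted by `coneCutoff` is nonincreasing: test the equation with the velocity times
the cutoff. The source vanishes inside the cone. The velocity is represented by a curve `v` that is
free at `t = 0`, where the two-sided derivative of `u` carries no information. -/
lemma IsSolution.hasDerivAt_coneEnergy (hsol : IsSolution a b c h u₀ u₁ u) (ha : Continuous a)
    (hb : Continuous b) (hc : Continuous c) (ha0 : ∀ x, 0 < a x) (hb0 : ∀ x, 0 < b x)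
    (hc0 : ∀ x, 0 < c x) (hs : IsSource q R h) (hq : IsSupportGauge b c β γ q) (hq0 : q 0 ≤ q R)
    (hβγ : β + γ < 2) (hu : TimeRegular k u) (hk : 0 < k) {N ρ : ℝ}
    (hρ : ∀ x : Space n, ρ < ‖x‖ → cone q R N x < -1) {v : ℝ → L2 n}
    (hv : ∀ t, 0 < t → v t = iteratedDeriv 1 u t) {t : ℝ} (ht : 0 < t) :
    ∃ d ≤ 0, HasDerivAt (fun s =>
      1 / 2 * inner ℝ (mul (fun x => coneCutoff q R N s x * c x) (v s)) (v s)
      + 1 / 2 * inner ℝ (mul (fun x => coneCutoff q R N s x * b x) (weakGrad (u s)))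
        (weakGrad (u s))) d t := by
  have hvd : HasDerivAt v (iteratedDeriv 2 u t) t :=
    (hu.hasDerivAt (i := 1) hk ht).congr_of_eventuallyEq
      (Filter.eventually_of_mem (Ioi_mem_nhds ht) hv)
  have hGd : HasDerivAt (fun s => weakGrad (u s)) (weakGrad (v t)) t := by
    rw [hv t ht]
    exact hu.hasDerivAt_weakGrad (i := 0) hk ht
  have hz : ∀ x : Space n, ρ < ‖x‖ → coneCutoff q R N t x = 0 := fun x hx =>
    coneCutoff_eq_zero (by linarith [hρ x hx])
  have d1 := hasDerivAt_half_inner_clm (inner_mul_comm _)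
    (hq.hasDerivAt_mul_coneCutoff (E := ℝ) hρ hc (t := t) (by linarith)) hvd
  have d2 := hasDerivAt_half_inner_clm (inner_mul_comm _)
    (hq.hasDerivAt_mul_coneCutoff (E := Space n) hρ hb (t := t) (by linarith)) hGd
  refine ⟨_, ?_, d1.add d2⟩
  have hψs : HasCompactSupport (coneCutoff q R N t : Space n → ℝ) :=
    HasCompactSupport.intro (isCompact_closedBall (0 : Space n) ρ) fun x hx =>
      hz x (by simpa using hx)
  have hflux := hq.cone_flux_le hq0 hρ hb hc hb0 hc0 ht.le (v t) (weakGrad (u t))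
  obtain ⟨r1, -⟩ := hq.coneCutoff_regular hq0 (N := N) ht.le
  have hA : 0 ≤ inner ℝ (mul (fun x => coneCutoff q R N t x * a x) (v t)) (v t) :=
    inner_mul_self_nonneg (hq.memLp_coneCutoff_mul hρ ha (by linarith))
      (fun x => mul_nonneg (coneCutoff_nonneg _ _) (ha0 x).le) _
  have hψc : Continuous (coneCutoff q R N t : Space n → ℝ) := hq.continuous_coneCutoff t
  have hsrc : inner ℝ (src h 0 t) (mul (coneCutoff q R N t) (v t)) = 0 := by
    rw [← inner_mul_comm, inner_mul (hψc.memLp_of_hasCompactSupport hψs)]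
    refine integral_eq_zero_of_ae ?_
    filter_upwards [coeFn_lpOf (hs.memLp hq hβγ 0 ht)] with x hx
    rw [src, hx]
    by_cases hcone : cone q R N x ≤ t
    · rw [coneCutoff_eq_zero hcone]; simp
    · rw [hs.iteratedDeriv_eq_zero 0 ht (by linarith [cone_lt q R N x, not_le.1 hcone])]; simp
  generalize coneCutoff q R N t = ψ at *
  have hvH : HasWeakGrad (v t) (weakGrad (v t)) := by
    rw [hv t ht]; exact hu.hasWeakGrad hk ht
  have hpair : (mul ψ (v t), mul ψ (weakGrad (v t)) + lpOf 2 fun x => v t x • gradient ψ x)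
      ∈ testPairs n ρ := by
    refine ⟨hvH.mul r1 hψs, ?_⟩
    filter_upwards [coeFn_mul (hψc.memLp_of_hasCompactSupport hψs) (v t)] with x hx hxρ
    rw [hx, hz x hxρ, zero_smul]
  have heq := hsol.equation_testPairs ha hb hc hs hq hβγ hu (i := 0) hk ht hpair
  simp only [iteratedDeriv_zero, zero_add] at heq
  rw [← hv t ht, inner_add_right, inner_mul_cut_mul hc hψc hz, inner_mul_cut_mul ha hψc hz,
    inner_mul_cut_mul hb hψc hz, hsrc] at heq
  have c1 := real_inner_comm (mul (fun x => ψ x * c x) (v t)) (iteratedDeriv 2 u t)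
  have c2 := inner_mul_comm (fun x => ψ x * c x) (iteratedDeriv 2 u t) (v t)
  linarith

/-- The velocity vanishes inside the backward cones: the energy weighted by `coneCutoff` is
nonincreasing, and it vanishes initially. -/
lemma IsSolution.deriv_eq_zero_of_cone (hn : 1 ≤ n) (hR : 0 ≤ R)
    (hsol : IsSolution a b c h u₀ u₁ u) (ha : Continuous a)
    (hb : Continuous b) (hc : Continuous c) (ha0 : ∀ x, 0 < a x) (hb0 : ∀ x, 0 < b x)
    (hc0 : ∀ x, 0 < c x) (hs : IsSource q R h) (hq : IsSupportGauge b c β γ q)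
    (hβγ : β + γ < 2) (hu : TimeRegular k u) (hk : 0 < k) (hu₀ : ∀ᵐ x, R < ‖x‖ → u₀ x = 0)
    (hu₁ : ∀ᵐ x, R < ‖x‖ → u₁ x = 0) (N : ℝ) {t : ℝ} (ht : 0 < t) :
    ∀ᵐ x, t < cone q R N x → deriv u t x = 0 := by
  obtain ⟨ρ, hρ⟩ := hq.exists_cone_lt hβγ R N
  have hq0 : q 0 ≤ q R := by
    have := hq.le_of_norm_le hn hR (x := 0) (by simpa using hR)
    rwa [norm_zero] at this
  set v : ℝ → L2 n := derivWithin u (Ici 0) with hv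
  set G : ℝ → L2Vec n := fun s => weakGrad (u s) with hG
  have hv1 : ∀ s, 0 < s → v s = iteratedDeriv 1 u s := fun s hs => by
    rw [hv, iteratedDeriv_one, derivWithin_of_mem_nhds (Ici_mem_nhds hs)]
  have hvc : ContinuousOn v (Ici 0) :=
    hsol.contDiffOn.continuousOn_derivWithin (uniqueDiffOn_Ici 0) le_rfl
  have hGc : ContinuousOn G (Ici 0) := hsol.continuous_H1.2.2
  have hmem : ∀ {m : Space n → ℝ}, Continuous m → ∀ s, -1 ≤ s →
      MemLp (fun x => coneCutoff q R N s x * m x) ⊤ volume := fun hm s hs =>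
    hq.memLp_coneCutoff_mul hρ hm hs
  set e : ℝ → ℝ := fun s =>
    1 / 2 * inner ℝ (mul (fun x => coneCutoff q R N s x * c x) (v s)) (v s)
    + 1 / 2 * inner ℝ (mul (fun x => coneCutoff q R N s x * b x) (G s)) (G s) with he
  have hec : ContinuousOn e (Ici 0) :=
    (continuousOn_half_inner_clm (fun s hs => hq.hasDerivAt_mul_coneCutoff hρ hc
      (by linarith [mem_Ici.1 hs])) hvc).add
    (continuousOn_half_inner_clm (fun s hs => hq.hasDerivAt_mul_coneCutoff hρ hb
      (by linarith [mem_Ici.1 hs])) hGc)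
  have hed : ∀ s, 0 < s → ∃ d ≤ 0, HasDerivAt e d s := fun s hs0 =>
    hsol.hasDerivAt_coneEnergy ha hb hc ha0 hb0 hc0 hs hq hq0 hβγ hu hk hρ hv1 hs0
  have hanti : AntitoneOn e (Ici 0) := by
    refine antitoneOn_of_deriv_nonpos (convex_Ici 0) hec (fun s hs => ?_) (fun s hs => ?_)
    · rw [interior_Ici] at hs
      obtain ⟨d, -, hd⟩ := hed s hs
      exact hd.differentiableAt.differentiableWithinAt
    · rw [interior_Ici] at hs
      obtain ⟨d, hd0, hd⟩ := hed s hs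
      rw [hd.deriv]; exact hd0
  have he0 : e 0 = 0 := by
    have hout : ∀ x : Space n, R < ‖x‖ ∨ coneCutoff q R N 0 x = 0 := fun x => by
      rcases lt_or_ge R ‖x‖ with hx | hx
      · exact Or.inl hx
      · refine Or.inr (coneCutoff_eq_zero ?_)
        linarith [cone_lt q R N x, hq.le_of_norm_le hn hR hx]
    have hu0 : HasWeakGrad u₀ (G 0) := by
      rw [← hsol.initial]; exact (hsol.continuous_H1.1 0 self_mem_Ici).hasWeakGrad
    have hopen : IsOpen {x : Space n | R < ‖x‖} :=
      isOpen_lt continuous_const _root_.continuous_norm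
    have hG0 := hu0.ae_eq_zero hopen hu₀
    have hv0 : v 0 = u₁ := hsol.initial_deriv
    rw [he]
    simp only
    rw [inner_mul (hmem hc 0 (by norm_num)), inner_mul (hmem hb 0 (by norm_num)),
      integral_eq_zero_of_ae, integral_eq_zero_of_ae]
    · ring
    · filter_upwards [hG0] with x hx
      rcases hout x with h1 | h1
      · rw [hx h1]; simp
      · rw [h1]; simp
    · filter_upwards [hu₁] with x hx
      rcases hout x with h1 | h1
      · rw [hv0, hx h1]; simp
      · rw [h1]; simp
  have hle : e t ≤ 0 := he0 ▸ hanti self_mem_Ici ht.le ht.le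
  have hnn : ∀ x : Space n, 0 ≤ coneCutoff q R N t x * c x := fun x =>
    mul_nonneg (coneCutoff_nonneg _ _) (hc0 x).le
  have p1 := inner_mul_self_nonneg (hmem hc t (by linarith)) hnn (v t)
  have p2 := inner_mul_self_nonneg (hmem hb t (by linarith))
    (fun x => mul_nonneg (coneCutoff_nonneg _ _) (hb0 x).le) (G t)
  have p3 : inner ℝ (mul (fun x => coneCutoff q R N t x * c x) (v t)) (v t) = 0 := by
    simp only [he] at hle
    linarith
  rw [inner_mul (hmem hc t (by linarith)), integral_eq_zero_iff_of_nonneg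
    (fun x => mul_nonneg (hnn x) real_inner_self_nonneg)
    (integrable_mul_inner (hmem hc t (by linarith)) _ _)] at p3
  rw [← iteratedDeriv_one, ← hv1 t ht]
  filter_upwards [p3] with x hx hcone
  have h1 : coneCutoff q R N t x * c x ≠ 0 := by
    refine mul_ne_zero ?_ (hc0 x).ne'
    rw [coneCutoff, max_eq_left (by linarith)]
    exact pow_ne_zero _ (by linarith)
  exact inner_self_eq_zero.1 ((mul_eq_zero.1 hx).resolve_left h1)

end Propagation

end

/-! ### Supports of the solution and of its time derivatives -/

section

variable {n : ℕ}

lemma mul_indicator_eq_zero_iff {U : Set (Space n)} (hU : MeasurableSet U) (f : L2 n) :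
    mul (U.indicator fun _ => (1 : ℝ)) f = 0 ↔ ∀ᵐ x, x ∈ U → f x = 0 := by
  have hm : MemLp (U.indicator fun _ => (1 : ℝ)) ⊤ volume := (memLp_top_const 1).indicator hU
  constructor
  · intro h
    have h1 := coeFn_mul hm f
    rw [h] at h1
    filter_upwards [h1, Lp.coeFn_zero ℝ 2 (volume : Measure (Space n))] with x h2 h3 hx
    rw [h3, indicator_of_mem hx] at h2
    simpa using h2.symm
  · intro h
    apply Lp.ext
    filter_upwards [coeFn_mul hm f, Lp.coeFn_zero ℝ 2 (volume : Measure (Space n)), h]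
      with x h1 h2 h3
    rw [h1, h2]
    by_cases hx : x ∈ U
    · simp [h3 hx]
    · simp [indicator_of_notMem hx]

/-- Vanishing on a set is inherited by the time derivative. -/
lemma ae_eq_zero_of_hasDerivAt {U : Set (Space n)} (hU : MeasurableSet U) {f : ℝ → L2 n} {f' : L2 n}
    {t : ℝ} (hf : HasDerivAt f f' t) (h : ∀ᶠ s in nhds t, ∀ᵐ x, x ∈ U → f s x = 0) :
    ∀ᵐ x, x ∈ U → f' x = 0 := by
  rw [← mul_indicator_eq_zero_iff hU]
  have h1 := (mul (E := ℝ) (U.indicator fun _ => (1 : ℝ))).hasFDerivAt.comp_hasDerivAt t hf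
  have h2 : HasDerivAt (fun _ : ℝ => (0 : L2 n)) 0 t := hasDerivAt_const _ _
  refine h1.unique (h2.congr_of_eventuallyEq ?_)
  filter_upwards [h] with s hs
  exact (mul_indicator_eq_zero_iff hU (f s)).2 hs

variable {a b c : Space n → ℝ} {β γ R : ℝ} {q : ℝ → ℝ} {h : Space n → ℝ → ℝ} {k : ℕ}
  {u₀ u₁ : L2 n} {u : ℝ → L2 n}

lemma IsSupportGauge.isOpen_lt (hq : IsSupportGauge b c β γ q) (s : ℝ) :
    IsOpen {x : Space n | s < q ‖x‖} := _root_.isOpen_lt continuous_const hq.continuous_norm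

/-- Finite speed of propagation: inside each backward cone the velocity and the initial value
vanish, hence so does the solution. -/
lemma IsSolution.ae_eq_zero (hn : 1 ≤ n) (hR : 0 ≤ R)
    (hsol : IsSolution a b c h u₀ u₁ u) (ha : Continuous a)
    (hb : Continuous b) (hc : Continuous c) (ha0 : ∀ x, 0 < a x) (hb0 : ∀ x, 0 < b x)
    (hc0 : ∀ x, 0 < c x) (hs : IsSource q R h) (hq : IsSupportGauge b c β γ q)
    (hβγ : β + γ < 2) (hu : TimeRegular k u) (hk : 0 < k) (hu₀ : ∀ᵐ x, R < ‖x‖ → u₀ x = 0)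
    (hu₁ : ∀ᵐ x, R < ‖x‖ → u₁ x = 0) {t : ℝ} (ht : 0 < t) :
    ∀ᵐ x, t + q R < q ‖x‖ → u t x = 0 := by
  have key : ∀ N : ℕ, ∀ᵐ x, t < cone q R N x → u t x = 0 := by
    intro N
    set U : Set (Space n) := {x | t < cone q R N x} with hU
    have hUm : MeasurableSet U :=
      (_root_.isOpen_lt continuous_const hq.continuous_cone).measurableSet
    have hUR : ∀ x ∈ U, R < ‖x‖ := fun x hx => by
      by_contra hxR
      have h1 := cone_lt q R N x
      have h2 := hq.le_of_norm_le hn hR (not_lt.1 hxR)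
      have h3 : t < cone q R N x := hx
      linarith
    have hconst := constant_of_has_deriv_right_zero (a := 0) (b := t)
      (f := fun s => mul (U.indicator fun _ => (1 : ℝ)) (u s)) ?_ ?_ t ⟨ht.le, le_rfl⟩
    · have h0 : mul (U.indicator fun _ => (1 : ℝ)) (u 0) = 0 := by
        rw [mul_indicator_eq_zero_iff hUm, hsol.initial]
        filter_upwards [hu₀] with x hx hxU using hx (hUR x hxU)
      simp only [h0] at hconst
      exact (mul_indicator_eq_zero_iff hUm _).1 hconst
    · exact (mul (E := ℝ) (U.indicator fun _ => (1 : ℝ))).continuous.comp_continuousOn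
        (hsol.contDiffOn.continuousOn.mono Icc_subset_Ici_self)
    · intro s hst
      have h1 : HasDerivWithinAt u (derivWithin u (Ici 0) s) (Ici s) s :=
        ((hsol.contDiffOn.differentiableOn one_ne_zero s hst.1).hasDerivWithinAt).mono
          (Ici_subset_Ici.2 hst.1)
      have h2 := (mul (E := ℝ) (U.indicator fun _ => (1 : ℝ))).hasFDerivAt.comp_hasDerivWithinAt s h1
      have h3 : mul (U.indicator fun _ => (1 : ℝ)) (derivWithin u (Ici 0) s) = 0 := by
        rw [mul_indicator_eq_zero_iff hUm]
        rcases hst.1.eq_or_lt with h4 | h4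
        · rw [← h4, hsol.initial_deriv]
          filter_upwards [hu₁] with x hx hxU using hx (hUR x hxU)
        · rw [derivWithin_of_mem_nhds (Ici_mem_nhds h4)]
          filter_upwards [hsol.deriv_eq_zero_of_cone hn hR ha hb hc ha0 hb0 hc0 hs hq hβγ hu hk
            hu₀ hu₁ N h4] with x hx hxU using hx (hst.2.trans hxU)
      rw [h3] at h2
      exact h2
  filter_upwards [ae_all_iff.2 key] with x hx hxt
  obtain ⟨N, hN⟩ := exists_lt_cone q hxt
  exact hx N hN

/-- Supports of the time derivatives. Differentiation in time needs vanishing on a neighbourhood of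
`t`, which costs an arbitrarily small enlargement `τ > t` of the support. -/
lemma IsSolution.iteratedDeriv_ae_eq_zero (hn : 1 ≤ n) (hR : 0 ≤ R)
    (hsol : IsSolution a b c h u₀ u₁ u) (ha : Continuous a)
    (hb : Continuous b) (hc : Continuous c) (ha0 : ∀ x, 0 < a x) (hb0 : ∀ x, 0 < b x)
    (hc0 : ∀ x, 0 < c x) (hs : IsSource q R h) (hq : IsSupportGauge b c β γ q)
    (hβγ : β + γ < 2) (hu : TimeRegular k u) (hk : 0 < k) (hu₀ : ∀ᵐ x, R < ‖x‖ → u₀ x = 0)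
    (hu₁ : ∀ᵐ x, R < ‖x‖ → u₁ x = 0) {i : ℕ} (hi : i ≤ k + 1) {t τ : ℝ} (ht : 0 < t)
    (htτ : t < τ) : ∀ᵐ x, τ + q R < q ‖x‖ → iteratedDeriv i u t x = 0 := by
  induction i generalizing t with
  | zero =>
    filter_upwards [hsol.ae_eq_zero hn hR ha hb hc ha0 hb0 hc0 hs hq hβγ hu hk hu₀ hu₁ ht]
      with x hx hx' using hx (by linarith)
  | succ i ih =>
    refine ae_eq_zero_of_hasDerivAt (hq.isOpen_lt (τ + q R)).measurableSet
      (hu.hasDerivAt (i := i) (by omega) ht) ?_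
    filter_upwards [eventually_gt_nhds ht, eventually_lt_nhds htτ] with s h1 h2
    exact ih (by omega) h1 h2

end

/-! ### Comparison of the weighted norms -/

section

variable {n : ℕ} {E : Type*} [NormedAddCommGroup E] [InnerProductSpace ℝ E]

lemma PowerBounds.pos {f : Space n → ℝ} {m M σ : ℝ} (h : PowerBounds f m M σ) (x : Space n) :
    0 < f x :=
  lt_of_lt_of_le (mul_pos h.1 (Real.rpow_pos_of_pos (by positivity) _)) (h.2.2 x).1

/-- Comparison of two coefficients with power bounds on a set where `1 + |x| ≤ L z^μ`. -/
lemma PowerBounds.le_mul {f g : Space n → ℝ} {m M m' M' σ σ' : ℝ} (hf : PowerBounds f m M σ)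
    (hg : PowerBounds g m' M' σ') {L z μ : ℝ} (hL : 0 < L) (hz : 1 ≤ z) {x : Space n}
    (hx : 1 + ‖x‖ ≤ L * z ^ μ) :
    f x ≤ M / m' * L ^ max 0 (σ - σ') * z ^ (μ * max 0 (σ - σ')) * g x := by
  have hr : (1 : ℝ) ≤ 1 + ‖x‖ := by linarith [norm_nonneg x]
  have hr0 : (0 : ℝ) < 1 + ‖x‖ := by linarith
  have hm' := hg.1
  have h1 : (1 + ‖x‖) ^ (σ - σ') ≤ L ^ max 0 (σ - σ') * z ^ (μ * max 0 (σ - σ')) := by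
    calc (1 + ‖x‖) ^ (σ - σ') ≤ (1 + ‖x‖) ^ max 0 (σ - σ') :=
          Real.rpow_le_rpow_of_exponent_le hr (le_max_right _ _)
      _ ≤ (L * z ^ μ) ^ max 0 (σ - σ') := Real.rpow_le_rpow hr0.le hx (le_max_left _ _)
      _ = _ := by
        rw [Real.mul_rpow hL.le (by positivity), ← Real.rpow_mul (by linarith)]
  have h2 : f x ≤ M * (1 + ‖x‖) ^ σ := (hf.2.2 x).2
  have h3 : m' * (1 + ‖x‖) ^ σ' ≤ g x := (hg.2.2 x).1
  have h4 : (1 + ‖x‖) ^ σ = (1 + ‖x‖) ^ (σ - σ') * (1 + ‖x‖) ^ σ' := by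
    rw [← Real.rpow_add hr0]; congr 1; ring
  have hM := hf.2.1
  calc f x ≤ M / m' * (1 + ‖x‖) ^ (σ - σ') * (m' * (1 + ‖x‖) ^ σ') := by
        rw [h4] at h2; refine h2.trans (le_of_eq ?_); field_simp
    _ ≤ M / m' * (L ^ max 0 (σ - σ') * z ^ (μ * max 0 (σ - σ'))) * g x := by
        gcongr
    _ = _ := by ring

/-- Pointwise comparison of coefficients on the support of `f`. -/
lemma inner_mul_cut_le {m m' : Space n → ℝ} (hm : Continuous m) (hm' : Continuous m') {ρ K : ℝ}
    {f : Lp E 2 (volume : Measure (Space n))} (h : ∀ᵐ x, f x = 0 ∨ m x ≤ K * m' x) :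
    inner ℝ (mul (cut ρ m) f) f ≤ K * inner ℝ (mul (cut ρ m') f) f := by
  rw [inner_mul (memLp_cut hm ρ), inner_mul (memLp_cut hm' ρ), ← integral_const_mul]
  refine integral_mono_ae (integrable_mul_inner (memLp_cut hm ρ) f f)
    ((integrable_mul_inner (memLp_cut hm' ρ) f f).const_mul K) ?_
  filter_upwards [h] with x hx
  rcases hx with hx | hx
  · simp [hx]
  · rw [← mul_assoc]
    refine mul_le_mul_of_nonneg_right ?_ real_inner_self_nonneg
    by_cases hxρ : ‖x‖ ≤ ρ
    · rwa [cut_of_le hxρ, cut_of_le hxρ]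
    · rw [cut_of_lt (not_le.1 hxρ), cut_of_lt (not_le.1 hxρ), mul_zero]

lemma inner_mul_cut_nonneg {m : Space n → ℝ} (hm : Continuous m) (h0 : ∀ x, 0 ≤ m x) (ρ : ℝ)
    (f : Lp E 2 (volume : Measure (Space n))) : 0 ≤ inner ℝ (mul (cut ρ m) f) f :=
  inner_mul_self_nonneg (memLp_cut hm ρ) (fun _ => indicator_nonneg (fun y _ => h0 y) _) f

/-- Young's inequality for the weighted inner product. -/
lemma abs_inner_mul_cut_le {m : Space n → ℝ} (hm : Continuous m) (h0 : ∀ x, 0 ≤ m x) (ρ : ℝ)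
    {lam : ℝ} (hlam : 0 < lam) (f g : Lp E 2 (volume : Measure (Space n))) :
    |inner ℝ (mul (cut ρ m) f) g| ≤ 1 / 2 * lam * inner ℝ (mul (cut ρ m) f) f
      + 1 / 2 * lam⁻¹ * inner ℝ (mul (cut ρ m) g) g := by
  have hs : inner ℝ (mul (cut ρ m) g) f = inner ℝ (mul (cut ρ m) f) g := by
    rw [inner_mul_comm, real_inner_comm]
  have h1 : ∀ r : ℝ, 0 ≤ lam * (lam * inner ℝ (mul (cut ρ m) f) f
      + 2 * r * inner ℝ (mul (cut ρ m) f) g + r ^ 2 * lam⁻¹ * inner ℝ (mul (cut ρ m) g) g) := by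
    intro r
    have h2 := inner_mul_cut_nonneg hm h0 ρ (lam • f + r • g)
    simp only [map_add, map_smul, inner_add_left, inner_add_right, real_inner_smul_left,
      real_inner_smul_right, hs] at h2
    refine h2.trans (le_of_eq ?_)
    field_simp
    ring
  have h2 := nonneg_of_mul_nonneg_right (h1 1) hlam
  have h3 := nonneg_of_mul_nonneg_right (h1 (-1)) hlam
  rw [abs_le]
  constructor <;> linarith

/-- Young's inequality between the damping and the source. -/
lemma inner_le_damping_add_source {a : Space n → ℝ} (ha : Continuous a) (ha0 : ∀ x, 0 < a x) {ρ : ℝ}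
    {lam : ℝ} (hlam : 0 < lam) {g f : L2 n} (hg : ∀ᵐ x, ρ < ‖x‖ → g x = 0) :
    inner ℝ g f ≤ 1 / 2 * lam * inner ℝ (mul (cut ρ a) f) f
      + 1 / 2 * lam⁻¹ * inner ℝ (mul (cut ρ fun x => (a x)⁻¹) g) g := by
  have ha' : Continuous fun x => (a x)⁻¹ := ha.inv₀ fun x => (ha0 x).ne'
  rw [L2.inner_def, inner_mul (memLp_cut ha ρ), inner_mul (memLp_cut ha' ρ), ← integral_const_mul,
    ← integral_const_mul]
  have i1 := (integrable_mul_inner (memLp_cut ha ρ) f f).const_mul (1 / 2 * lam)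
  have i2 := (integrable_mul_inner (memLp_cut ha' ρ) g g).const_mul (1 / 2 * lam⁻¹)
  rw [← integral_add i1 i2]
  refine integral_mono_ae (L2.integrable_inner (𝕜 := ℝ) g f) (i1.add i2) ?_
  filter_upwards [hg] with x hx
  by_cases hxρ : ‖x‖ ≤ ρ
  · rw [cut_of_le hxρ, cut_of_le hxρ]
    have e1 : inner ℝ (g x) (f x) = g x * f x := by simp [mul_comm]
    have e2 : inner ℝ (f x) (f x) = f x ^ 2 := by simp [sq]
    have e3 : inner ℝ (g x) (g x) = g x ^ 2 := by simp [sq]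
    rw [e1, e2, e3]
    have hp : 0 < lam * a x := mul_pos hlam (ha0 x)
    have h1 : 0 ≤ 1 / 2 * (lam * a x)⁻¹ * (lam * a x * f x - g x) ^ 2 := by positivity
    have h2 : 1 / 2 * (lam * a x)⁻¹ * (lam * a x * f x - g x) ^ 2
        = 1 / 2 * lam * (a x * f x ^ 2) + 1 / 2 * lam⁻¹ * ((a x)⁻¹ * g x ^ 2) - g x * f x := by
      have := (ha0 x).ne'
      field_simp
      ring
    linarith
  · rw [hx (not_le.1 hxρ), cut_of_lt (not_le.1 hxρ), cut_of_lt (not_le.1 hxρ)]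
    simp

end

/-! ### The weighted multiplier inequality -/

section

/-- Pointwise bound on the derivative of the multiplier functional
`A z^{p+1} e + z^{p+2+ω} E + z^{p+2} (x + d/2)`: the weights `z ^ (p + j)` and `z ^ (p + j + ω)` are
abstracted to the numbers `aⱼ` and `bⱼ`. The choice `ε = 1 / (2 (p + 3))` lets the derivatives of
the weights be absorbed by a fraction of `E`, and `A = 2 (p + 3)` makes the total coefficient of
`z^{p+1} d` negative. -/
lemma multiplier_deriv_le {p om ε A a₀ a₁ a₂ a₃ b₁ b₂ e d s H K g x D S H' r : ℝ} (hp : 0 ≤ p)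
    (hom : om < 1) (hε : ε = 1 / (2 * (p + 3))) (hA : A = 2 * (p + 3))
    (ha₁ : 0 ≤ a₁) (ha₂ : 0 ≤ a₂) (hb₁ : 0 ≤ b₁) (hb₂ : 0 ≤ b₂)
    (hb₁a : b₁ ≤ ε * a₂) (hb₂a : b₂ ≤ a₃)
    (hd : 0 ≤ d) (hK : 0 ≤ K) (hg : 0 ≤ g) (hD : 0 ≤ D) (hH' : 0 ≤ H')
    (hs : s ≤ 1 / 2 * d + 1 / 2 * H) (hS : S ≤ 1 / 2 * D + 1 / 2 * H')
    (hr : a₂ * r ≤ 1 / 2 * (a₁ * d) + 1 / 2 * (a₃ * H'))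
    (hx : a₁ * x ≤ 1 / 2 * (b₁ * K + ε * (a₁ * d))) (hKD : a₂ * K ≤ ε * (b₂ * D)) :
    A * ((p + 1) * a₀ * e + a₁ * (-d + s))
      + ((p + 2 + om) * b₁ * (1 / 2 * (K + g)) + b₂ * (-D + S))
      + ((p + 2) * a₁ * (x + 1 / 2 * d) + a₂ * (K - g + r))
      ≤ A * (p + 1) * (a₀ * e) + A / 2 * (a₁ * H) + a₃ * H' - a₂ * (1 / 2 * (K + g)) := by
  have hε0 : 0 < ε := by rw [hε]; positivity
  have hεp : ε * (p + 3) = 1 / 2 := by rw [hε]; field_simp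
  have hε6 : ε ≤ 1 / 6 := by nlinarith
  have hA0 : 0 ≤ A := by rw [hA]; positivity
  have e1 : A * (a₁ * s) ≤ A * (a₁ * (1 / 2 * d + 1 / 2 * H)) := by gcongr
  have e2 : b₂ * S ≤ b₂ * (1 / 2 * D + 1 / 2 * H') := by gcongr
  have e3 : b₂ * H' ≤ a₃ * H' := by gcongr
  have hE : 0 ≤ 1 / 2 * (K + g) := by positivity
  have e4 : (p + 2 + om) * b₁ * (1 / 2 * (K + g)) ≤ 1 / 2 * (a₂ * (1 / 2 * (K + g))) := by
    have : (p + 2 + om) * b₁ ≤ (p + 3) * (ε * a₂) := by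
      refine (mul_le_mul_of_nonneg_right (by linarith : p + 2 + om ≤ p + 3) hb₁).trans ?_
      gcongr
    calc (p + 2 + om) * b₁ * (1 / 2 * (K + g)) ≤ (p + 3) * (ε * a₂) * (1 / 2 * (K + g)) := by gcongr
      _ = (ε * (p + 3)) * (a₂ * (1 / 2 * (K + g))) := by ring
      _ = _ := by rw [hεp]
  have e5 : (p + 2) * (a₁ * x) ≤ 1 / 4 * (a₂ * K) + 1 / 4 * (a₁ * d) := by
    have h1 : b₁ * K ≤ ε * (a₂ * K) := by rw [← mul_assoc]; gcongr
    have h2 : (p + 2) * (a₁ * x) ≤ (p + 2) * (1 / 2 * (ε * (a₂ * K) + ε * (a₁ * d))) := by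
      refine mul_le_mul_of_nonneg_left (hx.trans ?_) (by linarith)
      linarith
    have h3 : 0 ≤ ε * (a₂ * K + a₁ * d) := by positivity
    have h4 : (p + 2) * (1 / 2 * (ε * (a₂ * K) + ε * (a₁ * d)))
        = 1 / 2 * (ε * (p + 3)) * (a₂ * K + a₁ * d) - 1 / 2 * (ε * (a₂ * K + a₁ * d)) := by ring
    rw [hεp] at h4
    linarith
  have e6 : a₂ * K ≤ 1 / 6 * (b₂ * D) := hKD.trans (by gcongr)
  have had : 0 ≤ a₁ * d := by positivity
  have hpad : 0 ≤ p * (a₁ * d) := by positivity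
  have hbD : 0 ≤ b₂ * D := by positivity
  have haK : 0 ≤ a₂ * K := by positivity
  have hag : 0 ≤ a₂ * g := by positivity
  have haH : A * (a₁ * (1 / 2 * d + 1 / 2 * H)) = (p + 3) * (a₁ * d) + A / 2 * (a₁ * H) := by
    rw [hA]; ring
  have hAd : A * (a₁ * d) = 2 * (p + 3) * (a₁ * d) := by rw [hA]
  nlinarith

/-- The integrated multiplier inequality: it controls the energy `E = (κ + g) / 2` of the time
derivative with weight `z^{p+2}` by the energy `e` with weight `z^p`, where `z = 1 + t`. In the
application `d = ∫ a w_t²`, `D = ∫ a w_tt²`, `x = ∫ c w_tt w_t`, while `s`, `S`, `r` are pairings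
with the source, and `H`, `H'` are weighted norms of the source and of its time derivative. -/
lemma integral_energy_deriv_le {p om ε A T₀ T : ℝ} (hp : 0 ≤ p) (hom0 : 0 < om) (hom : om < 1)
    (hε : ε = 1 / (2 * (p + 3))) (hA : A = 2 * (p + 3)) (hT₀ : 0 < T₀) (hT : T₀ ≤ T)
    {e d s H κ g x D S H' r : ℝ → ℝ}
    (he : ∀ t ∈ Icc T₀ T, HasDerivAt e (-d t + s t) t)
    (hE : ∀ t ∈ Icc T₀ T, HasDerivAt (fun t => 1 / 2 * (κ t + g t)) (-D t + S t) t)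
    (hX : ∀ t ∈ Icc T₀ T, HasDerivAt (fun t => x t + 1 / 2 * d t) (κ t - g t + r t) t)
    (hH : ContinuousOn H (Icc T₀ T)) (hH' : ContinuousOn H' (Icc T₀ T))
    (he0 : ∀ t ∈ Icc T₀ T, 0 ≤ e t) (hd : ∀ t ∈ Icc T₀ T, 0 ≤ d t)
    (hκ : ∀ t ∈ Icc T₀ T, 0 ≤ κ t) (hg : ∀ t ∈ Icc T₀ T, 0 ≤ g t)
    (hD : ∀ t ∈ Icc T₀ T, 0 ≤ D t) (hH0 : ∀ t ∈ Icc T₀ T, 0 ≤ H t)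
    (hH'0 : ∀ t ∈ Icc T₀ T, 0 ≤ H' t)
    (hs : ∀ t ∈ Icc T₀ T, s t ≤ 1 / 2 * d t + 1 / 2 * H t)
    (hS : ∀ t ∈ Icc T₀ T, S t ≤ 1 / 2 * D t + 1 / 2 * H' t)
    (hr : ∀ t ∈ Icc T₀ T, r t ≤ 1 / 2 * (1 + t)⁻¹ * d t + 1 / 2 * (1 + t) * H' t)
    (hx : ∀ t ∈ Icc T₀ T, |x t| ≤ 1 / 2 * ((1 + t) ^ om * κ t + ε * d t))
    (hκD : ∀ t ∈ Icc T₀ T, κ t ≤ ε * (1 + t) ^ om * D t)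
    (hz : ∀ t ∈ Icc T₀ T, (1 + t) ^ (om - 1) ≤ ε) :
    ∫ t in T₀..T, (1 + t) ^ (p + 2) * (1 / 2 * (κ t + g t)) ≤
      A * (1 + T₀) ^ (p + 1) * e T₀ + 2 * (1 + T₀) ^ (p + 2 + om) * (1 / 2 * (κ T₀ + g T₀))
        + (1 + T₀) ^ (p + 2) * d T₀
      + A * (p + 1) * (∫ t in T₀..T, (1 + t) ^ p * e t)
      + A * ((∫ t in T₀..T, (1 + t) ^ (p + 1) * H t)
        + ∫ t in T₀..T, (1 + t) ^ (p + 3) * H' t) := by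
  have hε0 : 0 < ε := by rw [hε]; positivity
  have hε1 : ε ≤ 1 := by
    rw [hε, div_le_one (by positivity)]; linarith
  have hA2 : 2 ≤ A := by rw [hA]; linarith
  have hz0 : ∀ t ∈ Icc T₀ T, 0 < 1 + t := fun t ht => by linarith [ht.1]
  have hz1 : ∀ t ∈ Icc T₀ T, 1 ≤ 1 + t := fun t ht => by linarith [ht.1]
  have hpow : ∀ (y : ℝ), ∀ t ∈ Icc T₀ T,
      HasDerivAt (fun t : ℝ => (1 + t) ^ (y + 1)) ((y + 1) * (1 + t) ^ y) t := by
    intro y t ht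
    have := ((hasDerivAt_id t).const_add 1).rpow_const (p := y + 1) (Or.inl (hz0 t ht).ne')
    simpa using this
  have hpc : ∀ y : ℝ, ContinuousOn (fun t : ℝ => (1 + t) ^ y) (Icc T₀ T) := fun y =>
    (continuousOn_const.add continuousOn_id).rpow_const fun t ht => Or.inl (hz0 t ht).ne'
  set Φ : ℝ → ℝ := fun t => A * ((1 + t) ^ (p + 1) * e t)
    + (1 + t) ^ (p + 1 + om + 1) * (1 / 2 * (κ t + g t))
    + (1 + t) ^ (p + 1 + 1) * (x t + 1 / 2 * d t) with hΦ
  have hΦ' : ∀ t ∈ Icc T₀ T, HasDerivAt Φ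
      (A * ((p + 1) * (1 + t) ^ p * e t + (1 + t) ^ (p + 1) * (-d t + s t))
      + ((p + 1 + om + 1) * (1 + t) ^ (p + 1 + om) * (1 / 2 * (κ t + g t))
        + (1 + t) ^ (p + 1 + om + 1) * (-D t + S t))
      + ((p + 1 + 1) * (1 + t) ^ (p + 1) * (x t + 1 / 2 * d t)
        + (1 + t) ^ (p + 1 + 1) * (κ t - g t + r t))) t := fun t ht =>
    ((((hpow p t ht).mul (he t ht)).const_mul A).add ((hpow _ t ht).mul (hE t ht))).add
      ((hpow _ t ht).mul (hX t ht))
  have hec : ContinuousOn e (Icc T₀ T) := fun t ht => (he t ht).continuousAt.continuousWithinAt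
  have hEc : ContinuousOn (fun t => 1 / 2 * (κ t + g t)) (Icc T₀ T) := fun t ht =>
    (hE t ht).continuousAt.continuousWithinAt
  have i1 : ContinuousOn (fun t => (1 + t) ^ p * e t) (Icc T₀ T) := (hpc p).mul hec
  have i2 : ContinuousOn (fun t => (1 + t) ^ (p + 1) * H t) (Icc T₀ T) := (hpc _).mul hH
  have i3 : ContinuousOn (fun t => (1 + t) ^ (p + 3) * H' t) (Icc T₀ T) := (hpc _).mul hH'
  have i4 : ContinuousOn (fun t => (1 + t) ^ (p + 2) * (1 / 2 * (κ t + g t))) (Icc T₀ T) :=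
    (hpc _).mul hEc
  have p2 : p + 1 + 1 = p + 2 := by ring
  have p2o : p + 1 + om + 1 = p + 2 + om := by ring
  -- the cross term in `Φ` is dominated by the two energies
  have hxb : ∀ t ∈ Icc T₀ T, |(1 + t) ^ (p + 2) * x t| ≤
      (1 + t) ^ (p + 2 + om) * (1 / 2 * (κ t + g t)) + (1 + t) ^ (p + 2) * (1 / 2 * d t) := by
    intro t ht
    have h0 : (0 : ℝ) ≤ (1 + t) ^ (p + 2) := Real.rpow_nonneg (hz0 t ht).le _
    have h0' : (0 : ℝ) ≤ (1 + t) ^ (p + 2 + om) := Real.rpow_nonneg (hz0 t ht).le _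
    rw [abs_mul, abs_of_nonneg h0]
    calc (1 + t) ^ (p + 2) * |x t|
        ≤ (1 + t) ^ (p + 2) * (1 / 2 * ((1 + t) ^ om * κ t + 1 * d t)) := by
          refine mul_le_mul_of_nonneg_left ((hx t ht).trans ?_) h0
          have := mul_le_mul_of_nonneg_right hε1 (hd t ht)
          linarith
      _ = (1 + t) ^ (p + 2 + om) * (1 / 2 * κ t) + (1 + t) ^ (p + 2) * (1 / 2 * d t) := by
          rw [Real.rpow_add (hz0 t ht) (p + 2) om]; ring
      _ ≤ _ := by
          have := mul_nonneg h0' (hg t ht)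
          linarith
  have hT₀m : T₀ ∈ Icc T₀ T := left_mem_Icc.2 hT
  have hTm : T ∈ Icc T₀ T := right_mem_Icc.2 hT
  have hΦT : 0 ≤ Φ T := by
    have h1 := neg_le_of_abs_le (hxb T hTm)
    have h2 : 0 ≤ A * ((1 + T) ^ (p + 1) * e T) :=
      mul_nonneg (by linarith) (mul_nonneg (Real.rpow_nonneg (hz0 T hTm).le _) (he0 T hTm))
    simp only [hΦ, p2, p2o]
    linarith
  have hΦT₀ : Φ T₀ ≤ A * (1 + T₀) ^ (p + 1) * e T₀
      + 2 * (1 + T₀) ^ (p + 2 + om) * (1 / 2 * (κ T₀ + g T₀)) + (1 + T₀) ^ (p + 2) * d T₀ := by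
    have h1 := le_of_abs_le (hxb T₀ hT₀m)
    simp only [hΦ, p2, p2o]
    linarith
  have key := intervalIntegral.sub_le_integral_of_hasDeriv_right_of_le (g := Φ)
    (φ := fun t => A * (p + 1) * ((1 + t) ^ p * e t) + A / 2 * ((1 + t) ^ (p + 1) * H t)
      + (1 + t) ^ (p + 3) * H' t - (1 + t) ^ (p + 2) * (1 / 2 * (κ t + g t))) hT
    (fun t ht => (hΦ' t ht).continuousAt.continuousWithinAt)
    (fun t ht => (hΦ' t (Ioo_subset_Icc_self ht)).hasDerivWithinAt)
    ((((continuousOn_const.mul i1).add (continuousOn_const.mul i2)).add i3).sub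
      i4).integrableOn_Icc ?_
  · have I1 := i1.intervalIntegrable_of_Icc hT (μ := volume)
    have I2 := i2.intervalIntegrable_of_Icc hT (μ := volume)
    have I3 := i3.intervalIntegrable_of_Icc hT (μ := volume)
    have I4 := i4.intervalIntegrable_of_Icc hT (μ := volume)
    rw [intervalIntegral.integral_sub (((I1.const_mul _).add (I2.const_mul _)).add I3) I4,
      intervalIntegral.integral_add ((I1.const_mul _).add (I2.const_mul _)) I3,
      intervalIntegral.integral_add (I1.const_mul _) (I2.const_mul _),
      intervalIntegral.integral_const_mul, intervalIntegral.integral_const_mul] at key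
    have n2 : 0 ≤ ∫ t in T₀..T, (1 + t) ^ (p + 1) * H t :=
      intervalIntegral.integral_nonneg hT fun t ht =>
        mul_nonneg (Real.rpow_nonneg (hz0 t ht).le _) (hH0 t ht)
    have n3 : 0 ≤ ∫ t in T₀..T, (1 + t) ^ (p + 3) * H' t :=
      intervalIntegral.integral_nonneg hT fun t ht =>
        mul_nonneg (Real.rpow_nonneg (hz0 t ht).le _) (hH'0 t ht)
    nlinarith
  · intro t ht'
    have ht := Ioo_subset_Icc_self ht'
    have hzt := hz0 t ht
    have hr0 : ∀ y : ℝ, (0 : ℝ) ≤ (1 + t) ^ y := fun y => Real.rpow_nonneg hzt.le y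
    have hmul : (1 + t) ^ (p + 1) * (1 + t) = (1 + t) ^ (p + 2) := by
      rw [← Real.rpow_add_one hzt.ne', p2]
    have hmul3 : (1 + t) ^ (p + 2) * (1 + t) = (1 + t) ^ (p + 3) := by
      rw [← Real.rpow_add_one hzt.ne']; congr 1; ring
    refine le_of_eq_of_le ?_ (multiplier_deriv_le (p := p) (om := om) (ε := ε) (A := A)
      (a₀ := (1 + t) ^ p) (a₁ := (1 + t) ^ (p + 1)) (a₂ := (1 + t) ^ (p + 2))
      (a₃ := (1 + t) ^ (p + 3)) (b₁ := (1 + t) ^ (p + 1 + om)) (b₂ := (1 + t) ^ (p + 2 + om))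
      (e := e t) (x := x t) (r := r t) (D := D t) hp hom hε hA
      (hr0 _) (hr0 _) (hr0 _) (hr0 _) ?_ ?_ (hd t ht) (hκ t ht) (hg t ht) (hD t ht) (hH'0 t ht)
      (hs t ht) (hS t ht) ?_ ?_ ?_)
    · rw [p2, p2o]
    · have : (1 + t) ^ (p + 1 + om) = (1 + t) ^ (om - 1) * (1 + t) ^ (p + 2) := by
        rw [← Real.rpow_add hzt]; congr 1; ring
      rw [this]
      exact mul_le_mul_of_nonneg_right (hz t ht) (hr0 _)
    · exact Real.rpow_le_rpow_of_exponent_le (hz1 t ht) (by linarith)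
    · refine (mul_le_mul_of_nonneg_left (hr t ht) (hr0 (p + 2))).trans (le_of_eq ?_)
      rw [← hmul3, ← hmul]
      field_simp
    · refine (mul_le_mul_of_nonneg_left (le_of_abs_le (hx t ht)) (hr0 (p + 1))).trans (le_of_eq ?_)
      rw [Real.rpow_add hzt (p + 1) om]; ring
    · refine (mul_le_mul_of_nonneg_left (hκD t ht) (hr0 (p + 2))).trans (le_of_eq ?_)
      rw [Real.rpow_add hzt (p + 2) om]; ring

end

/-! ### Energies as real valued functions of time -/

section

variable {n : ℕ}

section Quad

variable {E : Type*} [NormedAddCommGroup E] [InnerProductSpace ℝ E]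

/-- The quadratic form `∫_{|x| ≤ ρ} m |f|² dx`. -/
def quad (ρ : ℝ) (m : Space n → ℝ) (f : Lp E 2 (volume : Measure (Space n))) : ℝ :=
  inner ℝ (mul (cut ρ m) f) f

lemma quad_eq_integral {m : Space n → ℝ} (hm : Continuous m) {ρ : ℝ}
    {f : Lp E 2 (volume : Measure (Space n))} (hf : ∀ᵐ x, ρ < ‖x‖ → f x = 0) :
    quad ρ m f = ∫ x, m x * ‖f x‖ ^ 2 ∧ Integrable fun x => m x * ‖f x‖ ^ 2 := by
  have h : (fun x => cut ρ m x * inner ℝ (f x) (f x)) =ᵐ[volume] fun x => m x * ‖f x‖ ^ 2 := by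
    filter_upwards [hf] with x hx
    rw [real_inner_self_eq_norm_sq]
    by_cases hxρ : ‖x‖ ≤ ρ
    · rw [cut_of_le hxρ]
    · rw [hx (not_le.1 hxρ), norm_zero]; ring
  rw [quad, inner_mul (memLp_cut hm ρ)]
  exact ⟨integral_congr_ae h, (integrable_mul_inner (memLp_cut hm ρ) f f).congr h⟩

lemma continuousOn_quad {s : Set ℝ} {f : ℝ → Lp E 2 (volume : Measure (Space n))}
    (hf : ContinuousOn f s) (ρ : ℝ) (m : Space n → ℝ) : ContinuousOn (fun t => quad ρ m (f t)) s :=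
  ((mul (cut ρ m)).continuous.comp_continuousOn hf).inner hf

end Quad

variable {a b c : Space n → ℝ} {β γ R : ℝ} {q : ℝ → ℝ} {h : Space n → ℝ → ℝ} {k : ℕ}
  {u₀ u₁ : L2 n} {u : ℝ → L2 n}

/-- The energy of `∂_t^i u` in the ball of radius `ρ`. -/
def energyReal (ρ : ℝ) (b c : Space n → ℝ) (u : ℝ → L2 n) (i : ℕ) (t : ℝ) : ℝ :=
  1 / 2 * (quad ρ c (iteratedDeriv (i + 1) u t) + quad ρ b (weakGrad (iteratedDeriv i u t)))

lemma energyReal_nonneg (hb : Continuous b) (hc : Continuous c) (hb0 : ∀ x, 0 < b x)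
    (hc0 : ∀ x, 0 < c x) (ρ : ℝ) (u : ℝ → L2 n) (i : ℕ) (t : ℝ) :
    0 ≤ energyReal ρ b c u i t :=
  mul_nonneg (by norm_num) (add_nonneg (inner_mul_cut_nonneg hc (fun x => (hc0 x).le) ρ _)
    (inner_mul_cut_nonneg hb (fun x => (hb0 x).le) ρ _))

lemma TimeRegular.continuousOn_energyReal (hu : TimeRegular k u) {i : ℕ} (hi : i ≤ k) (ρ : ℝ)
    (b c : Space n → ℝ) : ContinuousOn (energyReal ρ b c u i) (Ioi 0) :=
  continuousOn_const.mul ((continuousOn_quad (hu.continuousOn (by omega)) ρ c).add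
    (continuousOn_quad (hu.2 i hi).2.2 ρ b))

/-- If the supports lie in the ball, the truncated energy is the energy. -/
lemma TimeRegular.energy_eq (hu : TimeRegular k u) (hb : Continuous b) (hc : Continuous c)
    (hb0 : ∀ x, 0 < b x) (hc0 : ∀ x, 0 < c x) {i : ℕ} (hi : i ≤ k) {t : ℝ} (ht : 0 < t) {ρ : ℝ}
    (h0 : ∀ᵐ x, ρ < ‖x‖ → iteratedDeriv i u t x = 0)
    (h1 : ∀ᵐ x, ρ < ‖x‖ → iteratedDeriv (i + 1) u t x = 0) :
    energy b c (iteratedDeriv i u) t = ENNReal.ofReal (energyReal ρ b c u i t) := by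
  have hU : IsOpen {x : Space n | ρ < ‖x‖} := isOpen_lt continuous_const continuous_norm
  have hg : ∀ᵐ x, ρ < ‖x‖ → weakGrad (iteratedDeriv i u t) x = 0 :=
    (hu.hasWeakGrad hi ht).ae_eq_zero hU h0
  obtain ⟨e1, i1⟩ := quad_eq_integral hc h1
  obtain ⟨e2, i2⟩ := quad_eq_integral hb hg
  have i3 : Integrable fun x => c x * ‖iteratedDeriv (i + 1) u t x‖ ^ 2
      + b x * ‖weakGrad (iteratedDeriv i u t) x‖ ^ 2 := i1.add i2
  rw [energyReal, e1, e2, ← integral_add i1 i2, ENNReal.ofReal_mul (by norm_num),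
    ofReal_integral_eq_lintegral_ofReal i3, energy, ← iteratedDeriv_succ]
  · congr 1
    · rw [ENNReal.ofReal_div_of_pos two_pos]; simp
    · refine lintegral_congr fun x => ?_
      simp
  · refine .of_forall fun x => ?_
    have := (hb0 x).le
    have := (hc0 x).le
    simp only [Pi.zero_apply]
    positivity

/-- The weighted norm of the source as a real number. -/
lemma IsSource.lintegral_eq (hs : IsSource q R h) (hq : IsSupportGauge b c β γ q)
    (hβγ : β + γ < 2) (ha : Continuous a) (ha0 : ∀ x, 0 < a x) {t : ℝ} (ht : 0 < t) {ρ : ℝ}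
    (h0 : ∀ i x, ρ < ‖x‖ → iteratedDeriv i (h x) t = 0) (θ : ℝ) (N : ℕ) :
    ∫⁻ x, ENNReal.ofReal ((1 + t) ^ (θ + 1) * (a x)⁻¹ *
        ∑ i ∈ Finset.range N, (1 + t) ^ (2 * i) * (iteratedDeriv i (h x) t) ^ 2)
      = ENNReal.ofReal (∑ i ∈ Finset.range N,
        (1 + t) ^ (θ + 2 * i + 1) * quad ρ (fun x => (a x)⁻¹) (src h i t)) := by
  have ha' : Continuous fun x => (a x)⁻¹ := ha.inv₀ fun x => (ha0 x).ne'
  have hz : 0 < 1 + t := by linarith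
  have hsrc : ∀ i, ∀ᵐ x, src h i t x = iteratedDeriv i (h x) t := fun i =>
    coeFn_lpOf (hs.memLp hq hβγ i ht)
  have hsupp : ∀ i, ∀ᵐ x, ρ < ‖x‖ → src h i t x = 0 := fun i => by
    filter_upwards [hsrc i] with x hx hxρ
    rw [hx, h0 i x hxρ]
  have hquad := fun i => quad_eq_integral ha' (hsupp i)
  have hint : ∀ i ∈ Finset.range N, Integrable fun x =>
      (1 + t) ^ (θ + 2 * i + 1) * ((a x)⁻¹ * ‖src h i t x‖ ^ 2) :=
    fun i _ => (hquad i).2.const_mul _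
  simp_rw [(hquad _).1, ← integral_const_mul]
  rw [← integral_finsetSum _ hint,
    ofReal_integral_eq_lintegral_ofReal (integrable_finsetSum _ hint)]
  · refine lintegral_congr_ae ?_
    filter_upwards [ae_all_iff.2 hsrc] with x hx
    congr 1
    rw [Finset.mul_sum]
    refine Finset.sum_congr rfl fun i _ => ?_
    have e : (1 + t) ^ (θ + 2 * i + 1) = (1 + t) ^ (θ + 1) * (1 + t) ^ (2 * i) := by
      rw [← Real.rpow_add_natCast hz.ne']
      congr 1; push_cast; ring
    rw [hx, e, Real.norm_eq_abs, sq_abs]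
    ring
  · refine .of_forall fun x => Finset.sum_nonneg fun i _ => ?_
    have := (ha0 x).le
    positivity

lemma lintegral_Icc_ofReal {f : ℝ → ℝ} {T₀ T : ℝ} (hT : T₀ ≤ T) (hf : ContinuousOn f (Icc T₀ T))
    (h0 : ∀ t ∈ Icc T₀ T, 0 ≤ f t) :
    ∫⁻ t in Icc T₀ T, ENNReal.ofReal (f t) = ENNReal.ofReal (∫ t in T₀..T, f t) := by
  rw [intervalIntegral.integral_of_le hT, ← integral_Icc_eq_integral_Ioc,
    ofReal_integral_eq_lintegral_ofReal hf.integrableOn_Icc]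
  exact (ae_restrict_iff' measurableSet_Icc).2 (.of_forall h0)

/-! ### From the energy of `∂_t^i u` to the energy of `∂_t^{i+1} u` -/

lemma inner_mul_cut_comm {E : Type*} [NormedAddCommGroup E] [InnerProductSpace ℝ E] (ρ : ℝ)
    (m : Space n → ℝ) (f g : Lp E 2 (volume : Measure (Space n))) :
    inner ℝ (mul (cut ρ m) f) g = inner ℝ f (mul (cut ρ m) g) :=
  inner_mul_comm _ f g

/-- The energy identity for `∂_t^i u`, for `i < k`. -/
lemma IsSolution.hasDerivAt_energyReal (hsol : IsSolution a b c h u₀ u₁ u)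
    (ha : Continuous a) (hb : Continuous b) (hc : Continuous c) (hs : IsSource q R h)
    (hq : IsSupportGauge b c β γ q) (hβγ : β + γ < 2) (hu : TimeRegular k u) {i : ℕ} (hi : i < k)
    {σ t : ℝ} (ht : 0 < t) (hsupp : ∀ᵐ x, σ < ‖x‖ → iteratedDeriv (i + 1) u t x = 0) :
    HasDerivAt (energyReal (σ + 1) b c u i) (-quad (σ + 1) a (iteratedDeriv (i + 1) u t)
      + inner ℝ (src h i t) (iteratedDeriv (i + 1) u t)) t := by
  have h1 := hasDerivAt_energy (inner_mul_cut_comm (σ + 1) c) (inner_mul_cut_comm (σ + 1) b)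
    (hu.hasDerivAt (i := i + 1) hi ht) (hu.hasDerivAt_weakGrad hi ht)
    (hsol.equation_testPairs ha hb hc hs hq hβγ hu hi ht
      (z := (iteratedDeriv (i + 1) u t, weakGrad (iteratedDeriv (i + 1) u t)))
      ⟨hu.hasWeakGrad hi ht, hsupp⟩)
  refine h1.congr_of_eventuallyEq (.of_forall fun s => ?_)
  simp only [energyReal, quad]; ring

/-- The energy and equipartition identities for `∂_t^{i+1} u`, for `i < k`. -/
lemma IsSolution.hasDerivAt_energyReal_succ (hsol : IsSolution a b c h u₀ u₁ u)
    (ha : Continuous a) (hb : Continuous b) (hc : Continuous c) (hs : IsSource q R h)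
    (hq : IsSupportGauge b c β γ q) (hβγ : β + γ < 2) (hu : TimeRegular k u) {i : ℕ} (hi : i < k)
    {σ T : ℝ}
    (hsupp : ∀ j ≤ k + 1, ∀ t ∈ Ioo 0 T, ∀ᵐ x, σ < ‖x‖ → iteratedDeriv j u t x = 0)
    {t : ℝ} (ht : t ∈ Ioo 0 T) :
    HasDerivAt (energyReal (σ + 1) b c u (i + 1)) (-quad (σ + 1) a (iteratedDeriv (i + 2) u t)
      + inner ℝ (src h (i + 1) t) (iteratedDeriv (i + 2) u t)) t ∧
    HasDerivAt (fun s => inner ℝ (mul (cut (σ + 1) c) (iteratedDeriv (i + 2) u s))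
        (iteratedDeriv (i + 1) u s) + 1 / 2 * quad (σ + 1) a (iteratedDeriv (i + 1) u s))
      (quad (σ + 1) c (iteratedDeriv (i + 2) u t)
        - quad (σ + 1) b (weakGrad (iteratedDeriv (i + 1) u t))
        + inner ℝ (src h (i + 1) t) (iteratedDeriv (i + 1) u t)) t := by
  have hI : Ioo 0 T ⊆ Ioi 0 := fun t ht => ht.1
  have hpair : ∀ j ≤ k, ∀ t ∈ Ioo 0 T,
      (iteratedDeriv j u t, weakGrad (iteratedDeriv j u t)) ∈ testPairs n σ := fun j hj t ht =>
    ⟨hu.hasWeakGrad hj ht.1, hsupp j (by omega) t ht⟩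
  have hsrcc : ContinuousOn (src h (i + 1)) (Ioo 0 T) := fun t ht =>
    (hs.hasDerivAt_src hq hβγ (i + 1) ht.1).continuousAt.continuousWithinAt
  have hV₂ := (hu.continuousOn (i := i + 2) (by omega)).mono hI
  have hG₁ := (hu.2 (i + 1) hi).2.2.mono hI
  have h1 := hasDerivAt_energy_mixed_deriv (inner_mul_cut_comm (σ + 1) a)
    (inner_mul_cut_comm (σ + 1) c) (inner_mul_cut_comm (σ + 1) b) isOpen_Ioo
    (fun t ht => hu.hasDerivAt (i := i) hi.le (hI ht))
    (fun t ht => hu.hasDerivAt (i := i + 1) hi (hI ht)) hV₂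
    (fun t ht => hu.hasDerivAt_weakGrad hi (hI ht)) hG₁
    (fun t ht => hs.hasDerivAt_src hq hβγ i (hI ht)) hsrcc (testPairs n σ)
    (hpair i hi.le) (hpair (i + 1) hi)
    (fun t ht z hz => hsol.equation_testPairs ha hb hc hs hq hβγ hu hi (hI ht) hz) ht
  refine ⟨h1.1.congr_of_eventuallyEq (.of_forall fun s => ?_), h1.2⟩
  simp only [energyReal, quad]; ring

end

section

variable {n : ℕ} {a b c : Space n → ℝ} {β γ R : ℝ} {q : ℝ → ℝ} {h : Space n → ℝ → ℝ} {k : ℕ}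
  {u₀ u₁ : L2 n} {u : ℝ → L2 n}

/-- The multiplier inequality for the solution. The hypotheses `hca` and `hac` compare the
coefficients on the support of the solution at time `t`. -/
lemma IsSolution.integral_energyReal_succ_le (hsol : IsSolution a b c h u₀ u₁ u)
    (ha : Continuous a) (hb : Continuous b) (hc : Continuous c) (ha0 : ∀ x, 0 < a x)
    (hb0 : ∀ x, 0 < b x) (hc0 : ∀ x, 0 < c x) (hs : IsSource q R h)
    (hq : IsSupportGauge b c β γ q) (hβγ : β + γ < 2) (hu : TimeRegular k u) {i : ℕ} (hi : i < k)
    {T₀ T σ p om ε A Ka τ : ℝ} (hT₀ : 0 < T₀) (hT : T₀ ≤ T) (hp : 0 ≤ p) (hom0 : 0 < om)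
    (hom : om < 1) (hε : ε = 1 / (2 * (p + 3))) (hA : A = 2 * (p + 3))
    (hz : ∀ t ∈ Icc T₀ T, (1 + t) ^ (om - 1) ≤ ε)
    (hsupp : ∀ j ≤ k + 1, ∀ t ∈ Ioo 0 (T + 1), ∀ᵐ x, σ < ‖x‖ → iteratedDeriv j u t x = 0)
    (hsupp' : ∀ j, ∀ t ∈ Icc T₀ T, ∀ x : Space n, σ < ‖x‖ → iteratedDeriv j (h x) t = 0)
    (hca : ∀ j ≤ k + 1, ∀ t ∈ Icc T₀ T, ∀ᵐ x, iteratedDeriv j u t x = 0 ∨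
      c x ≤ ε * (1 + t) ^ om * a x)
    (hac : ∀ j ≤ k + 1, ∀ t ∈ Icc T₀ T, ∀ᵐ x, iteratedDeriv j u t x = 0 ∨
      a x ≤ Ka * (1 + t) ^ τ * c x) (hKa : 0 ≤ Ka) :
    ∫ t in T₀..T, (1 + t) ^ (p + 2) * energyReal (σ + 1) b c u (i + 1) t ≤
      A * (1 + T₀) ^ (p + 1) * energyReal (σ + 1) b c u i T₀
        + 2 * (1 + T₀) ^ (p + 2 + om) * energyReal (σ + 1) b c u (i + 1) T₀
        + 2 * Ka * (1 + T₀) ^ (p + 2 + τ) * energyReal (σ + 1) b c u i T₀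
      + A * (p + 1) * (∫ t in T₀..T, (1 + t) ^ p * energyReal (σ + 1) b c u i t)
      + A * ((∫ t in T₀..T, (1 + t) ^ (p + 1) * quad (σ + 1) (fun x => (a x)⁻¹) (src h i t))
        + ∫ t in T₀..T,
          (1 + t) ^ (p + 3) * quad (σ + 1) (fun x => (a x)⁻¹) (src h (i + 1) t)) := by
  have ha' : Continuous fun x => (a x)⁻¹ := ha.inv₀ fun x => (ha0 x).ne'
  have hpos : ∀ t ∈ Icc T₀ T, 0 < t := fun t ht => hT₀.trans_le ht.1
  have hz0 : ∀ t ∈ Icc T₀ T, 0 < 1 + t := fun t ht => by linarith [hpos t ht]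
  have hIcc : ∀ t ∈ Icc T₀ T, t ∈ Ioo 0 (T + 1) := fun t ht => ⟨hpos t ht, by linarith [ht.2]⟩
  have hsrc0 : ∀ j, ∀ t ∈ Icc T₀ T, ∀ᵐ x, σ + 1 < ‖x‖ → src h j t x = 0 := fun j t ht => by
    filter_upwards [coeFn_lpOf (hs.memLp hq hβγ j (hpos t ht))] with x hx hxσ
    exact hx.trans (hsupp' j t ht x (by linarith))
  have hsrcc : ∀ j, ContinuousOn (src h j) (Ioi 0) := fun j t ht =>
    (hs.hasDerivAt_src hq hβγ j ht).continuousAt.continuousWithinAt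
  have hq0 : ∀ {m : Space n → ℝ}, Continuous m → (∀ x, 0 < m x) → ∀ f : L2 n,
      0 ≤ quad (σ + 1) m f := fun hm h0 f => inner_mul_cut_nonneg hm (fun x => (h0 x).le) _ f
  have hai : ∀ x, 0 < (a x)⁻¹ := fun x => inv_pos.2 (ha0 x)
  have hlow : ∀ t ∈ Icc T₀ T, _ := fun t ht => hsol.hasDerivAt_energyReal ha hb hc hs hq hβγ hu hi
    (hpos t ht) (hsupp (i + 1) (by omega) t (hIcc t ht))
  have hhigh : ∀ t ∈ Icc T₀ T, _ := fun t ht =>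
    hsol.hasDerivAt_energyReal_succ ha hb hc hs hq hβγ hu hi hsupp (hIcc t ht)
  have key := integral_energy_deriv_le (T₀ := T₀) (T := T) (e := energyReal (σ + 1) b c u i)
    (d := fun t => quad (σ + 1) a (iteratedDeriv (i + 1) u t))
    (s := fun t => inner ℝ (src h i t) (iteratedDeriv (i + 1) u t))
    (H := fun t => quad (σ + 1) (fun x => (a x)⁻¹) (src h i t))
    (κ := fun t => quad (σ + 1) c (iteratedDeriv (i + 2) u t))
    (g := fun t => quad (σ + 1) b (weakGrad (iteratedDeriv (i + 1) u t)))
    (x := fun t => inner ℝ (mul (cut (σ + 1) c) (iteratedDeriv (i + 2) u t))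
      (iteratedDeriv (i + 1) u t))
    (D := fun t => quad (σ + 1) a (iteratedDeriv (i + 2) u t))
    (S := fun t => inner ℝ (src h (i + 1) t) (iteratedDeriv (i + 2) u t))
    (H' := fun t => quad (σ + 1) (fun x => (a x)⁻¹) (src h (i + 1) t))
    (r := fun t => inner ℝ (src h (i + 1) t) (iteratedDeriv (i + 1) u t))
    hp hom0 hom hε hA hT₀ hT hlow
    (fun t ht => (hhigh t ht).1)
    (fun t ht => (hhigh t ht).2)
    (continuousOn_quad ((hsrcc i).mono hpos) _ _) (continuousOn_quad ((hsrcc (i + 1)).mono hpos) _ _)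
    (fun t _ => energyReal_nonneg hb hc hb0 hc0 _ u i t) (fun t _ => hq0 ha ha0 _)
    (fun t _ => hq0 hc hc0 _) (fun t _ => inner_mul_cut_nonneg hb (fun x => (hb0 x).le) _ _)
    (fun t _ => hq0 ha ha0 _) (fun t _ => hq0 ha' hai _) (fun t _ => hq0 ha' hai _)
    (fun t ht => ?_) (fun t ht => ?_) (fun t ht => ?_) (fun t ht => ?_) (fun t ht => ?_) hz
  · have hT₀m : T₀ ∈ Icc T₀ T := left_mem_Icc.2 hT
    refine key.trans ?_
    have h1 : quad (σ + 1) a (iteratedDeriv (i + 1) u T₀)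
        ≤ Ka * (1 + T₀) ^ τ * quad (σ + 1) c (iteratedDeriv (i + 1) u T₀) :=
      inner_mul_cut_le ha hc (hac (i + 1) (by omega) T₀ hT₀m)
    have h2 : quad (σ + 1) c (iteratedDeriv (i + 1) u T₀) ≤ 2 * energyReal (σ + 1) b c u i T₀ := by
      have : 0 ≤ quad (σ + 1) b (weakGrad (iteratedDeriv i u T₀)) :=
        inner_mul_cut_nonneg hb (fun x => (hb0 x).le) _ _
      simp only [energyReal]; linarith
    have hr0 : ∀ y : ℝ, (0 : ℝ) ≤ (1 + T₀) ^ y := fun y => Real.rpow_nonneg (hz0 T₀ hT₀m).le y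
    have h3 : (1 + T₀) ^ (p + 2) * quad (σ + 1) a (iteratedDeriv (i + 1) u T₀)
        ≤ 2 * Ka * (1 + T₀) ^ (p + 2 + τ) * energyReal (σ + 1) b c u i T₀ := by
      calc _ ≤ (1 + T₀) ^ (p + 2) * (Ka * (1 + T₀) ^ τ * (2 * energyReal (σ + 1) b c u i T₀)) :=
            mul_le_mul_of_nonneg_left (h1.trans (mul_le_mul_of_nonneg_left h2
              (mul_nonneg hKa (hr0 τ)))) (hr0 _)
        _ = _ := by rw [Real.rpow_add (hz0 T₀ hT₀m) (p + 2) τ]; ring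
    have h4 : 1 / 2 * (quad (σ + 1) c (iteratedDeriv (i + 2) u T₀)
        + quad (σ + 1) b (weakGrad (iteratedDeriv (i + 1) u T₀)))
        = energyReal (σ + 1) b c u (i + 1) T₀ := rfl
    simp only [h4]
    linarith
  · simpa [quad] using inner_le_damping_add_source ha ha0 one_pos (f := iteratedDeriv (i + 1) u t)
      (hsrc0 i t ht)
  · simpa [quad] using inner_le_damping_add_source ha ha0 one_pos (f := iteratedDeriv (i + 2) u t)
      (hsrc0 (i + 1) t ht)
  -- Young's inequality with parameter `z⁻¹`, as this term carries one power of `z` less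
  · simpa [quad] using inner_le_damping_add_source ha ha0 (inv_pos.2 (hz0 t ht))
      (f := iteratedDeriv (i + 1) u t) (hsrc0 (i + 1) t ht)
  -- Young's inequality with parameter `z^ω`, and then `c ≤ ε z^ω a`
  · have hzo := Real.rpow_pos_of_pos (hz0 t ht) om
    have h1 := abs_inner_mul_cut_le hc (fun x => (hc0 x).le) (σ + 1) hzo
      (iteratedDeriv (i + 2) u t) (iteratedDeriv (i + 1) u t)
    have h2 : inner ℝ (mul (cut (σ + 1) c) (iteratedDeriv (i + 1) u t)) (iteratedDeriv (i + 1) u t)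
        ≤ ε * (1 + t) ^ om * quad (σ + 1) a (iteratedDeriv (i + 1) u t) :=
      inner_mul_cut_le hc ha (hca (i + 1) (by omega) t ht)
    have h3 : ((1 + t) ^ om)⁻¹ * (ε * (1 + t) ^ om * quad (σ + 1) a (iteratedDeriv (i + 1) u t))
        = ε * quad (σ + 1) a (iteratedDeriv (i + 1) u t) := by
      field_simp
    have h4 := mul_le_mul_of_nonneg_left h2 (inv_pos.2 hzo).le
    rw [h3] at h4
    simp only [quad] at h4 ⊢
    linarith
  · exact inner_mul_cut_le hc ha (hca (i + 2) (by omega) t ht)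

end

/-! ### The choice of constants -/

section

lemma exists_const_of_recurrence {C₁ : ℝ} (hC₁ : 0 ≤ C₁) (k : ℕ) : ∃ C : ℝ, 0 < C ∧
    ∀ (X : ℕ → ℝ) (Y : ℝ), 0 ≤ Y → X 0 ≤ Y → (∀ i < k, X (i + 1) ≤ C₁ * (Y + X i)) → X k ≤ C * Y := by
  induction k with
  | zero => exact ⟨1, one_pos, fun X Y _ h _ => by simpa using h⟩
  | succ k ih =>
    obtain ⟨C, hC, h⟩ := ih
    refine ⟨C₁ * (1 + C) + 1, by positivity, fun X Y hY h0 hX => ?_⟩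
    have h1 := h X Y hY h0 fun i hi => hX i (by omega)
    have h2 : C₁ * (Y + X k) ≤ C₁ * (Y + C * Y) := by gcongr
    linarith [hX k (by omega)]

/-- The terms of the multiplier inequality, with constants that are uniform in `p ≤ B / 2 - 3`. -/
lemma recurrence_step {B p K P₁ P₂ P₃ X₀ X X' J J' N : ℝ} (hp : 0 ≤ p) (hpB : 2 * (p + 3) ≤ B)
    (hK : 0 ≤ K) (hX₀ : 0 ≤ X₀) (hX : 0 ≤ X) (hJ : 0 ≤ J) (hP₁ : 0 ≤ P₁) (h₁ : P₁ ≤ N)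
    (h₂ : P₂ ≤ N) (h₃ : P₃ ≤ N) (hJ' : J ≤ J')
    (h : X' ≤ 2 * (p + 3) * P₁ + 2 * P₂ + 2 * K * P₃ + 2 * (p + 3) * (p + 1) * X
      + 2 * (p + 3) * J) :
    X' ≤ (B * B + B + 2 + 2 * K) * (N + X₀ + J' + X) := by
  have hN : 0 ≤ N := hP₁.trans h₁
  have hB : 0 ≤ B := by linarith
  have hJ'0 : 0 ≤ J' := hJ.trans hJ'
  have s1 : 2 * (p + 3) * P₁ ≤ B * N := mul_le_mul hpB h₁ hP₁ hB
  have s2 : 2 * (p + 3) * (p + 1) * X ≤ B * B * X :=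
    mul_le_mul_of_nonneg_right (mul_le_mul hpB (by linarith) (by linarith) hB) hX
  have s3 : 2 * (p + 3) * J ≤ B * J' := mul_le_mul hpB hJ' hJ hB
  have s4 : 2 * K * P₃ ≤ 2 * K * N := mul_le_mul_of_nonneg_left h₃ (by positivity)
  have r1 : 0 ≤ B * B * (N + X₀ + J') := by positivity
  have r2 : 0 ≤ (B + 2 + 2 * K) * (X₀ + X) := by positivity
  have r3 : 0 ≤ (2 + 2 * K) * J' := by positivity
  linarith

/-- The time from which the weights beat the constants. -/
lemma exists_time {K ω' om ε : ℝ} (hω' : ω' < om) (hom : om < 1) (hε : 0 < ε) :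
    ∃ T : ℝ, 0 < T ∧ ∀ t, T ≤ t →
      (1 + t) ^ (om - 1) ≤ ε ∧ K * (1 + t) ^ ω' ≤ ε * (1 + t) ^ om := by
  have h0 : Filter.Tendsto (fun t : ℝ => 1 + t) Filter.atTop Filter.atTop :=
    Filter.tendsto_atTop_add_const_left _ _ Filter.tendsto_id
  have h1 := ((tendsto_rpow_neg_atTop (sub_pos.2 hom)).comp h0).eventually_le_const hε
  have h2 := (((tendsto_rpow_neg_atTop (sub_pos.2 hω')).comp h0).const_mul K).eventually_le_const
    (by simpa using hε)
  obtain ⟨T, hT⟩ := Filter.eventually_atTop.1 (h1.and h2)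
  refine ⟨max T 1, by positivity, fun t ht => ?_⟩
  have hz : 0 < 1 + t := by linarith [(le_max_right T 1).trans ht]
  obtain ⟨h3, h4⟩ := hT t ((le_max_left _ _).trans ht)
  simp only [Function.comp] at h3 h4
  refine ⟨by simpa using h3, ?_⟩
  have h5 : (1 + t) ^ ω' = (1 + t) ^ (-(om - ω')) * (1 + t) ^ om := by
    rw [← Real.rpow_add hz]; congr 1; ring
  rw [h5, ← mul_assoc]
  exact mul_le_mul_of_nonneg_right h4 (Real.rpow_nonneg hz.le _)

variable {n : ℕ} {a b c : Space n → ℝ} {α β γ a₀ a₁ b₀ b₁ c₀ c₁ R : ℝ} {q : ℝ → ℝ}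
  {h : Space n → ℝ → ℝ} {k : ℕ} {u₀ u₁ : L2 n} {u : ℝ → L2 n}

/-- `PowerBounds.le_mul` with the exponents of the theorem. -/
lemma PowerBounds.le_mul_neg {f g : Space n → ℝ} {m M m' M' s s' : ℝ}
    (hf : PowerBounds f m M (-s)) (hg : PowerBounds g m' M' (-s')) (hβγ : β + γ < 2) {L z : ℝ}
    (hL : 0 < L) (hz : 1 ≤ z) {x : Space n} (hx : 1 + ‖x‖ ≤ L * z ^ (2 / (2 - β - γ))) :
    f x ≤ M / m' * L ^ max 0 (s' - s) * z ^ max 0 (2 * (s' - s) / (2 - β - γ)) * g x := by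
  have hm : 0 < 2 - β - γ := by linarith
  have h1 := hf.le_mul hg hL hz hx
  have h2 : 2 / (2 - β - γ) * max 0 (s' - s) = max 0 (2 * (s' - s) / (2 - β - γ)) := by
    rw [mul_max_of_nonneg _ _ (by positivity), mul_zero, div_mul_eq_mul_div]
  rwa [show -s - -s' = s' - s by ring, h2] at h1

/-- The weighted estimate for real valued energies in a ball that contains the supports at all
times `t < T + 1`. The constants do not depend on the solution. -/
lemma exists_integral_energyReal_le (hn : 1 ≤ n) (ha : Continuous a) (hb : Continuous b)
    (hc : Continuous c) (ha_bd : PowerBounds a a₀ a₁ (-α)) (hb_bd : PowerBounds b b₀ b₁ β)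
    (hc_bd : PowerBounds c c₀ c₁ (-γ)) (hβγ : β + γ < 2) (hq : IsSupportGauge b c β γ q)
    (hR : 0 ≤ R) {θ om : ℝ} (hθ : 0 < θ) (hom_gt : max 0 (2 * (α - γ) / (2 - β - γ)) < om)
    (hom_lt : om < 1) (hk : 0 < k) :
    ∃ Tstar C : ℝ, 0 < Tstar ∧ 0 < C ∧ ∀ T₀ T σ : ℝ, Tstar ≤ T₀ → T₀ ≤ T →
      ∀ (h : Space n → ℝ → ℝ) (u₀ u₁ : L2 n) (u : ℝ → L2 n), IsSource q R h →
        (∀ᵐ x, R < ‖x‖ → u₀ x = 0) → (∀ᵐ x, R < ‖x‖ → u₁ x = 0) →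
        IsSolution a b c h u₀ u₁ u → TimeRegular k u →
        (∀ j ≤ k + 1, ∀ t ∈ Ioo 0 (T + 1), ∀ᵐ x, σ < ‖x‖ → iteratedDeriv j u t x = 0) →
        (∀ j, ∀ t ∈ Ioo 0 (T + 1), ∀ x : Space n, σ < ‖x‖ → iteratedDeriv j (h x) t = 0) →
        ∫ t in T₀..T, (1 + t) ^ (θ + 2 * k) * energyReal (σ + 1) b c u k t ≤
          C * ((1 + T₀) ^ (2 * k + max 0 (2 * (γ - α) / (2 - β - γ) - om)) * (1 + T₀) ^ (θ + om) *
              ∑ i ∈ Finset.range (k + 1), energyReal (σ + 1) b c u i T₀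
            + (∫ t in T₀..T, (1 + t) ^ θ * energyReal (σ + 1) b c u 0 t)
            + ∫ t in T₀..T, ∑ i ∈ Finset.range (k + 1), (1 + t) ^ (θ + 2 * i + 1) *
              quad (σ + 1) (fun x => (a x)⁻¹) (src h i t)) := by
  have ha0 := ha_bd.pos
  have hb0 := hb_bd.pos
  have hc0 := hc_bd.pos
  have ha' : Continuous fun x => (a x)⁻¹ := ha.inv₀ fun x => (ha0 x).ne'
  obtain ⟨L, hL, hbound⟩ := hq.exists_bound hβγ hR
  set τ : ℝ := max 0 (2 * (γ - α) / (2 - β - γ)) with hτ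
  set ε : ℝ := 1 / (2 * (θ + 2 * k + 3)) with hε
  have hε0 : 0 < ε := by positivity
  set Ka : ℝ := a₁ / c₀ * L ^ max 0 (γ - α) with hKa
  have hKa0 : 0 ≤ Ka := by
    have := ha_bd.2.1
    have := hc_bd.1
    positivity
  obtain ⟨Tstar, hTs, hTstar⟩ := exists_time (K := c₁ / a₀ * L ^ max 0 (α - γ)) hom_gt hom_lt hε0
  -- one choice of `ε = 1 / B` for all levels `i < k`, as `p = θ + 2i` stays below `θ + 2k`
  set B : ℝ := 2 * (θ + 2 * k + 3) with hB
  have hB2 : 2 ≤ B := by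
    have : (0 : ℝ) ≤ k := by positivity
    linarith
  set C₁ : ℝ := B * B + B + 2 + 2 * Ka with hC₁
  have hC₁0 : 0 ≤ C₁ := by positivity
  obtain ⟨C, hC, hrec⟩ := exists_const_of_recurrence hC₁0 k
  refine ⟨Tstar, C, hTs, hC, ?_⟩
  intro T₀ T σ hT₀s hT h u₀ u₁ u hs hu₀ hu₁ hsol hu hsupp hsupp'
  have hT₀ : 0 < T₀ := hTs.trans_le hT₀s
  have hpos : ∀ t ∈ Icc T₀ T, 0 < t := fun t ht => hT₀.trans_le ht.1
  have hIcc : ∀ t ∈ Icc T₀ T, t ∈ Ioo 0 (T + 1) := fun t ht => ⟨hpos t ht, by linarith [ht.2]⟩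
  have hz0 : 0 < 1 + T₀ := by linarith
  have hz1 : 1 ≤ 1 + T₀ := by linarith
  have hpc : ∀ y : ℝ, ContinuousOn (fun t : ℝ => (1 + t) ^ y) (Icc T₀ T) := fun y =>
    (continuousOn_const.add continuousOn_id).rpow_const fun t ht =>
      Or.inl (add_pos one_pos (hpos t ht)).ne'
  have hw0 : ∀ y : ℝ, ∀ t ∈ Icc T₀ T, (0 : ℝ) ≤ (1 + t) ^ y := fun y t ht =>
    Real.rpow_nonneg (by linarith [hpos t ht]) _
  have hE0 : ∀ i t, 0 ≤ energyReal (σ + 1) b c u i t :=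
    energyReal_nonneg hb hc hb0 hc0 (σ + 1) u
  have hH0 : ∀ i t, 0 ≤ quad (σ + 1) (fun x => (a x)⁻¹) (src h i t) := fun i t =>
    inner_mul_cut_nonneg ha' (fun x => (inv_pos.2 (ha0 x)).le) _ _
  -- comparison of the coefficients on the support of `u`
  have hloc : ∀ j ≤ k + 1, ∀ t ∈ Icc T₀ T, ∀ᵐ x, iteratedDeriv j u t x = 0 ∨
      1 + ‖x‖ ≤ L * (1 + t) ^ (2 / (2 - β - γ)) := by
    intro j hj t ht
    filter_upwards [hsol.iteratedDeriv_ae_eq_zero hn hR ha hb hc ha0 hb0 hc0 hs hq hβγ hu hk hu₀ hu₁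
      hj (hpos t ht) (lt_add_one t)] with x hx
    by_cases hxq : t + 1 + q R < q ‖x‖
    · exact Or.inl (hx hxq)
    · exact Or.inr (hbound t ‖x‖ (hpos t ht).le (norm_nonneg x) (not_lt.1 hxq))
  have hca : ∀ j ≤ k + 1, ∀ t ∈ Icc T₀ T, ∀ᵐ x, iteratedDeriv j u t x = 0 ∨
      c x ≤ ε * (1 + t) ^ om * a x := by
    intro j hj t ht
    filter_upwards [hloc j hj t ht] with x hx
    refine hx.imp_right fun hx => ?_
    have h1 := hc_bd.le_mul_neg ha_bd hβγ hL (by linarith [hpos t ht]) hx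
    exact h1.trans (mul_le_mul_of_nonneg_right (hTstar t (hT₀s.trans ht.1)).2 (ha0 x).le)
  have hac : ∀ j ≤ k + 1, ∀ t ∈ Icc T₀ T, ∀ᵐ x, iteratedDeriv j u t x = 0 ∨
      a x ≤ Ka * (1 + t) ^ τ * c x := by
    intro j hj t ht
    filter_upwards [hloc j hj t ht] with x hx
    exact hx.imp_right fun hx => ha_bd.le_mul_neg hc_bd hβγ hL (by linarith [hpos t ht]) hx
  -- `X i` satisfies the recurrence that the multiplier inequality provides
  set X : ℕ → ℝ := fun i => ∫ t in T₀..T, (1 + t) ^ (θ + 2 * i) * energyReal (σ + 1) b c u i t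
    with hX
  set Z : ℝ := (1 + T₀) ^ (2 * k + max 0 (2 * (γ - α) / (2 - β - γ) - om)) * (1 + T₀) ^ (θ + om)
    with hZ
  have hZ0 : 0 ≤ Z := by positivity
  set S₀ : ℝ := ∑ i ∈ Finset.range (k + 1), energyReal (σ + 1) b c u i T₀ with hSdef
  set J : ℕ → ℝ := fun i => ∫ t in T₀..T, (1 + t) ^ (θ + 2 * i + 1) *
    quad (σ + 1) (fun x => (a x)⁻¹) (src h i t) with hJ
  have hJsum : ∫ t in T₀..T, ∑ i ∈ Finset.range (k + 1), (1 + t) ^ (θ + 2 * i + 1) *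
      quad (σ + 1) (fun x => (a x)⁻¹) (src h i t) = ∑ i ∈ Finset.range (k + 1), J i := by
    refine intervalIntegral.integral_finsetSum fun i _ => ?_
    refine ContinuousOn.intervalIntegrable_of_Icc hT ((hpc _).mul (continuousOn_quad ?_ _ _))
    exact fun t ht => (hs.hasDerivAt_src hq hβγ i (hpos t ht)).continuousAt.continuousWithinAt
  have hJ0 : ∀ i, 0 ≤ J i := fun i => intervalIntegral.integral_nonneg hT fun t ht =>
    mul_nonneg (hw0 _ t ht) (hH0 i t)
  have hX0 : ∀ i, 0 ≤ X i := fun i => intervalIntegral.integral_nonneg hT fun t ht =>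
    mul_nonneg (hw0 _ t ht) (hE0 i t)
  have hES : ∀ i ≤ k, energyReal (σ + 1) b c u i T₀ ≤ S₀ := fun i hi =>
    Finset.single_le_sum (f := fun i => energyReal (σ + 1) b c u i T₀) (fun j _ => hE0 j T₀)
      (Finset.mem_range.2 (by omega))
  have hS₀ : 0 ≤ S₀ := (hE0 0 T₀).trans (hES 0 (by omega))
  have hJs0 : 0 ≤ ∑ i ∈ Finset.range (k + 1), J i := Finset.sum_nonneg fun i _ => hJ0 i
  have hXz : X 0 = ∫ t in T₀..T, (1 + t) ^ θ * energyReal (σ + 1) b c u 0 t := by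
    simp [hX]
  rw [hJsum, ← hXz]
  refine hrec X _ (by have := hX0 0; positivity) ?_ fun i hi => ?_
  · have : 0 ≤ Z * S₀ := by positivity
    linarith
  have hik : (i : ℝ) + 1 ≤ k := by exact_mod_cast hi
  set p : ℝ := θ + 2 * i with hp
  have hi0 : (0 : ℝ) ≤ i := by positivity
  have hp0 : 0 < p := by positivity
  have hpB : 2 * (p + 3) ≤ B := by rw [hp, hB]; linarith
  have hεp : ε ≤ 1 / (2 * (p + 3)) := one_div_le_one_div_of_le (by positivity) hpB
  have hom0 : 0 < om := (le_max_left _ _).trans_lt hom_gt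
  have key := hsol.integral_energyReal_succ_le (k := k) (T₀ := T₀) (T := T) (σ := σ) (p := p)
    (om := om) (Ka := Ka) (τ := τ) ha hb hc ha0 hb0 hc0 hs hq hβγ hu hi hT₀ hT hp0.le hom0 hom_lt
    rfl rfl (fun t ht => (hTstar t (hT₀s.trans ht.1)).1.trans hεp) hsupp
    (fun j t ht => hsupp' j t (hIcc t ht))
    (fun j hj t ht => by
      filter_upwards [hca j hj t ht] with x hx
      refine hx.imp_right fun hx => hx.trans ?_
      exact mul_le_mul_of_nonneg_right (mul_le_mul_of_nonneg_right hεp (hw0 _ t ht)) (ha0 x).le)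
    hac hKa0
  have e1 : p + 2 = θ + 2 * ((i + 1 : ℕ) : ℝ) := by rw [hp]; push_cast; ring
  have e2 : p + 3 = θ + 2 * ((i + 1 : ℕ) : ℝ) + 1 := by rw [hp]; push_cast; ring
  have k1 : ∫ t in T₀..T, (1 + t) ^ (p + 2) * energyReal (σ + 1) b c u (i + 1) t = X (i + 1) := by
    rw [e1]
  have k2 : ∫ t in T₀..T, (1 + t) ^ (p + 3) * quad (σ + 1) (fun x => (a x)⁻¹) (src h (i + 1) t)
      = J (i + 1) := by
    rw [e2]
  have k3 : ∫ t in T₀..T, (1 + t) ^ (p + 1) * quad (σ + 1) (fun x => (a x)⁻¹) (src h i t) = J i :=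
    rfl
  have k4 : ∫ t in T₀..T, (1 + t) ^ p * energyReal (σ + 1) b c u i t = X i := rfl
  rw [k1, k2, k3, k4] at key
  -- all powers of `1 + T₀` are dominated by the largest one
  have hpow : ∀ y : ℝ, y ≤ p + 2 + max om τ → (1 + T₀) ^ y ≤ Z := by
    intro y hy
    rw [hZ, ← Real.rpow_add hz0]
    refine Real.rpow_le_rpow_of_exponent_le hz1 (hy.trans ?_)
    have h1 : max om τ ≤ max 0 (2 * (γ - α) / (2 - β - γ) - om) + om := by
      rw [hτ]
      refine max_le ?_ (max_le ?_ ?_)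
      · linarith [le_max_left 0 (2 * (γ - α) / (2 - β - γ) - om)]
      · linarith [le_max_left 0 (2 * (γ - α) / (2 - β - γ) - om)]
      · linarith [le_max_right 0 (2 * (γ - α) / (2 - β - γ) - om)]
    rw [hp]
    linarith
  have hterm : ∀ {y : ℝ} {j : ℕ}, y ≤ p + 2 + max om τ → j ≤ k →
      (1 + T₀) ^ y * energyReal (σ + 1) b c u j T₀ ≤ Z * S₀ := fun hy hj =>
    mul_le_mul (hpow _ hy) (hES _ hj) (hE0 _ _) hZ0
  have hmom := le_max_left om τ
  have hmτ := le_max_right om τ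
  have t1 : (1 + T₀) ^ (p + 1) * energyReal (σ + 1) b c u i T₀ ≤ Z * S₀ :=
    hterm (by linarith) hi.le
  have t2 : (1 + T₀) ^ (p + 2 + om) * energyReal (σ + 1) b c u (i + 1) T₀ ≤ Z * S₀ :=
    hterm (by linarith) hi
  have t3 : (1 + T₀) ^ (p + 2 + τ) * energyReal (σ + 1) b c u i T₀ ≤ Z * S₀ :=
    hterm (by linarith) hi.le
  have t4 : J i + J (i + 1) ≤ ∑ i ∈ Finset.range (k + 1), J i := by
    have h1 : J i + J (i + 1) = ∑ j ∈ {i, i + 1}, J j := by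
      rw [Finset.sum_pair (by omega)]
    rw [h1]
    refine Finset.sum_le_sum_of_subset_of_nonneg (fun j hj => ?_) fun j _ _ => hJ0 j
    simp only [Finset.mem_insert, Finset.mem_singleton] at hj
    exact Finset.mem_range.2 (by omega)
  refine recurrence_step hp0.le hpB hKa0 (hX0 0) (hX0 i) (add_nonneg (hJ0 _) (hJ0 _))
    (mul_nonneg (Real.rpow_nonneg hz0.le _) (hE0 _ _)) t1 t2 t3 t4 ?_
  linarith

end

end DampedWave

end

/-! ### The weighted energy estimate -/

theorem proposition3p2 {n : ℕ} (hn : 1 ≤ n)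
    (a b c : DampedWave.Space n → ℝ)
    (ha : ContDiff ℝ ∞ a) (hb : ContDiff ℝ ∞ b) (hc : ContDiff ℝ ∞ c)
    (α β γ a₀ a₁ b₀ b₁ c₀ c₁ : ℝ)
    (ha_bd : DampedWave.PowerBounds a a₀ a₁ (-α))
    (hb_bd : DampedWave.PowerBounds b b₀ b₁ β)
    (hc_bd : DampedWave.PowerBounds c c₀ c₁ (-γ))
    (hβγ : β + γ < 2) (hαβγ : 2 * α + β - γ < 2)
    (q : ℝ → ℝ) (hq : DampedWave.IsSupportGauge b c β γ q)
    (R : ℝ) (hR : 0 ≤ R)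
    (θ om ν : ℝ) (hθ : 0 < θ)
    (hom_gt : max 0 (2 * (α - γ) / (2 - β - γ)) < om) (hom_lt : om < 1) (hν : ν = θ + om)
    (k : ℕ) :
    ∃ Tstar C : ℝ, 0 < Tstar ∧ 0 < C ∧
      ∀ T₀ T : ℝ, Tstar ≤ T₀ → T₀ ≤ T →
      ∀ (h : DampedWave.Space n → ℝ → ℝ) (u₀ u₁ : DampedWave.L2 n) (u : ℝ → DampedWave.L2 n),
        DampedWave.IsSource q R h →
        DampedWave.MemH1 u₀ →
        (∀ᵐ x, R < ‖x‖ → u₀ x = 0) →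
        (∀ᵐ x, R < ‖x‖ → u₁ x = 0) →
        DampedWave.IsSolution a b c h u₀ u₁ u →
        DampedWave.TimeRegular k u →
        ∫⁻ t in Icc T₀ T, ENNReal.ofReal ((1 + t) ^ (θ + 2 * k)) *
            DampedWave.energy b c (iteratedDeriv k u) t
          ≤ ENNReal.ofReal C *
            (ENNReal.ofReal
                ((1 + T₀) ^ (2 * k + max 0 (2 * (γ - α) / (2 - β - γ) - om)) * (1 + T₀) ^ ν) *
                ∑ i ∈ Finset.range (k + 1), DampedWave.energy b c (iteratedDeriv i u) T₀
              + (∫⁻ t in Icc T₀ T, ENNReal.ofReal ((1 + t) ^ θ) * DampedWave.energy b c u t)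
              + ∫⁻ t in Icc T₀ T, ∫⁻ x, ENNReal.ofReal ((1 + t) ^ (θ + 1) * (a x)⁻¹ *
                  ∑ i ∈ Finset.range (k + 1),
                    (1 + t) ^ (2 * i) * (iteratedDeriv i (h x) t) ^ 2)) := by
  subst hν
  rcases Nat.eq_zero_or_pos k with rfl | hk
  -- for `k = 0` the left hand side is the second term on the right
  · refine ⟨1, 1, one_pos, one_pos, fun T₀ T _ _ h u₀ u₁ u _ _ _ _ _ _ => ?_⟩
    simp only [ENNReal.ofReal_one, one_mul, Nat.cast_zero, mul_zero, add_zero, iteratedDeriv_zero]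
    exact le_add_right le_add_self
  obtain ⟨Tstar, C, hTs, hC, hmain⟩ := DampedWave.exists_integral_energyReal_le hn ha.continuous
    hb.continuous hc.continuous ha_bd hb_bd hc_bd hβγ hq hR hθ hom_gt hom_lt hk
  refine ⟨Tstar, C, hTs, hC, ?_⟩
  intro T₀ T hT₀s hT h u₀ u₁ u hs _ hu₀ hu₁ hsol hu
  have ha0 := ha_bd.pos
  have hb0 := hb_bd.pos
  have hc0 := hc_bd.pos
  have ha' : Continuous fun x => (a x)⁻¹ := ha.continuous.inv₀ fun x => (ha0 x).ne'
  have hT₀ : 0 < T₀ := hTs.trans_le hT₀s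
  have hpos : ∀ t ∈ Icc T₀ T, 0 < t := fun t ht => hT₀.trans_le ht.1
  have hIcc : ∀ t ∈ Icc T₀ T, t ∈ Ioo 0 (T + 1) := fun t ht => ⟨hpos t ht, by linarith [ht.2]⟩
  have hT₀m : T₀ ∈ Icc T₀ T := left_mem_Icc.2 hT
  -- a ball that contains the supports at all times `t < T + 1`
  obtain ⟨σ, -, hσ⟩ := hq.exists_radius hβγ (T + 1 + q R)
  have hsupp : ∀ j ≤ k + 1, ∀ t ∈ Ioo 0 (T + 1),
      ∀ᵐ x, σ < ‖x‖ → iteratedDeriv j u t x = 0 := fun j hj t ht => by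
    filter_upwards [hsol.iteratedDeriv_ae_eq_zero hn hR ha.continuous hb.continuous hc.continuous
      ha0 hb0 hc0 hs hq hβγ hu hk hu₀ hu₁ hj ht.1 ht.2] with x hx hxσ using hx (hσ x hxσ)
  have hsupp' : ∀ j, ∀ t ∈ Ioo 0 (T + 1), ∀ x : DampedWave.Space n, σ < ‖x‖ →
      iteratedDeriv j (h x) t = 0 := fun j t ht x hx =>
    hs.iteratedDeriv_eq_zero j ht.1 (by linarith [hσ x hx, ht.2])
  have key := hmain T₀ T σ hT₀s hT h u₀ u₁ u hs hu₀ hu₁ hsol hu hsupp hsupp'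
  have hE0 := DampedWave.energyReal_nonneg hb.continuous hc.continuous hb0 hc0 (σ + 1) u
  have hw0 : ∀ y : ℝ, ∀ t ∈ Icc T₀ T, (0 : ℝ) ≤ (1 + t) ^ y := fun y t ht =>
    Real.rpow_nonneg (by linarith [hpos t ht]) _
  have hpc : ∀ y : ℝ, ContinuousOn (fun t : ℝ => (1 + t) ^ y) (Icc T₀ T) := fun y =>
    (continuousOn_const.add continuousOn_id).rpow_const fun t ht =>
      Or.inl (add_pos one_pos (hpos t ht)).ne'
  have henergy : ∀ i ≤ k, ∀ t ∈ Icc T₀ T, DampedWave.energy b c (iteratedDeriv i u) t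
      = ENNReal.ofReal (DampedWave.energyReal (σ + 1) b c u i t) := fun i hi t ht => by
    refine hu.energy_eq hb.continuous hc.continuous hb0 hc0 hi (hpos t ht) ?_ ?_
    · filter_upwards [hsupp i (by omega) t (hIcc t ht)] with x hx hxσ using hx (by linarith)
    · filter_upwards [hsupp (i + 1) (by omega) t (hIcc t ht)] with x hx hxσ using hx (by linarith)
  have hint : ∀ (y : ℝ), ∀ i ≤ k, ∫⁻ t in Icc T₀ T, ENNReal.ofReal ((1 + t) ^ y) *
      DampedWave.energy b c (iteratedDeriv i u) t
      = ENNReal.ofReal (∫ t in T₀..T, (1 + t) ^ y * DampedWave.energyReal (σ + 1) b c u i t) := by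
    intro y i hi
    rw [← DampedWave.lintegral_Icc_ofReal
      (f := fun t => (1 + t) ^ y * DampedWave.energyReal (σ + 1) b c u i t) hT
      ((hpc y).mul ((hu.continuousOn_energyReal hi _ b c).mono hpos))
      fun t ht => mul_nonneg (hw0 y t ht) (hE0 i t)]
    refine setLIntegral_congr_fun measurableSet_Icc fun t ht => ?_
    simp only [henergy i hi t ht]
    rw [ENNReal.ofReal_mul (hw0 y t ht)]
  have hsum : ∑ i ∈ Finset.range (k + 1), DampedWave.energy b c (iteratedDeriv i u) T₀
      = ENNReal.ofReal (∑ i ∈ Finset.range (k + 1),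
        DampedWave.energyReal (σ + 1) b c u i T₀) := by
    rw [ENNReal.ofReal_sum_of_nonneg fun i _ => hE0 i T₀]
    exact Finset.sum_congr rfl fun i hi =>
      henergy i (Nat.lt_succ_iff.1 (Finset.mem_range.1 hi)) T₀ hT₀m
  have hH0 : ∀ i, ∀ t ∈ Icc T₀ T, 0 ≤ (1 + t) ^ (θ + 2 * (i : ℕ) + 1) *
      DampedWave.quad (σ + 1) (fun x => (a x)⁻¹) (DampedWave.src h i t) := fun i t ht =>
    mul_nonneg (hw0 _ t ht)
      (DampedWave.inner_mul_cut_nonneg ha' (fun x => (inv_pos.2 (ha0 x)).le) _ _)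
  have hsrc : ∫⁻ t in Icc T₀ T, ∫⁻ x, ENNReal.ofReal ((1 + t) ^ (θ + 1) * (a x)⁻¹ *
      ∑ i ∈ Finset.range (k + 1), (1 + t) ^ (2 * i) * (iteratedDeriv i (h x) t) ^ 2)
      = ENNReal.ofReal (∫ t in T₀..T, ∑ i ∈ Finset.range (k + 1), (1 + t) ^ (θ + 2 * i + 1) *
        DampedWave.quad (σ + 1) (fun x => (a x)⁻¹) (DampedWave.src h i t)) := by
    rw [← DampedWave.lintegral_Icc_ofReal
      (f := fun t => ∑ i ∈ Finset.range (k + 1), (1 + t) ^ (θ + 2 * i + 1) *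
        DampedWave.quad (σ + 1) (fun x => (a x)⁻¹) (DampedWave.src h i t)) hT
      (continuousOn_finsetSum _ fun i _ => (hpc _).mul (DampedWave.continuousOn_quad
        (fun t ht => (hs.hasDerivAt_src hq hβγ i (hpos t ht)).continuousAt.continuousWithinAt) _ _))
      fun t ht => Finset.sum_nonneg fun i _ => hH0 i t ht]
    refine setLIntegral_congr_fun measurableSet_Icc fun t ht => ?_
    exact hs.lintegral_eq hq hβγ ha.continuous ha0 (hpos t ht)
      (fun i x hx => hsupp' i t (hIcc t ht) x (by linarith)) θ (k + 1)
  have h0 := hint θ 0 (Nat.zero_le k)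
  rw [iteratedDeriv_zero] at h0
  rw [hint _ k le_rfl, h0, hsum, hsrc]
  have p1 : 0 ≤ (1 + T₀) ^ (2 * k + max 0 (2 * (γ - α) / (2 - β - γ) - om))
      * (1 + T₀) ^ (θ + om) := mul_nonneg (hw0 _ T₀ hT₀m) (hw0 _ T₀ hT₀m)
  have p2 : 0 ≤ ∑ i ∈ Finset.range (k + 1), DampedWave.energyReal (σ + 1) b c u i T₀ :=
    Finset.sum_nonneg fun i _ => hE0 i T₀
  have p3 : 0 ≤ ∫ t in T₀..T, (1 + t) ^ θ * DampedWave.energyReal (σ + 1) b c u 0 t :=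
    intervalIntegral.integral_nonneg hT fun t ht => mul_nonneg (hw0 θ t ht) (hE0 0 t)
  have p4 : 0 ≤ ∫ t in T₀..T, ∑ i ∈ Finset.range (k + 1), (1 + t) ^ (θ + 2 * i + 1) *
      DampedWave.quad (σ + 1) (fun x => (a x)⁻¹) (DampedWave.src h i t) :=
    intervalIntegral.integral_nonneg hT fun t ht => Finset.sum_nonneg fun i _ => hH0 i t ht
  rw [← ENNReal.ofReal_mul p1, ← ENNReal.ofReal_add (mul_nonneg p1 p2) p3,
    ← ENNReal.ofReal_add (add_nonneg (mul_nonneg p1 p2) p3) p4, ← ENNReal.ofReal_mul hC.le]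
  exact ENNReal.ofReal_le_ofReal key
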